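/- Let $\Omega\subset\mathbb R^N$ be a bounded, open, connected and simply connected set with smooth boundary, let $T>0$, $p\in(1,\infty)$ and $\frac1p+\frac1q=1$. Let $\rho_0\in L^p(\Omega)$ and let $u\in L^1(0,T;W^{1,q}_0(\Omega)^N)$ satisfy $\nabla\cdot u=0$, i.e. for almost every $t\in(0,T)$, $\int_\Omega u(t)\cdot\nabla\varphi\,dx=0$ for all $\varphi\in C_c^\infty(\Omega)$; here $W^{1,q}_0(\Omega)$ is the closure of $C_c^\infty(\Omega)$ in the Sobolev space $W^{1,q}(\Omega)$. Let $\rho\in L^\infty(0,T;L^p(\Omega))$ be a weak solution of $$\rho_t-u\cdot\nabla\rho=0\ \text{ in }(0,T)\times\Omega,\qquad \rho(0)=\rho_0,$$ that is, $$-\int_0^T\!\int_\Omega\rho\,\phi_t\,dx\,dt-\int_\Omega\rho_0(x)\,\phi(0,x)\,dx+\int_0^T\!\int_\Omega\rho\,(u\cdot\nabla\phi)\,dx\,dt=0$$ for every smooth $\phi$ on $[0,T]\times\Omega$ with compact support in $[0,T)\times\Omega$. Then $\rho\in C([0,T];L^p(\Omega))$: after modification on a null set of times, $\rho$ is a continuous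 map from $[0,T]$ to $L^p(\Omega)$ with its norm. -/

import Mathlib

set_option maxSynthPendingDepth 3

open MeasureTheory Set Filter Topology TopologicalSpace
open scoped ENNReal ContDiff Distributions

noncomputable section

/-- The boundary of `Ω` is smooth: near each boundary point `x`, the set `Ω` is the region `g < 0`
for a smooth function `g` whose differential at `x` does not vanish. -/
def HasSmoothBoundary {N : ℕ} (Ω : Set (EuclideanSpace ℝ (Fin N))) : Prop :=
  ∀ x ∈ frontier Ω, ∃ (U : Set (EuclideanSpace ℝ (Fin N))) (g : EuclideanSpace ℝ (Fin N) → ℝ),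
    IsOpen U ∧ x ∈ U ∧ ContDiffOn ℝ ∞ g U ∧ fderiv ℝ g x ≠ 0 ∧ Ω ∩ U = {y ∈ U | g y < 0}

/-- Bounded, connected and simply connected open sets with smooth boundary. -/
structure IsSmoothDomain {N : ℕ} (Ω : Opens (EuclideanSpace ℝ (Fin N))) : Prop where
  isBounded : Bornology.IsBounded (Ω : Set (EuclideanSpace ℝ (Fin N)))
  isConnected : IsConnected (Ω : Set (EuclideanSpace ℝ (Fin N)))
  isSimplyConnected : IsSimplyConnected (Ω : Set (EuclideanSpace ℝ (Fin N)))
  hasSmoothBoundary : HasSmoothBoundary (Ω : Set (EuclideanSpace ℝ (Fin N)))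

/-- The space `L^q(Ω; F)`. -/
abbrev LpOn {N : ℕ} (Ω : Opens (EuclideanSpace ℝ (Fin N))) (q : ℝ≥0∞) (F : Type)
    [NormedAddCommGroup F] : Type :=
  Lp F q (volume.restrict (Ω : Set (EuclideanSpace ℝ (Fin N))))

/-- `G` is the weak differential of the vector field `v` in `Ω`:
`∫_Ω (∂_e φ) v = - ∫_Ω φ (G e)` for every test function `φ` and every direction `e`. -/
def HasWeakFDeriv {N : ℕ} (Ω : Opens (EuclideanSpace ℝ (Fin N)))
    (v : EuclideanSpace ℝ (Fin N) → EuclideanSpace ℝ (Fin N))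
    (G : EuclideanSpace ℝ (Fin N) → EuclideanSpace ℝ (Fin N) →L[ℝ] EuclideanSpace ℝ (Fin N)) :
    Prop :=
  ∀ (φ : 𝓓(Ω, ℝ)) (e : EuclideanSpace ℝ (Fin N)),
    ∫ x in (Ω : Set (EuclideanSpace ℝ (Fin N))), fderiv ℝ φ x e • v x =
      - ∫ x in (Ω : Set (EuclideanSpace ℝ (Fin N))), φ x • G x e

theorem integrable_smul_of_test {N : ℕ} {Ω : Opens (EuclideanSpace ℝ (Fin N))} {q : ℝ≥0∞}
    [hq : Fact (1 ≤ q)] {F : Type} [NormedAddCommGroup F] [NormedSpace ℝ F]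
    (v : LpOn Ω q F) {ψ : EuclideanSpace ℝ (Fin N) → ℝ} (hψ : Continuous ψ)
    (hc : HasCompactSupport ψ) :
    Integrable (fun x => ψ x • v x)
      (volume.restrict (Ω : Set (EuclideanSpace ℝ (Fin N)))) :=
  ((Lp.memLp v).locallyIntegrable hq.out).integrable_smul_left_of_hasCompactSupport hψ hc

theorem integrable_fderiv_smul {N : ℕ} {Ω : Opens (EuclideanSpace ℝ (Fin N))} {q : ℝ≥0∞}
    [Fact (1 ≤ q)] (v : LpOn Ω q (EuclideanSpace ℝ (Fin N))) (φ : 𝓓(Ω, ℝ))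
    (e : EuclideanSpace ℝ (Fin N)) :
    Integrable (fun x => fderiv ℝ φ x e • v x)
      (volume.restrict (Ω : Set (EuclideanSpace ℝ (Fin N)))) := by
  refine integrable_smul_of_test v ?_ (φ.hasCompactSupport.fderiv_apply ℝ e)
  exact (φ.contDiff.continuous_fderiv (by simp)).clm_apply continuous_const

theorem integrable_smul_apply {N : ℕ} {Ω : Opens (EuclideanSpace ℝ (Fin N))} {q : ℝ≥0∞}
    [Fact (1 ≤ q)]
    (G : LpOn Ω q (EuclideanSpace ℝ (Fin N) →L[ℝ] EuclideanSpace ℝ (Fin N))) (φ : 𝓓(Ω, ℝ))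
    (e : EuclideanSpace ℝ (Fin N)) :
    Integrable (fun x => φ x • G x e)
      (volume.restrict (Ω : Set (EuclideanSpace ℝ (Fin N)))) :=
  (integrable_smul_of_test G φ.continuous φ.hasCompactSupport).apply_continuousLinearMap e

/-- The Sobolev space `W^{1,q}(Ω; ℝ^N)`, realised as the space of pairs `(v, Dv)` in
`L^q × L^q` with `Dv` the weak differential of `v`; it carries the norm
`max (‖v‖_q) (‖Dv‖_q)`, which is equivalent to the usual one. -/
def SobolevW {N : ℕ} (Ω : Opens (EuclideanSpace ℝ (Fin N))) (q : ℝ≥0∞) [Fact (1 ≤ q)] :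
    Submodule ℝ (LpOn Ω q (EuclideanSpace ℝ (Fin N)) ×
      LpOn Ω q (EuclideanSpace ℝ (Fin N) →L[ℝ] EuclideanSpace ℝ (Fin N))) where
  carrier := {w | HasWeakFDeriv Ω w.1 w.2}
  zero_mem' := by
    intro φ e
    have h1 := Lp.coeFn_zero (EuclideanSpace ℝ (Fin N)) q
      (volume.restrict (Ω : Set (EuclideanSpace ℝ (Fin N))))
    have h2 := Lp.coeFn_zero (EuclideanSpace ℝ (Fin N) →L[ℝ] EuclideanSpace ℝ (Fin N)) q
      (volume.restrict (Ω : Set (EuclideanSpace ℝ (Fin N))))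
    rw [integral_eq_zero_of_ae, integral_eq_zero_of_ae, neg_zero]
    · filter_upwards [h2] with x hx
      rw [Prod.snd_zero, hx]
      simp
    · filter_upwards [h1] with x hx
      rw [Prod.fst_zero, hx]
      simp
  add_mem' := by
    intro a b ha hb φ e
    have h1 : ∫ x in (Ω : Set (EuclideanSpace ℝ (Fin N))), fderiv ℝ φ x e • (a + b).1 x =
        ∫ x in (Ω : Set (EuclideanSpace ℝ (Fin N))),
          (fderiv ℝ φ x e • a.1 x + fderiv ℝ φ x e • b.1 x) := by
      refine integral_congr_ae ?_
      filter_upwards [Lp.coeFn_add a.1 b.1] with x hx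
      simp only [Prod.fst_add, hx, Pi.add_apply, smul_add]
    have h2 : ∫ x in (Ω : Set (EuclideanSpace ℝ (Fin N))), φ x • (a + b).2 x e =
        ∫ x in (Ω : Set (EuclideanSpace ℝ (Fin N))), (φ x • a.2 x e + φ x • b.2 x e) := by
      refine integral_congr_ae ?_
      filter_upwards [Lp.coeFn_add a.2 b.2] with x hx
      simp only [Prod.snd_add, hx, Pi.add_apply, add_apply, smul_add]
    rw [h1, h2, integral_add (integrable_fderiv_smul a.1 φ e) (integrable_fderiv_smul b.1 φ e),
      integral_add (integrable_smul_apply a.2 φ e) (integrable_smul_apply b.2 φ e),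
      ha φ e, hb φ e, neg_add]
  smul_mem' := by
    intro c a ha φ e
    have h1 : ∫ x in (Ω : Set (EuclideanSpace ℝ (Fin N))), fderiv ℝ φ x e • (c • a).1 x =
        ∫ x in (Ω : Set (EuclideanSpace ℝ (Fin N))), c • (fderiv ℝ φ x e • a.1 x) := by
      refine integral_congr_ae ?_
      filter_upwards [Lp.coeFn_smul c a.1] with x hx
      simp only [Prod.smul_fst, hx, Pi.smul_apply]
      rw [smul_comm]
    have h2 : ∫ x in (Ω : Set (EuclideanSpace ℝ (Fin N))), φ x • (c • a).2 x e =
        ∫ x in (Ω : Set (EuclideanSpace ℝ (Fin N))), c • (φ x • a.2 x e) := by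
      refine integral_congr_ae ?_
      filter_upwards [Lp.coeFn_smul c a.2] with x hx
      simp only [Prod.smul_snd, hx, Pi.smul_apply, smul_apply]
      rw [smul_comm]
    rw [h1, h2, integral_smul, integral_smul, ha φ e, smul_neg]

/-- The vector fields in `W^{1,q}(Ω; ℝ^N)` given by test functions, with their differentials. -/
def SobolevW.testFields {N : ℕ} (Ω : Opens (EuclideanSpace ℝ (Fin N))) (q : ℝ≥0∞)
    [Fact (1 ≤ q)] : Submodule ℝ (SobolevW Ω q) where
  carrier := {w | ∃ φ : 𝓓(Ω, EuclideanSpace ℝ (Fin N)),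
    w.1.1 =ᵐ[volume.restrict (Ω : Set (EuclideanSpace ℝ (Fin N)))] φ ∧
    w.1.2 =ᵐ[volume.restrict (Ω : Set (EuclideanSpace ℝ (Fin N)))] fderiv ℝ φ}
  zero_mem' := by
    refine ⟨0, Lp.coeFn_zero _ _ _, (Lp.coeFn_zero _ _ _).trans ?_⟩
    refine Eventually.of_forall fun x => ?_
    simp
  add_mem' := by
    rintro a b ⟨φ, h1, h2⟩ ⟨ψ, h3, h4⟩
    refine ⟨φ + ψ, ?_, ?_⟩
    · filter_upwards [Lp.coeFn_add a.1.1 b.1.1, h1, h3] with x hx hx1 hx3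
      exact hx.trans (by simp only [Pi.add_apply, hx1, hx3, FunLike.coe_add])
    · filter_upwards [Lp.coeFn_add a.1.2 b.1.2, h2, h4] with x hx hx2 hx4
      have hφ : DifferentiableAt ℝ φ x := (φ.contDiff.differentiable (by simp)) x
      have hψ : DifferentiableAt ℝ ψ x := (ψ.contDiff.differentiable (by simp)) x
      refine hx.trans ?_
      rw [Pi.add_apply, hx2, hx4, FunLike.coe_add, fderiv_add hφ hψ]
  smul_mem' := by
    rintro c a ⟨φ, h1, h2⟩
    refine ⟨c • φ, ?_, ?_⟩
    · filter_upwards [Lp.coeFn_smul c a.1.1, h1] with x hx hx1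
      exact hx.trans (by simp only [Pi.smul_apply, hx1, FunLike.coe_smul])
    · filter_upwards [Lp.coeFn_smul c a.1.2, h2] with x hx hx2
      have hφ : DifferentiableAt ℝ φ x := (φ.contDiff.differentiable (by simp)) x
      refine hx.trans ?_
      rw [Pi.smul_apply, hx2, FunLike.coe_smul, fderiv_const_smul hφ]

/-- `W_0^{1,q}(Ω; ℝ^N)`: the closure of the test functions in `W^{1,q}(Ω; ℝ^N)`. -/
def SobolevWZero {N : ℕ} (Ω : Opens (EuclideanSpace ℝ (Fin N))) (q : ℝ≥0∞) [Fact (1 ≤ q)] :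
    Submodule ℝ (SobolevW Ω q) :=
  (SobolevW.testFields Ω q).topologicalClosure

/-- The vector field underlying an element of `W_0^{1,q}(Ω; ℝ^N)`. -/
def SobolevWZero.field {N : ℕ} {Ω : Opens (EuclideanSpace ℝ (Fin N))} {q : ℝ≥0∞}
    [Fact (1 ≤ q)] (w : SobolevWZero Ω q) : LpOn Ω q (EuclideanSpace ℝ (Fin N)) :=
  w.1.1.1

/-- `∇ · v = 0` in `Ω` in the weak sense: `∫_Ω v · ∇φ = 0` for every test function `φ`. -/
def IsDivergenceFree {N : ℕ} (Ω : Opens (EuclideanSpace ℝ (Fin N)))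
    (v : EuclideanSpace ℝ (Fin N) → EuclideanSpace ℝ (Fin N)) : Prop :=
  ∀ φ : 𝓓(Ω, ℝ), ∫ x in (Ω : Set (EuclideanSpace ℝ (Fin N))), inner ℝ (v x) (gradient φ x) = 0

/-- The open set `(-∞, T) × Ω` of space-time. The restrictions to `[0, T] × Ω` of the test
functions on this set are the smooth functions on `[0, T] × Ω` with compact support in
`[0, T) × Ω`. -/
def spaceTime {N : ℕ} (T : ℝ) (Ω : Opens (EuclideanSpace ℝ (Fin N))) :
    Opens (ℝ × EuclideanSpace ℝ (Fin N)) :=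
  ⟨Iio T ×ˢ (Ω : Set (EuclideanSpace ℝ (Fin N))), isOpen_Iio.prod Ω.isOpen⟩

/-- `ρ ∈ L^∞(0,T; L^p(Ω))` is a weak solution of `ρ_t - u · ∇ρ = 0` in `(0,T) × Ω`,
`ρ(0) = ρ₀`. -/
structure IsWeakSolution {N : ℕ} (Ω : Opens (EuclideanSpace ℝ (Fin N))) (T : ℝ) (p : ℝ≥0∞)
    [Fact (1 ≤ p)] (u : ℝ → EuclideanSpace ℝ (Fin N) → EuclideanSpace ℝ (Fin N))
    (ρ₀ : LpOn Ω p ℝ) (ρ : ℝ → LpOn Ω p ℝ) : Prop where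
  memLp : MemLp ρ ⊤ (volume.restrict (Ioo 0 T))
  weak_eq : ∀ φ : 𝓓(spaceTime T Ω, ℝ),
    - (∫ t in Ioo 0 T, ∫ x in (Ω : Set (EuclideanSpace ℝ (Fin N))),
        ρ t x * deriv (fun s => φ (s, x)) t)
      - (∫ x in (Ω : Set (EuclideanSpace ℝ (Fin N))), ρ₀ x * φ (0, x))
      + (∫ t in Ioo 0 T, ∫ x in (Ω : Set (EuclideanSpace ℝ (Fin N))),
        ρ t x * inner ℝ (u t x) (gradient (fun y => φ (t, y)) x)) = 0

end

/-! The argument follows DiPerna and Lions: mollify the density, show that the mollified densities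
almost solve the equation, and deduce that the distribution of values of the density is conserved in
time.

Zero boundary values allow the work to be done up to the boundary. Extended by zero, a field `w` in
`W_0^{1,q}` satisfies `‖w(· + h) - w‖_q ≤ |h| ‖w‖` (`eLpNorm_translate_field_le`). By smoothness and
compactness of the boundary, a point of `Ω` within a small distance `s` of the complement leaves `Ω`
under translation by `s • e i` for one of finitely many vectors `e i`, so `w` has norm `O(s)` on
that layer (`exists_eLpNorm_boundaryLayer_le`). This balances the gradient `O(1/s)` of a cutoff.
Hence the weak equation and the divergence condition hold for test functions that do not vanish near
the boundary (`IsWeakSolution.weak_eq_smooth`, `IsDivergenceFree.integral_fderiv_eq_zero`), in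
particular for `y ↦ k (x - y)` with any `x`.

So `ρ_n = k_n * ρ` satisfies `∂_t ρ_n = div (k_n * (ρ u)) = u · ∇ρ_n + r_n`. By the divergence
condition and the evenness of `k_n`, the commutator `r_n` is an integral of `∇k_n (x - y)` against
the product of the increments of `ρ` and of `u` (`commutator_eq`). The increment of `u` absorbs the
factor `1/s` of the kernel, and the `L^p` modulus of continuity of `ρ` sends `r_n` to zero in `L^1`,
with majorant `C ‖u(t)‖` in time. For smooth `β` with bounded Lipschitz derivative, `∫ β(ρ_n)` then
varies by at most `sup |β'|` times the space-time `L^1` norm of `r_n`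
(`IsWeakSolution.eventually_energy_le`).

Taking for `β` a smoothed absolute value and applying this to `ρ_m - ρ_n` shows that the paths are
uniformly Cauchy in `L^1`; the limit `R` is continuous in `L^1` and represents `ρ`. Taking `cos (ξ
·)` and `sin (ξ ·)` shows that the characteristic function of `R t` does not depend on `t`, so every
`R t` has the law of `ρ₀`. Functions with a common law in `L^p` are uniformly `p`-integrable, and
Vitali's theorem upgrades `L^1` continuity to `L^p` continuity
(`exists_continuousOn_Lp_of_identDistrib`). -/

/-! ### Even mollifiers and the scaling of their gradients. -/

section Mollifier

variable {E : Type*} [NormedAddCommGroup E] [InnerProductSpace ℝ E] [FiniteDimensional ℝ E]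
  [MeasurableSpace E] [BorelSpace E]

/-- A fixed even bump function on the unit ball with integral one. -/
noncomputable def unitMollifier (E : Type*) [NormedAddCommGroup E] [InnerProductSpace ℝ E]
    [FiniteDimensional ℝ E] [MeasurableSpace E] [BorelSpace E] : E → ℝ :=
  (⟨1 / 2, 1, by norm_num, by norm_num⟩ : ContDiffBump (0 : E)).normed volume

/-- The mollifier at scale `s`, supported in the ball of radius `s`. -/
noncomputable def mollifier (s : ℝ) (x : E) : ℝ :=
  (s ^ Module.finrank ℝ E)⁻¹ * unitMollifier E (s⁻¹ • x)

theorem contDiff_unitMollifier : ContDiff ℝ ∞ (unitMollifier E) :=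
  ContDiffBump.contDiff_normed _

theorem contDiff_mollifier (s : ℝ) : ContDiff ℝ ∞ (mollifier s : E → ℝ) :=
  contDiff_const.mul (contDiff_unitMollifier.comp (contDiff_id.const_smul _))

theorem mollifier_nonneg {s : ℝ} (hs : 0 < s) (x : E) : 0 ≤ mollifier s x :=
  mul_nonneg (by positivity) (ContDiffBump.nonneg_normed _ _)

theorem mollifier_neg (s : ℝ) (x : E) : mollifier s (-x) = mollifier s x := by
  simp only [mollifier, unitMollifier, smul_neg, ContDiffBump.normed_neg]

theorem mollifier_eq_zero {s : ℝ} (hs : 0 < s) {x : E} (hx : s ≤ ‖x‖) : mollifier s x = 0 := by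
  have h : unitMollifier E (s⁻¹ • x) = 0 := by
    rw [← Function.notMem_support, unitMollifier, ContDiffBump.support_normed_eq]
    rw [Metric.mem_ball, dist_zero_right, norm_smul, norm_inv, Real.norm_of_nonneg hs.le, not_lt,
      inv_mul_eq_div, le_div_iff₀ hs]
    simpa using hx
  rw [mollifier, h, mul_zero]

theorem tsupport_mollifier_subset {s : ℝ} (hs : 0 < s) :
    tsupport (mollifier s : E → ℝ) ⊆ Metric.closedBall 0 s := by
  refine closure_minimal (fun x hx => ?_) Metric.isClosed_closedBall
  by_contra h
  rw [Metric.mem_closedBall, dist_zero_right, not_le] at h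
  exact hx (mollifier_eq_zero hs h.le)

theorem hasCompactSupport_mollifier {s : ℝ} (hs : 0 < s) :
    HasCompactSupport (mollifier s : E → ℝ) :=
  (isCompact_closedBall 0 s).of_isClosed_subset (isClosed_tsupport _) (tsupport_mollifier_subset hs)

theorem integral_mollifier {s : ℝ} (hs : 0 < s) : ∫ x : E, mollifier s x = 1 := by
  have h := Measure.integral_comp_inv_smul_of_nonneg (volume : Measure E) (unitMollifier E) hs.le
  simp only [mollifier]
  rw [integral_const_mul, h, unitMollifier, ContDiffBump.integral_normed, smul_eq_mul, mul_one,
    inv_mul_cancel₀ (by positivity)]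

theorem fderiv_mollifier (s : ℝ) (x : E) : fderiv ℝ (mollifier s : E → ℝ) x =
    ((s ^ Module.finrank ℝ E)⁻¹ * s⁻¹) • fderiv ℝ (unitMollifier E) (s⁻¹ • x) := by
  have h1 : DifferentiableAt ℝ (unitMollifier E) (s⁻¹ • x) :=
    contDiff_unitMollifier.differentiable (by simp) _
  have h2 : HasFDerivAt (fun y : E => s⁻¹ • y) (s⁻¹ • ContinuousLinearMap.id ℝ E) x :=
    (hasFDerivAt_id x).const_smul s⁻¹
  have h3 : HasFDerivAt (mollifier s : E → ℝ) _ x :=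
    (h1.hasFDerivAt.comp x h2).const_mul ((s ^ Module.finrank ℝ E)⁻¹)
  rw [h3.fderiv, mul_smul]
  congr 1
  ext y
  simp

theorem fderiv_mollifier_neg (s : ℝ) (x : E) :
    fderiv ℝ (mollifier s : E → ℝ) (-x) = -fderiv ℝ (mollifier s : E → ℝ) x := by
  have h1 : HasFDerivAt (mollifier s : E → ℝ) (fderiv ℝ (mollifier s : E → ℝ) (-x)) (-x) :=
    ((contDiff_mollifier s).differentiable (by simp) _).hasFDerivAt
  have h2 : HasFDerivAt (fun y : E => mollifier s (-y))
      (fderiv ℝ (mollifier s : E → ℝ) (-x) ∘L (-ContinuousLinearMap.id ℝ E)) x :=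
    h1.comp x (hasFDerivAt_id x).neg
  simp only [mollifier_neg] at h2
  rw [h2.fderiv]
  ext y
  simp

theorem continuous_fderiv_mollifier (s : ℝ) : Continuous (fderiv ℝ (mollifier s : E → ℝ)) :=
  (contDiff_mollifier s).continuous_fderiv (by simp)

theorem fderiv_mollifier_eq_zero {s : ℝ} (hs : 0 < s) {x : E} (hx : s < ‖x‖) :
    fderiv ℝ (mollifier s : E → ℝ) x = 0 := by
  rw [← Function.notMem_support]
  intro h
  have := tsupport_mollifier_subset hs (support_fderiv_subset ℝ h)
  rw [Metric.mem_closedBall, dist_zero_right] at this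
  linarith

/-- The `L¹` norm of the gradient of the mollifier at unit scale. -/
noncomputable def mollifierConst (E : Type*) [NormedAddCommGroup E] [InnerProductSpace ℝ E]
    [FiniteDimensional ℝ E] [MeasurableSpace E] [BorelSpace E] : ℝ :=
  ∫ x : E, ‖fderiv ℝ (unitMollifier E) x‖

theorem mollifierConst_nonneg : 0 ≤ mollifierConst E := integral_nonneg fun _ => norm_nonneg _

theorem integrable_fderiv_mollifier {s : ℝ} (hs : 0 < s) :
    Integrable (fderiv ℝ (mollifier s : E → ℝ)) :=
  (continuous_fderiv_mollifier s).integrable_of_hasCompactSupport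
    ((hasCompactSupport_mollifier hs).fderiv ℝ)

/-- The gradient costs exactly one power of `1/s`, which the cutoff and commutator estimates must
both win back from the vector field. -/
theorem integral_norm_fderiv_mollifier {s : ℝ} (hs : 0 < s) :
    ∫ x : E, ‖fderiv ℝ (mollifier s : E → ℝ) x‖ = mollifierConst E / s := by
  have h := Measure.integral_comp_inv_smul_of_nonneg (volume : Measure E)
    (fun x => ‖fderiv ℝ (unitMollifier E) x‖) hs.le
  simp only [fderiv_mollifier, norm_smul]
  rw [integral_const_mul, h, smul_eq_mul, Real.norm_of_nonneg (by positivity), mollifierConst]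
  field_simp

theorem lintegral_enorm_fderiv_mollifier {s : ℝ} (hs : 0 < s) :
    ∫⁻ x : E, ‖fderiv ℝ (mollifier s : E → ℝ) x‖ₑ = ENNReal.ofReal (mollifierConst E / s) := by
  rw [← integral_norm_fderiv_mollifier hs,
    ofReal_integral_norm_eq_lintegral_enorm (integrable_fderiv_mollifier hs)]

/-- The gradient of an even function is odd. This cancellation allows the value of the field at `x`
to be subtracted in `commutator_eq`. -/
theorem integral_fderiv_mollifier (s : ℝ) : ∫ x : E, fderiv ℝ (mollifier s : E → ℝ) x = 0 := by
  have h := integral_neg_eq_self (fderiv ℝ (mollifier s : E → ℝ)) volume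
  simp only [fderiv_mollifier_neg, integral_neg] at h
  ext y
  have h2 := congrArg (fun L : E →L[ℝ] ℝ => L y) h
  simp only [neg_apply, zero_apply] at h2 ⊢
  linarith

end Mollifier

/-! ### Translations in Lebesgue spaces. -/

section Translation

variable {E F : Type*} [NormedAddCommGroup E] [InnerProductSpace ℝ E] [FiniteDimensional ℝ E]
  [MeasurableSpace E] [BorelSpace E] [NormedAddCommGroup F]

theorem eLpNorm_comp_add_right_sub_le {f : E → F} {q : ℝ≥0∞} (hq : 1 ≤ q)
    (hf : AEStronglyMeasurable f volume) (h : E) :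
    eLpNorm (fun x => f (x + h) - f x) q volume ≤ 2 * eLpNorm f q volume := by
  have hm := measurePreserving_add_right (volume : Measure E) h
  have h1 : eLpNorm (fun x => f (x + h)) q volume = eLpNorm f q volume :=
    eLpNorm_comp_measurePreserving hf hm
  refine (eLpNorm_sub_le (hf.comp_measurePreserving hm) hf hq).trans ?_
  rw [two_mul]
  exact add_le_add h1.le le_rfl

/-- Strong continuity of translations for finite exponents. It supplies the smallness in the
commutator estimate and the convergence of mollifications. -/
theorem tendsto_eLpNorm_comp_add_right_sub {f : E → F} {q : ℝ≥0∞} [Fact (1 ≤ q)] (hq' : q ≠ ⊤)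
    (hf : MemLp f q volume) :
    Tendsto (fun h : E => eLpNorm (fun x => f (x + h) - f x) q volume) (𝓝 0) (𝓝 0) := by
  have : Fact (q ≠ ⊤) := ⟨hq'⟩
  have hc : Continuous fun h : E => Lp.compMeasurePreserving (fun x => x + h)
      (measurePreserving_add_right (volume : Measure E) h) (hf.toLp f) := by
    have hg : Continuous fun h : E => (⟨fun x => x + h, by fun_prop⟩ : C(E, E)) :=
      ContinuousMap.continuous_of_continuous_uncurry _
        (show Continuous fun z : E × E => z.2 + z.1 by fun_prop)
    exact Continuous.compMeasurePreservingLp (f := fun _ : E => hf.toLp f)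
      continuous_const hg (fun h => measurePreserving_add_right (volume : Measure E) h) hq'
  have h2 : Tendsto (fun h : E => Lp.compMeasurePreserving (fun x => x + h)
      (measurePreserving_add_right (volume : Measure E) h) (hf.toLp f) - hf.toLp f) (𝓝 0)
      (𝓝 0) := by
    have h3 := (hc.sub (continuous_const (y := hf.toLp f))).tendsto 0
    suffices h4 : Lp.compMeasurePreserving (fun x => x + (0 : E))
        (measurePreserving_add_right (volume : Measure E) 0) (hf.toLp f) - hf.toLp f = 0 by
      rw [← h4]
      exact h3
    rw [sub_eq_zero]
    refine Lp.ext ?_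
    refine (Lp.coeFn_compMeasurePreserving _ _).trans ?_
    simp [Function.comp_def]
  have h3 := (continuous_enorm.tendsto _).comp h2
  rw [enorm_zero] at h3
  refine h3.congr fun h => ?_
  rw [Function.comp_apply, Lp.toLp_compMeasurePreserving, ← MemLp.toLp_sub, Lp.enorm_toLp]
  rfl

end Translation

/-! ### Translation estimate for smooth functions. -/

section SobolevTranslation

variable {E F : Type*} [NormedAddCommGroup E] [InnerProductSpace ℝ E]
  [NormedAddCommGroup F] [NormedSpace ℝ F]

/-- The increment is the integral of the derivative along the segment. The power is moved inside
this integral so that integration over `x` can be done first, by Fubini. -/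
theorem enorm_sub_rpow_le_lintegral_fderiv [CompleteSpace F] {φ : E → F} (hφ : ContDiff ℝ 1 φ)
    {r : ℝ} (hr : 1 ≤ r) (x h : E) :
    ‖φ (x + h) - φ x‖ₑ ^ r ≤
      ‖h‖ₑ ^ r * ∫⁻ s in Ioc (0 : ℝ) 1, ‖fderiv ℝ φ (x + s • h)‖ₑ ^ r := by
  have hc : Continuous fun s : ℝ => fderiv ℝ φ (x + s • h) :=
    (hφ.continuous_fderiv (by simp)).comp (by fun_prop)
  have h1 : φ (x + h) - φ x = ∫ s in (0 : ℝ)..1, fderiv ℝ φ (x + s • h) h := by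
    have hd : ∀ s : ℝ, HasDerivAt (fun s : ℝ => φ (x + s • h)) (fderiv ℝ φ (x + s • h) h) s := by
      intro s
      have h2 : HasDerivAt (fun s : ℝ => x + s • h) h s := by
        simpa using ((hasDerivAt_id s).smul_const h).const_add x
      exact ((hφ.differentiable (by simp) _).hasFDerivAt).comp_hasDerivAt s h2
    rw [intervalIntegral.integral_eq_sub_of_hasDerivAt (fun s _ => hd s)
      ((hc.clm_apply continuous_const).intervalIntegrable _ _)]
    simp
  have h2 : ‖φ (x + h) - φ x‖ₑ ≤ ‖h‖ₑ * ∫⁻ s in Ioc (0 : ℝ) 1, ‖fderiv ℝ φ (x + s • h)‖ₑ := by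
    rw [h1, intervalIntegral.integral_of_le zero_le_one]
    refine (enorm_integral_le_lintegral_enorm _).trans ?_
    rw [← lintegral_const_mul' _ _ enorm_ne_top]
    refine lintegral_mono fun s => ?_
    rw [mul_comm]
    exact ContinuousLinearMap.le_opENorm _ _
  have : IsProbabilityMeasure (volume.restrict (Ioc (0 : ℝ) 1)) := ⟨by simp⟩
  -- Monotonicity of the `L^r` norms on a probability space plays the part of Jensen's inequality.
  have h3 := eLpNorm'_le_eLpNorm'_of_exponent_le zero_lt_one hr (volume.restrict (Ioc (0 : ℝ) 1))
    (f := fun s : ℝ => fderiv ℝ φ (x + s • h)) hc.aestronglyMeasurable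
  simp only [eLpNorm', ENNReal.rpow_one, one_div, inv_one] at h3
  have hr0 : 0 ≤ r := zero_le_one.trans hr
  have h4 := ENNReal.rpow_le_rpow h3 hr0
  rw [← ENNReal.rpow_mul, inv_mul_cancel₀ (by linarith), ENNReal.rpow_one] at h4
  refine (ENNReal.rpow_le_rpow h2 hr0).trans ?_
  rw [ENNReal.mul_rpow_of_nonneg _ _ hr0]
  gcongr

theorem eLpNorm_comp_add_right_sub_le_fderiv [FiniteDimensional ℝ E] [MeasurableSpace E]
    [BorelSpace E] [CompleteSpace F] {φ : E → F} (hφ : ContDiff ℝ 1 φ)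
    {q : ℝ≥0∞} (hq : 1 ≤ q) (hq' : q ≠ ⊤) (h : E) :
    eLpNorm (fun x => φ (x + h) - φ x) q volume ≤ ‖h‖ₑ * eLpNorm (fderiv ℝ φ) q volume := by
  have hq0 : q ≠ 0 := (one_pos.trans_le hq).ne'
  have hr : 1 ≤ q.toReal := by
    rw [← ENNReal.toReal_one]
    exact ENNReal.toReal_mono hq' hq
  have hr0 : 0 < q.toReal := one_pos.trans_le hr
  have hcont : Continuous (fderiv ℝ φ) := hφ.continuous_fderiv (by simp)
  rw [eLpNorm_eq_lintegral_rpow_enorm_toReal hq0 hq', eLpNorm_eq_lintegral_rpow_enorm_toReal hq0 hq',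
    one_div, ENNReal.rpow_inv_le_iff hr0, ENNReal.mul_rpow_of_nonneg _ _ hr0.le,
    ← ENNReal.rpow_mul, inv_mul_cancel₀ hr0.ne', ENNReal.rpow_one]
  calc ∫⁻ x, ‖φ (x + h) - φ x‖ₑ ^ q.toReal
      ≤ ∫⁻ x, ‖h‖ₑ ^ q.toReal *
          ∫⁻ s in Ioc (0 : ℝ) 1, ‖fderiv ℝ φ (x + s • h)‖ₑ ^ q.toReal :=
        lintegral_mono fun x => enorm_sub_rpow_le_lintegral_fderiv hφ hr x h
    _ = ‖h‖ₑ ^ q.toReal *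
          ∫⁻ x, ∫⁻ s in Ioc (0 : ℝ) 1, ‖fderiv ℝ φ (x + s • h)‖ₑ ^ q.toReal := by
        rw [lintegral_const_mul' _ _ (ENNReal.rpow_ne_top_of_nonneg hr0.le enorm_ne_top)]
    _ = ‖h‖ₑ ^ q.toReal *
          ∫⁻ s in Ioc (0 : ℝ) 1, ∫⁻ x, ‖fderiv ℝ φ (x + s • h)‖ₑ ^ q.toReal := by
        congr 1
        refine lintegral_lintegral_swap (Measurable.aemeasurable ?_)
        refine Measurable.pow_const ?_ _
        exact (hcont.comp (by fun_prop)).enorm.measurable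
    _ = ‖h‖ₑ ^ q.toReal * ∫⁻ x, ‖fderiv ℝ φ x‖ₑ ^ q.toReal := by
        congr 1
        have : ∀ s : ℝ, ∫⁻ x, ‖fderiv ℝ φ (x + s • h)‖ₑ ^ q.toReal =
            ∫⁻ x, ‖fderiv ℝ φ x‖ₑ ^ q.toReal := fun s =>
          lintegral_add_right_eq_self (fun x => ‖fderiv ℝ φ x‖ₑ ^ q.toReal) (s • h)
        simp only [this]
        simp

end SobolevTranslation

/-! ### Extension by zero of fields with zero boundary values. -/

section SobolevZero

variable {N : ℕ} {Ω : Opens (EuclideanSpace ℝ (Fin N))} {q : ℝ≥0∞}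

theorem measurableSet_domain (Ω : Opens (EuclideanSpace ℝ (Fin N))) :
    MeasurableSet (Ω : Set (EuclideanSpace ℝ (Fin N))) := Ω.isOpen.measurableSet

theorem memLp_indicator_LpOn [Fact (1 ≤ q)] {F : Type} [NormedAddCommGroup F] (f : LpOn Ω q F) :
    MemLp ((Ω : Set (EuclideanSpace ℝ (Fin N))).indicator f) q volume :=
  (memLp_indicator_iff_restrict (measurableSet_domain Ω)).2 (Lp.memLp f)

theorem eLpNorm_indicator_LpOn {F : Type} [NormedAddCommGroup F] (f : LpOn Ω q F) :
    eLpNorm ((Ω : Set (EuclideanSpace ℝ (Fin N))).indicator f) q volume = ‖f‖ₑ := by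
  rw [eLpNorm_indicator_eq_eLpNorm_restrict (measurableSet_domain Ω), Lp.enorm_def]

theorem enorm_fst_le_of_mem_SobolevWZero [Fact (1 ≤ q)] (w : SobolevWZero Ω q) :
    ‖SobolevWZero.field w‖ₑ ≤ ‖w‖ₑ := by
  rw [enorm_le_iff_norm_le]
  exact norm_fst_le w.1.1

theorem SobolevWZero.exists_testField_near [Fact (1 ≤ q)] (w : SobolevWZero Ω q) {ε : ℝ}
    (hε : 0 < ε) : ∃ z : SobolevWZero Ω q, z.1 ∈ SobolevW.testFields Ω q ∧ ‖w - z‖ < ε := by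
  have hw : (w : SobolevW Ω q) ∈ closure (SobolevW.testFields Ω q : Set (SobolevW Ω q)) := w.2
  obtain ⟨z, hz, hd⟩ := Metric.mem_closure_iff.1 hw ε hε
  refine ⟨⟨z, (SobolevW.testFields Ω q).le_topologicalClosure hz⟩, hz, ?_⟩
  rwa [dist_eq_norm] at hd

theorem SobolevWZero.field_sub [Fact (1 ≤ q)] (w z : SobolevWZero Ω q) :
    SobolevWZero.field (w - z) = SobolevWZero.field w - SobolevWZero.field z := rfl

theorem indicator_ae_eq_of_testField {F : Type} [NormedAddCommGroup F] [NormedSpace ℝ F]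
    {v : EuclideanSpace ℝ (Fin N) → F} {φ : 𝓓(Ω, F)}
    (h : v =ᵐ[volume.restrict (Ω : Set (EuclideanSpace ℝ (Fin N)))] φ) :
    (Ω : Set (EuclideanSpace ℝ (Fin N))).indicator v =ᵐ[volume] φ := by
  rw [ae_eq_restrict_iff_indicator_ae_eq (measurableSet_domain Ω)] at h
  refine h.trans (Eventually.of_forall fun x => ?_)
  by_cases hx : x ∈ (Ω : Set (EuclideanSpace ℝ (Fin N)))
  · rw [indicator_of_mem hx]
  · rw [indicator_of_notMem hx, image_eq_zero_of_notMem_tsupport fun h => hx (φ.tsupport_subset h)]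

theorem eLpNorm_translate_testField_le [Fact (1 ≤ q)] (hq' : q ≠ ⊤) (z : SobolevWZero Ω q)
    (hz : z.1 ∈ SobolevW.testFields Ω q) (h : EuclideanSpace ℝ (Fin N)) :
    eLpNorm (fun x => (Ω : Set (EuclideanSpace ℝ (Fin N))).indicator (SobolevWZero.field z) (x + h) -
      (Ω : Set (EuclideanSpace ℝ (Fin N))).indicator (SobolevWZero.field z) x) q volume ≤
      ‖h‖ₑ * ‖z‖ₑ := by
  obtain ⟨φ, h1, h2⟩ := hz
  have h3 := indicator_ae_eq_of_testField h1
  have hm := measurePreserving_add_right (volume : Measure (EuclideanSpace ℝ (Fin N))) h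
  have h4 : (fun x => (Ω : Set (EuclideanSpace ℝ (Fin N))).indicator (SobolevWZero.field z) (x + h) -
      (Ω : Set (EuclideanSpace ℝ (Fin N))).indicator (SobolevWZero.field z) x) =ᵐ[volume]
      fun x => φ (x + h) - φ x := by
    filter_upwards [h3, hm.quasiMeasurePreserving.ae_eq_comp h3] with x hx hx'
    simp only [Function.comp_apply] at hx'
    exact congrArg₂ _ hx' hx
  rw [eLpNorm_congr_ae h4]
  refine (eLpNorm_comp_add_right_sub_le_fderiv (φ.contDiff.of_le (by simp))
    Fact.out hq' h).trans ?_
  gcongr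
  have h5 : eLpNorm (fderiv ℝ φ) q volume = ‖z.1.1.2‖ₑ := by
    rw [Lp.enorm_def, eLpNorm_congr_ae h2,
      ← eLpNorm_indicator_eq_eLpNorm_restrict (measurableSet_domain Ω)]
    congr 1
    refine (indicator_eq_self.2 ?_).symm
    exact (support_fderiv_subset ℝ).trans φ.tsupport_subset
  rw [h5, enorm_le_iff_norm_le]
  exact norm_snd_le z.1.1

/-- The bound holds for test fields and passes to their closure, since replacing `w` by a test field
at distance `ε` costs a multiple of `ε`. Zero boundary values enter here: the extension by zero of a
general Sobolev field jumps across the boundary. -/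
theorem eLpNorm_translate_field_le [Fact (1 ≤ q)] (hq' : q ≠ ⊤) (w : SobolevWZero Ω q)
    (h : EuclideanSpace ℝ (Fin N)) :
    eLpNorm (fun x => (Ω : Set (EuclideanSpace ℝ (Fin N))).indicator (SobolevWZero.field w) (x + h) -
      (Ω : Set (EuclideanSpace ℝ (Fin N))).indicator (SobolevWZero.field w) x) q volume ≤
      ‖h‖ₑ * ‖w‖ₑ := by
  set V := fun z : SobolevWZero Ω q =>
    (Ω : Set (EuclideanSpace ℝ (Fin N))).indicator (SobolevWZero.field z) with hV
  have hVm : ∀ z, MemLp (V z) q volume := fun z => memLp_indicator_LpOn _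
  have hm := measurePreserving_add_right (volume : Measure (EuclideanSpace ℝ (Fin N))) h
  have key : ∀ ε : ℝ, 0 < ε → eLpNorm (fun x => V w (x + h) - V w x) q volume ≤
      ‖h‖ₑ * (‖w‖ₑ + ENNReal.ofReal ε) + 2 * ENNReal.ofReal ε := by
    intro ε hε
    obtain ⟨z, hz, hwz⟩ := SobolevWZero.exists_testField_near w hε
    have hwz' : ‖w - z‖ₑ ≤ ENNReal.ofReal ε := by
      rw [← ofReal_norm]
      exact ENNReal.ofReal_le_ofReal hwz.le
    have e1 : V (w - z) =ᵐ[volume] fun x => V w x - V z x := by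
      have := Lp.coeFn_sub (SobolevWZero.field w) (SobolevWZero.field z)
      rw [← SobolevWZero.field_sub,
        ae_eq_restrict_iff_indicator_ae_eq (measurableSet_domain Ω)] at this
      refine this.trans (Eventually.of_forall fun x => ?_)
      simp only [hV, indicator_sub', Pi.sub_apply]
    have e2 : (fun x => V w (x + h) - V w x) =ᵐ[volume]
        (fun x => V z (x + h) - V z x) + fun x => V (w - z) (x + h) - V (w - z) x := by
      filter_upwards [e1, hm.quasiMeasurePreserving.ae_eq_comp e1] with x hx hx'
      simp only [Function.comp_apply] at hx'
      simp only [Pi.add_apply, hx, hx']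
      abel
    have hmeas : ∀ z, AEStronglyMeasurable (fun x => V z (x + h) - V z x) volume := fun z =>
      ((hVm z).1.comp_measurePreserving hm).sub (hVm z).1
    rw [eLpNorm_congr_ae e2]
    refine (eLpNorm_add_le (hmeas _) (hmeas _) Fact.out).trans ?_
    refine add_le_add ((eLpNorm_translate_testField_le hq' z hz h).trans ?_) ?_
    · gcongr
      calc ‖z‖ₑ = ‖w - (w - z)‖ₑ := by rw [sub_sub_cancel]
        _ ≤ ‖w‖ₑ + ‖w - z‖ₑ := enorm_sub_le
        _ ≤ _ := by gcongr
    · refine (eLpNorm_comp_add_right_sub_le Fact.out (hVm _).1 h).trans ?_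
      gcongr
      rw [hV, eLpNorm_indicator_LpOn]
      exact (enorm_fst_le_of_mem_SobolevWZero _).trans hwz'
  have hlim : Tendsto (fun ε : ℝ => ‖h‖ₑ * (‖w‖ₑ + ENNReal.ofReal ε) + 2 * ENNReal.ofReal ε)
      (𝓝[>] 0) (𝓝 (‖h‖ₑ * (‖w‖ₑ + ENNReal.ofReal 0) + 2 * ENNReal.ofReal 0)) := by
    refine Tendsto.mono_left ?_ nhdsWithin_le_nhds
    have h0 : Tendsto (fun ε : ℝ => ENNReal.ofReal ε) (𝓝 0) (𝓝 (ENNReal.ofReal 0)) :=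
      ENNReal.continuous_ofReal.tendsto 0
    exact (ENNReal.Tendsto.const_mul (tendsto_const_nhds.add h0) (Or.inr enorm_ne_top)).add
      (ENNReal.Tendsto.const_mul h0 (Or.inr (by simp)))
  have := ge_of_tendsto hlim (eventually_nhdsWithin_of_forall fun ε hε => key ε hε)
  simpa using this

end SobolevZero

/-! ### Smallness of the field near the boundary. -/

section BoundaryLayer

variable {N : ℕ}

/-- Some `z` outside `Ω` lies within `s` of `y`, and to first order `g` differs between them by at
most `‖L‖ * s`. A displacement `s • e` along which `g` grows faster than that leads outside `Ω`. One
vector `e` serves a whole neighbourhood and all small `s`. -/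
theorem HasSmoothBoundary.exists_exit_direction {Ω : Set (EuclideanSpace ℝ (Fin N))}
    (h : HasSmoothBoundary Ω) {x₀ : EuclideanSpace ℝ (Fin N)} (hx₀ : x₀ ∈ frontier Ω) :
    ∃ V ∈ 𝓝 x₀, ∃ e : EuclideanSpace ℝ (Fin N), ∃ δ > 0, ∀ y ∈ V, ∀ s, 0 < s → s < δ →
      y ∈ Metric.thickening s Ωᶜ → y + s • e ∉ Ω := by
  obtain ⟨U, g, hU, hxU, hg, hL, hΩU⟩ := h x₀ hx₀
  set L := fderiv ℝ g x₀ with hLdef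
  obtain ⟨a, ha⟩ : ∃ a, L a ≠ 0 := by
    by_contra! hcon
    exact hL (ContinuousLinearMap.ext hcon)
  obtain ⟨e₀, he₀⟩ : ∃ e₀, L e₀ = 1 := ⟨(L a)⁻¹ • a, by simp [ha]⟩
  have hs : HasStrictFDerivAt g L x₀ :=
    (hg.contDiffAt (hU.mem_nhds hxU)).hasStrictFDerivAt (by simp)
  -- The linearization error must absorb no more than half of the gain `s * c` and a further `s /
  -- 2`.
  set η : NNReal := ⟨1 / (2 * (‖e₀‖ + 1)), by positivity⟩ with hη
  have hηpos : 0 < η := by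
    rw [← NNReal.coe_pos]
    change 0 < 1 / (2 * (‖e₀‖ + 1))
    positivity
  obtain ⟨W, hW, happ⟩ := hs.approximates_deriv_on_nhds (c := η) (Or.inr hηpos)
  obtain ⟨R, hR, hball⟩ := Metric.mem_nhds_iff.1 (inter_mem hW (hU.mem_nhds hxU))
  -- Then `c / 2 = ‖L‖ + 1 / 2` pays exactly for the first-order drop and the rest of the error; the
  -- surplus `η * s * c` contradicts `g (y + s • c • e₀) < 0 ≤ g z`.
  set c : ℝ := 2 * ‖L‖ + 1 with hc
  have hcpos : 0 < c := by positivity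
  refine ⟨Metric.ball x₀ (R / 2), Metric.ball_mem_nhds _ (by positivity), c • e₀,
    R / 2 / (1 + ‖c • e₀‖), by positivity, fun y hy s hs0 hsδ hyz hmem => ?_⟩
  obtain ⟨z, hz, hzy⟩ := Metric.mem_thickening_iff.1 hyz
  rw [lt_div_iff₀ (by positivity)] at hsδ
  rw [Metric.mem_ball, dist_eq_norm] at hy
  rw [dist_eq_norm] at hzy
  have hsR : s < R / 2 := by nlinarith [norm_nonneg (c • e₀)]
  have hse : ‖s • c • e₀‖ < R / 2 := by
    rw [norm_smul, Real.norm_of_nonneg hs0.le]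
    nlinarith
  have hz' : z ∈ Metric.ball x₀ R := by
    rw [Metric.mem_ball, dist_eq_norm]
    calc ‖z - x₀‖ = ‖(y - x₀) - (y - z)‖ := by congr 1; abel
      _ ≤ ‖y - x₀‖ + ‖y - z‖ := norm_sub_le _ _
      _ < R := by linarith
  have hp' : y + s • c • e₀ ∈ Metric.ball x₀ R := by
    rw [Metric.mem_ball, dist_eq_norm]
    calc ‖y + s • c • e₀ - x₀‖ = ‖(y - x₀) + s • c • e₀‖ := by congr 1; abel
      _ ≤ ‖y - x₀‖ + ‖s • c • e₀‖ := norm_add_le _ _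
      _ < R := by linarith
  have hgz : 0 ≤ g z := by
    by_contra! hneg
    have : z ∈ Ω ∩ U := hΩU ▸ ⟨(hball hz').2, hneg⟩
    exact hz this.1
  have hgp : g (y + s • c • e₀) < 0 := by
    have : y + s • c • e₀ ∈ {y ∈ U | g y < 0} := hΩU ▸ ⟨hmem, (hball hp').2⟩
    exact this.2
  have h1 := happ _ (hball hp').1 _ (hball hz').1
  have h2 : L (y + s • c • e₀ - z) = L (y - z) + s * c := by
    rw [show y + s • c • e₀ - z = (y - z) + s • c • e₀ by abel, map_add, map_smul, map_smul, he₀]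
    simp
  have h3 : |L (y - z)| ≤ ‖L‖ * s := by
    refine (L.le_opNorm _).trans ?_
    gcongr
  have h4 : ‖y + s • c • e₀ - z‖ ≤ s + s * c * ‖e₀‖ := by
    rw [show y + s • c • e₀ - z = (y - z) + s • c • e₀ by abel]
    refine (norm_add_le _ _).trans ?_
    rw [norm_smul, norm_smul, Real.norm_of_nonneg hs0.le, Real.norm_of_nonneg hcpos.le, mul_assoc]
    linarith
  have hη1 : (η : ℝ) * (‖e₀‖ + 1) = 1 / 2 := by
    change 1 / (2 * (‖e₀‖ + 1)) * (‖e₀‖ + 1) = 1 / 2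
    field_simp
  have hη0 : (0 : ℝ) ≤ η := η.2
  have h5 : (η : ℝ) * ‖y + s • c • e₀ - z‖ ≤ s * (1 / 2) * c + s * (1 / 2) - η * s * c := by
    have := mul_le_mul_of_nonneg_left h4 hη0
    have hc1 : 1 ≤ c := by linarith [norm_nonneg L]
    have : (η : ℝ) * (s + s * c * ‖e₀‖) = η * s + s * c * (η * ‖e₀‖) := by ring
    have h6 : (η : ℝ) * ‖e₀‖ = 1 / 2 - η := by linarith
    have h7 : (η : ℝ) ≤ 1 / 2 := by nlinarith [norm_nonneg e₀]
    rw [h6] at this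
    nlinarith
  rw [h2, Real.norm_eq_abs] at h1
  have h8 := (abs_le.1 h1).1
  have h9 := (abs_le.1 h3).1
  have : 0 ≤ (η : ℝ) * s * c := by positivity
  have : s * c = 2 * (‖L‖ * s) + s := by rw [hc]; ring
  nlinarith

theorem exists_mem_segment_frontier {E : Type*} [NormedAddCommGroup E] [NormedSpace ℝ E]
    {U : Set E} (hU : IsOpen U) {y z : E} (hy : y ∈ U) (hz : z ∉ U) :
    ∃ b ∈ segment ℝ y z, b ∈ frontier U := by
  by_contra! h
  have hz' : z ∉ closure U := fun hc =>
    h z (right_mem_segment ℝ y z) ⟨hc, by rwa [hU.interior_eq]⟩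
  have hcover : segment ℝ y z ⊆ U ∪ (closure U)ᶜ := fun b hb => by
    by_cases hbU : b ∈ U
    · exact Or.inl hbU
    · exact Or.inr fun hc => h b hb ⟨hc, by rwa [hU.interior_eq]⟩
  obtain ⟨b, -, hb1, hb2⟩ := (convex_segment y z).isPreconnected U (closure U)ᶜ hU
    isClosed_closure.isOpen_compl hcover ⟨y, left_mem_segment ℝ y z, hy⟩
    ⟨z, right_mem_segment ℝ y z, hz'⟩
  exact hb2 (subset_closure hb1)

/-- The frontier is compact, so finitely many of the local directions suffice. A point of `Ω` within
`s` of the complement is also within `s` of the frontier, because the segment to an outside point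
crosses it. -/
theorem exists_finite_exit_directions {Ω : Opens (EuclideanSpace ℝ (Fin N))}
    (hΩ : IsSmoothDomain Ω) : ∃ (t : Finset (frontier (Ω : Set (EuclideanSpace ℝ (Fin N)))))
      (e : frontier (Ω : Set (EuclideanSpace ℝ (Fin N))) → EuclideanSpace ℝ (Fin N)), ∃ δ > 0,
      ∀ s, 0 < s → s < δ → ∀ y ∈ (Ω : Set (EuclideanSpace ℝ (Fin N))),
        y ∈ Metric.thickening s (Ω : Set (EuclideanSpace ℝ (Fin N)))ᶜ →
        ∃ i ∈ t, y + s • e i ∉ (Ω : Set (EuclideanSpace ℝ (Fin N))) := by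
  have hcomp : IsCompact (frontier (Ω : Set (EuclideanSpace ℝ (Fin N)))) :=
    Metric.isCompact_of_isClosed_isBounded isClosed_frontier
      (hΩ.isBounded.closure.subset frontier_subset_closure)
  choose! V hV e δ hδ hexit using fun (x : frontier (Ω : Set (EuclideanSpace ℝ (Fin N)))) =>
    hΩ.hasSmoothBoundary.exists_exit_direction x.2
  obtain ⟨t, ht⟩ := hcomp.elim_nhds_subcover' (fun x hx => interior (V ⟨x, hx⟩))
    fun x hx => interior_mem_nhds.2 (hV ⟨x, hx⟩)
  obtain ⟨r, hr, hthick⟩ := hcomp.exists_thickening_subset_open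
    (isOpen_biUnion fun i _ => isOpen_interior) ht
  obtain ⟨d, hd, hdt⟩ : ∃ d > 0, ∀ i ∈ t, d ≤ δ i := by
    rcases t.eq_empty_or_nonempty with rfl | hne
    · exact ⟨1, one_pos, by simp⟩
    · exact ⟨t.inf' hne δ, by simp [Finset.lt_inf'_iff, hδ], fun i hi => Finset.inf'_le _ hi⟩
  refine ⟨t, e, min d r, lt_min hd hr, fun s hs hsd y hy hyt => ?_⟩
  obtain ⟨z, hz, hyz⟩ := Metric.mem_thickening_iff.1 hyt
  obtain ⟨b, hb, hbf⟩ := exists_mem_segment_frontier Ω.isOpen hy hz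
  have hyb : dist y b < r := by
    have := norm_sub_le_of_mem_segment hb
    rw [dist_comm, dist_eq_norm]
    rw [dist_comm, dist_eq_norm] at hyz
    exact (this.trans_lt hyz).trans (hsd.trans_le (min_le_right _ _))
  have hyU := hthick (Metric.mem_thickening_iff.2 ⟨b, hbf, hyb⟩)
  simp only [mem_iUnion] at hyU
  obtain ⟨i, hi, hyi⟩ := hyU
  exact ⟨i, hi, hexit i y (interior_subset hyi) s hs
    (hsd.trans_le ((min_le_left _ _).trans (hdt i hi))) hyt⟩

/-- Where `y + s • e i` lies outside `Ω`, the extension by zero vanishes there, so the size of `w`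
at `y` is that of a translation increment, of order `s` in `L^q`. This takes the place of a Hardy
inequality. -/
theorem exists_eLpNorm_boundaryLayer_le {Ω : Opens (EuclideanSpace ℝ (Fin N))}
    (hΩ : IsSmoothDomain Ω) {q : ℝ≥0∞} [Fact (1 ≤ q)] (hq' : q ≠ ⊤) :
    ∃ C : ℝ, 0 ≤ C ∧ ∃ δ > 0, ∀ s, 0 < s → s < δ → ∀ w : SobolevWZero Ω q,
      eLpNorm (SobolevWZero.field w) q (volume.restrict ((Ω : Set (EuclideanSpace ℝ (Fin N))) ∩
        Metric.thickening s (Ω : Set (EuclideanSpace ℝ (Fin N)))ᶜ)) ≤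
      ENNReal.ofReal (C * s) * ‖w‖ₑ := by
  obtain ⟨t, e, δ, hδ, hexit⟩ := exists_finite_exit_directions hΩ
  refine ⟨∑ i ∈ t, ‖e i‖, Finset.sum_nonneg fun _ _ => norm_nonneg _, δ, hδ,
    fun s hs hsδ w => ?_⟩
  set V := (Ω : Set (EuclideanSpace ℝ (Fin N))).indicator (SobolevWZero.field w) with hV
  have hVm : MemLp V q volume := memLp_indicator_LpOn _
  have hlayer : MeasurableSet ((Ω : Set (EuclideanSpace ℝ (Fin N))) ∩
      Metric.thickening s (Ω : Set (EuclideanSpace ℝ (Fin N)))ᶜ) :=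
    (measurableSet_domain Ω).inter Metric.isOpen_thickening.measurableSet
  have hmeas : ∀ i, AEStronglyMeasurable (fun y => ‖V (y + s • e i) - V y‖) volume := fun i =>
    ((hVm.1.comp_measurePreserving (measurePreserving_add_right _ (s • e i))).sub hVm.1).norm
  calc eLpNorm (SobolevWZero.field w) q (volume.restrict _)
      ≤ eLpNorm (∑ i ∈ t, fun y => ‖V (y + s • e i) - V y‖) q (volume.restrict
          ((Ω : Set (EuclideanSpace ℝ (Fin N))) ∩
            Metric.thickening s (Ω : Set (EuclideanSpace ℝ (Fin N)))ᶜ)) := by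
        refine eLpNorm_mono_ae ?_
        filter_upwards [ae_restrict_mem hlayer] with y hy
        obtain ⟨i, hi, hexi⟩ := hexit s hs hsδ y hy.1 hy.2
        have h0 : V (y + s • e i) = 0 := indicator_of_notMem hexi _
        have h1 : V y = SobolevWZero.field w y := indicator_of_mem hy.1 _
        rw [Finset.sum_apply, Real.norm_of_nonneg (Finset.sum_nonneg fun _ _ => norm_nonneg _)]
        -- The exit direction depends on `y`, hence the sum over all of them.
        refine le_trans ?_ (Finset.single_le_sum (f := fun i => ‖V (y + s • e i) - V y‖)
          (fun _ _ => norm_nonneg _) hi)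
        simp only [h0, h1, zero_sub, norm_neg, le_refl]
    _ ≤ eLpNorm (∑ i ∈ t, fun y => ‖V (y + s • e i) - V y‖) q volume :=
        eLpNorm_mono_measure _ Measure.restrict_le_self
    _ ≤ ∑ i ∈ t, eLpNorm (fun y => ‖V (y + s • e i) - V y‖) q volume :=
        eLpNorm_sum_le (fun i _ => hmeas i) Fact.out
    _ ≤ ∑ i ∈ t, ENNReal.ofReal (‖e i‖ * s) * ‖w‖ₑ := by
        refine Finset.sum_le_sum fun i _ => ?_
        rw [eLpNorm_norm]
        refine (eLpNorm_translate_field_le hq' w (s • e i)).trans (le_of_eq ?_)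
        congr 1
        rw [← ofReal_norm, norm_smul, Real.norm_of_nonneg hs.le, mul_comm]
    _ = ENNReal.ofReal ((∑ i ∈ t, ‖e i‖) * s) * ‖w‖ₑ := by
        have h : (∑ i ∈ t, ‖e i‖) * s = ∑ i ∈ t, ‖e i‖ * s := Finset.sum_mul _ _ _
        rw [h, ENNReal.ofReal_sum_of_nonneg fun i _ => mul_nonneg (norm_nonneg _) hs.le,
          Finset.sum_mul]

end BoundaryLayer

/-! ### Hölder's inequality and the distance to the complement. -/

theorem lintegral_enorm_mul_le_of_holderConjugate {p q : ℝ≥0∞} {α F G : Type*} [MeasurableSpace α]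
    [NormedAddCommGroup F] [NormedAddCommGroup G] {μ : Measure α}
    (hpq : ENNReal.HolderConjugate p q) {f : α → F} {g : α → G}
    (hf : AEStronglyMeasurable f μ) (hg : AEStronglyMeasurable g μ) :
    ∫⁻ x, ‖f x‖ₑ * ‖g x‖ₑ ∂μ ≤ eLpNorm f p μ * eLpNorm g q μ := by
  have h := eLpNorm_smul_le_mul_eLpNorm (p := p) (q := q) (r := 1) hg.norm hf.norm
  rw [eLpNorm_norm, eLpNorm_norm, eLpNorm_one_eq_lintegral_enorm] at h
  refine le_trans (lintegral_mono fun x => ?_) h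
  simp [enorm_mul]

theorem eventually_notMem_thickening_compl {E : Type*} [NormedAddCommGroup E]
    {U K : Set E} (hU : IsOpen U) (hK : IsCompact K)
    (hKU : K ⊆ U) (c : ℝ) : ∀ᶠ s in 𝓝[>] (0 : ℝ), ∀ x ∈ K, x ∉ Metric.thickening (c * s) Uᶜ := by
  obtain ⟨r, hr, hthick⟩ := hK.exists_thickening_subset_open hU hKU
  have hlim : Tendsto (fun s : ℝ => c * s) (𝓝[>] 0) (𝓝 0) := by
    have : Tendsto (fun s : ℝ => c * s) (𝓝 0) (𝓝 (c * 0)) := tendsto_id.const_mul c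
    rw [mul_zero] at this
    exact this.mono_left nhdsWithin_le_nhds
  filter_upwards [hlim.eventually_lt_const hr] with s hs x hx hmem
  obtain ⟨z, hz, hzx⟩ := Metric.mem_thickening_iff.1 hmem
  refine hz (hthick (Metric.mem_thickening_iff.2 ⟨x, hx, ?_⟩))
  rw [dist_comm]
  exact hzx.trans hs

theorem measurableSet_compl_thickening {E : Type*} [NormedAddCommGroup E]
    [MeasurableSpace E] [BorelSpace E] (U : Set E) (s : ℝ) :
    MeasurableSet (Metric.thickening s Uᶜ)ᶜ := Metric.isOpen_thickening.measurableSet.compl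

/-! ### Smooth cutoff functions near the boundary. -/

section Cutoff

variable {E : Type*} [NormedAddCommGroup E] [InnerProductSpace ℝ E] [FiniteDimensional ℝ E]
  [MeasurableSpace E] [BorelSpace E]

/-- A smooth function which equals one at distance at least `3 * s` from the complement of `U`, and
vanishes at distance less than `s` from it. -/
noncomputable def cutoff (U : Set E) (s : ℝ) : E → ℝ :=
  convolution ((Metric.thickening (2 * s) Uᶜ)ᶜ.indicator fun _ => (1 : ℝ)) (mollifier s)
    (ContinuousLinearMap.lsmul ℝ ℝ) volume

theorem locallyIntegrable_indicator_one {A : Set E} (hA : MeasurableSet A) :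
    LocallyIntegrable (A.indicator fun _ => (1 : ℝ)) volume :=
  (locallyIntegrable_const 1).indicator hA

theorem cutoff_apply (U : Set E) (s : ℝ) (x : E) : cutoff U s x =
    ∫ t, (Metric.thickening (2 * s) Uᶜ)ᶜ.indicator (fun _ => (1 : ℝ)) t * mollifier s (x - t) :=
  rfl

theorem contDiff_cutoff (U : Set E) {s : ℝ} (hs : 0 < s) : ContDiff ℝ ∞ (cutoff U s) :=
  (hasCompactSupport_mollifier hs).contDiff_convolution_right _
    (locallyIntegrable_indicator_one (measurableSet_compl_thickening U _))
    (contDiff_mollifier s)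

theorem integrable_mollifier_sub {s : ℝ} (hs : 0 < s) (x : E) :
    Integrable fun t : E => mollifier s (x - t) :=
  (((contDiff_mollifier s).continuous.integrable_of_hasCompactSupport
    (hasCompactSupport_mollifier hs))).comp_sub_left x

theorem integral_mollifier_sub {s : ℝ} (hs : 0 < s) (x : E) :
    ∫ t : E, mollifier s (x - t) = 1 := by
  rw [integral_sub_left_eq_self (mollifier s : E → ℝ) volume x, integral_mollifier hs]

theorem cutoff_nonneg (U : Set E) {s : ℝ} (hs : 0 < s) (x : E) : 0 ≤ cutoff U s x := by
  rw [cutoff_apply]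
  exact integral_nonneg fun t => mul_nonneg (indicator_nonneg (fun _ _ => zero_le_one) _)
    (mollifier_nonneg hs _)

theorem cutoff_le_one (U : Set E) {s : ℝ} (hs : 0 < s) (x : E) : cutoff U s x ≤ 1 := by
  refine le_of_le_of_eq ?_ (integral_mollifier_sub hs x)
  rw [cutoff_apply]
  refine integral_mono_of_nonneg (Eventually.of_forall fun t =>
    mul_nonneg (indicator_nonneg (fun _ _ => zero_le_one) _) (mollifier_nonneg hs _))
    (integrable_mollifier_sub hs x) (Eventually.of_forall fun t => ?_)
  refine mul_le_of_le_one_left (mollifier_nonneg hs _) ?_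
  exact indicator_le_self' (fun _ _ => zero_le_one) t

theorem cutoff_eq_one {U : Set E} {s : ℝ} (hs : 0 < s) {x : E}
    (hx : x ∉ Metric.thickening (3 * s) Uᶜ) : cutoff U s x = 1 := by
  refine Eq.trans ?_ (integral_mollifier_sub hs x)
  rw [cutoff_apply]
  refine integral_congr_ae (Eventually.of_forall fun t => ?_)
  by_cases ht : s ≤ ‖x - t‖
  · simp only [mollifier_eq_zero hs ht, mul_zero]
  · have : t ∈ (Metric.thickening (2 * s) Uᶜ)ᶜ := by
      intro hmem
      obtain ⟨z, hz, hzt⟩ := Metric.mem_thickening_iff.1 hmem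
      refine hx (Metric.mem_thickening_iff.2 ⟨z, hz, ?_⟩)
      rw [not_le, ← dist_eq_norm] at ht
      linarith [dist_triangle x t z]
    simp only [indicator_of_mem this, one_mul]

theorem cutoff_eq_zero {U : Set E} {s : ℝ} (hs : 0 < s) {x : E}
    (hx : x ∈ Metric.thickening s Uᶜ) : cutoff U s x = 0 := by
  rw [cutoff_apply]
  refine integral_eq_zero_of_ae (Eventually.of_forall fun t => ?_)
  by_cases ht : s ≤ ‖x - t‖
  · simp only [mollifier_eq_zero hs ht, mul_zero, Pi.zero_apply]
  · have : t ∉ (Metric.thickening (2 * s) Uᶜ)ᶜ := by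
      rw [notMem_compl_iff]
      obtain ⟨z, hz, hzt⟩ := Metric.mem_thickening_iff.1 hx
      refine Metric.mem_thickening_iff.2 ⟨z, hz, ?_⟩
      rw [not_le, ← dist_eq_norm, dist_comm] at ht
      linarith [dist_triangle t x z]
    simp only [indicator_of_notMem this, zero_mul, Pi.zero_apply]

theorem tsupport_cutoff_subset {U : Set E} {s : ℝ} (hs : 0 < s) : tsupport (cutoff U s) ⊆ U := by
  have h : tsupport (cutoff U s) ⊆ (Metric.thickening s Uᶜ)ᶜ :=
    closure_minimal (fun x hx hmem => hx (cutoff_eq_zero hs hmem))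
      Metric.isOpen_thickening.isClosed_compl
  exact h.trans (compl_subset_comm.1 (Metric.self_subset_thickening hs _))

/-- The derivative falls on the mollifier and the indicator is at most one, so only the `L^1` norm
of the mollifier's gradient remains, whatever the set. -/
theorem norm_fderiv_cutoff_le (U : Set E) {s : ℝ} (hs : 0 < s) (x : E) :
    ‖fderiv ℝ (cutoff U s) x‖ ≤ mollifierConst E / s := by
  have h := (hasCompactSupport_mollifier hs).hasFDerivAt_convolution_right
    (ContinuousLinearMap.lsmul ℝ ℝ) (locallyIntegrable_indicator_one
      (measurableSet_compl_thickening U (2 * s))) ((contDiff_mollifier s).of_le (by simp)) x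
  have h' : HasFDerivAt (cutoff U s) _ x := h
  rw [h'.fderiv, convolution, ← integral_norm_fderiv_mollifier hs,
    ← integral_sub_left_eq_self (fun y => ‖fderiv ℝ (mollifier s : E → ℝ) y‖) volume x]
  refine norm_integral_le_of_norm_le ((integrable_fderiv_mollifier hs).norm.comp_sub_left x)
    (Eventually.of_forall fun t => ?_)
  by_cases ht : t ∈ (Metric.thickening (2 * s) Uᶜ)ᶜ
  · rw [indicator_of_mem ht]
    refine le_of_eq (congrArg _ ?_)
    ext y
    simp [ContinuousLinearMap.precompR_apply]
  · rw [indicator_of_notMem ht, map_zero, zero_apply, norm_zero]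
    exact norm_nonneg _

/-- The margin grows from `3 * s` to `4 * s` so that the cutoff is constant on a ball around `x`. -/
theorem fderiv_cutoff_eq_zero {U : Set E} {s : ℝ} (hs : 0 < s) {x : E}
    (hx : x ∉ Metric.thickening (4 * s) Uᶜ) : fderiv ℝ (cutoff U s) x = 0 := by
  have h : cutoff U s =ᶠ[𝓝 x] fun _ => 1 := by
    filter_upwards [Metric.ball_mem_nhds x hs] with y hy
    refine cutoff_eq_one hs fun hmem => hx ?_
    obtain ⟨z, hz, hzy⟩ := Metric.mem_thickening_iff.1 hmem
    refine Metric.mem_thickening_iff.2 ⟨z, hz, ?_⟩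
    rw [Metric.mem_ball, dist_comm] at hy
    linarith [dist_triangle x y z]
  rw [h.fderiv_eq, fderiv_const_apply]

theorem tendsto_cutoff {U : Set E} (hU : IsOpen U) {x : E} (hx : x ∈ U) :
    Tendsto (fun s => cutoff U s x) (𝓝[>] 0) (𝓝 1) := by
  refine tendsto_const_nhds.congr' ?_
  filter_upwards [eventually_notMem_thickening_compl hU isCompact_singleton
    (singleton_subset_iff.2 hx) 3, self_mem_nhdsWithin] with s h hs
  exact (cutoff_eq_one hs (h x rfl)).symm

end Cutoff

/-! ### The flux through the cutoff layer vanishes. -/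

section CutoffLimit

variable {N : ℕ} {Ω : Opens (EuclideanSpace ℝ (Fin N))} {p q : ℝ≥0∞} [Fact (1 ≤ p)] [Fact (1 ≤ q)]

/-- The cutoff function times a smooth function, as a test function on the domain. -/
noncomputable def cutoffTest (hΩ : Bornology.IsBounded (Ω : Set (EuclideanSpace ℝ (Fin N)))) {s : ℝ}
    (hs : 0 < s) {ζ : EuclideanSpace ℝ (Fin N) → ℝ} (hζ : ContDiff ℝ ∞ ζ) : 𝓓(Ω, ℝ) where
  toFun x := cutoff (Ω : Set (EuclideanSpace ℝ (Fin N))) s x * ζ x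
  contDiff' := (contDiff_cutoff _ hs).mul hζ
  hasCompactSupport' := by
    refine HasCompactSupport.mul_right ?_
    exact Metric.isCompact_of_isClosed_isBounded (isClosed_tsupport _)
      (hΩ.subset (tsupport_cutoff_subset hs))
  tsupport_subset' := (tsupport_mul_subset_left).trans (tsupport_cutoff_subset hs)

/-- The gradient of the cutoff is `O(1/s)` and lives in a layer of width `4 * s`, where `w` is
`O(s)` in `L^q`; the powers cancel. Uniformity in `f`, `w` and `s` serves both the density argument
below and the domination in time. -/
theorem exists_lintegral_fderiv_cutoff_le (hΩ : IsSmoothDomain Ω) (hq' : q ≠ ⊤)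
    (hpq : ENNReal.HolderConjugate p q) : ∃ C : ℝ, 0 ≤ C ∧ ∃ δ > 0, ∀ s, 0 < s → s < δ →
    ∀ (f : LpOn Ω p ℝ) (w : SobolevWZero Ω q),
      ∫⁻ x in (Ω : Set (EuclideanSpace ℝ (Fin N))), ‖f x‖ₑ *
        (‖fderiv ℝ (cutoff (Ω : Set (EuclideanSpace ℝ (Fin N))) s) x‖ₑ *
          ‖SobolevWZero.field w x‖ₑ) ≤ ENNReal.ofReal C * (‖f‖ₑ * ‖w‖ₑ) := by
  obtain ⟨C, hC, δ, hδ, hle⟩ := exists_eLpNorm_boundaryLayer_le hΩ hq'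
  set B := mollifierConst (EuclideanSpace ℝ (Fin N)) with hB
  have hB0 : 0 ≤ B := mollifierConst_nonneg
  refine ⟨B * C * 4, by positivity, δ / 4, by positivity, fun s hs hsδ f w => ?_⟩
  set A := Metric.thickening (4 * s) (Ω : Set (EuclideanSpace ℝ (Fin N)))ᶜ with hA
  have hAm : MeasurableSet A := Metric.isOpen_thickening.measurableSet
  set μ := volume.restrict (Ω : Set (EuclideanSpace ℝ (Fin N))) with hμ
  calc ∫⁻ x, ‖f x‖ₑ * (‖fderiv ℝ (cutoff (Ω : Set (EuclideanSpace ℝ (Fin N))) s) x‖ₑ *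
          ‖SobolevWZero.field w x‖ₑ) ∂μ
      ≤ ∫⁻ x, A.indicator (fun x => ENNReal.ofReal (B / s) *
          (‖f x‖ₑ * ‖SobolevWZero.field w x‖ₑ)) x ∂μ := by
        refine lintegral_mono fun x => ?_
        by_cases hx : x ∈ A
        · rw [indicator_of_mem hx, mul_left_comm]
          gcongr
          rw [← ofReal_norm]
          exact ENNReal.ofReal_le_ofReal (norm_fderiv_cutoff_le _ hs x)
        · rw [fderiv_cutoff_eq_zero hs hx]
          simp
    _ = ENNReal.ofReal (B / s) * ∫⁻ x, ‖f x‖ₑ * ‖SobolevWZero.field w x‖ₑ ∂(μ.restrict A) := by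
        rw [lintegral_indicator hAm, lintegral_const_mul' _ _ ENNReal.ofReal_ne_top]
    _ ≤ ENNReal.ofReal (B / s) * (‖f‖ₑ * (ENNReal.ofReal (C * (4 * s)) * ‖w‖ₑ)) := by
        gcongr
        refine (lintegral_enorm_mul_le_of_holderConjugate hpq (Lp.aestronglyMeasurable f).restrict
          (Lp.aestronglyMeasurable _).restrict).trans ?_
        gcongr
        · rw [Lp.enorm_def]
          exact eLpNorm_mono_measure _ Measure.restrict_le_self
        · rw [Measure.restrict_restrict hAm, inter_comm]
          exact hle (4 * s) (by positivity) (by linarith) w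
    _ = ENNReal.ofReal (B * C * 4) * (‖f‖ₑ * ‖w‖ₑ) := by
        have : B * C * 4 = B / s * (C * (4 * s)) := by field_simp
        rw [this, ENNReal.ofReal_mul (show 0 ≤ B / s by positivity)]
        ring

/-- The integrals are bounded uniformly in `s` by the norm of `w`, so a test field may be
subtracted: its support is at positive distance from the boundary, and the gradient of the cutoff
vanishes there for small `s`. -/
theorem tendsto_lintegral_fderiv_cutoff (hΩ : IsSmoothDomain Ω) (hq' : q ≠ ⊤)
    (hpq : ENNReal.HolderConjugate p q) (f : LpOn Ω p ℝ) (w : SobolevWZero Ω q) :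
    Tendsto (fun s => ∫⁻ x in (Ω : Set (EuclideanSpace ℝ (Fin N))), ‖f x‖ₑ *
        (‖fderiv ℝ (cutoff (Ω : Set (EuclideanSpace ℝ (Fin N))) s) x‖ₑ *
          ‖SobolevWZero.field w x‖ₑ)) (𝓝[>] 0) (𝓝 0) := by
  obtain ⟨C, hC, δ, hδ, hle⟩ := exists_lintegral_fderiv_cutoff_le (p := p) hΩ hq' hpq
  rw [ENNReal.tendsto_nhds_zero]
  intro ε hε
  obtain ⟨η, hη, hηε⟩ : ∃ η : ℝ, 0 < η ∧ ENNReal.ofReal C * (‖f‖ₑ * ENNReal.ofReal η) ≤ ε := by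
    have h0 : Tendsto (fun η : ℝ => ENNReal.ofReal C * (‖f‖ₑ * ENNReal.ofReal η)) (𝓝[>] 0)
        (𝓝 (ENNReal.ofReal C * (‖f‖ₑ * ENNReal.ofReal 0))) := by
      refine Tendsto.mono_left ?_ nhdsWithin_le_nhds
      exact ENNReal.Tendsto.const_mul (ENNReal.Tendsto.const_mul
        (ENNReal.continuous_ofReal.tendsto 0) (Or.inr enorm_ne_top)) (Or.inr ENNReal.ofReal_ne_top)
    simp only [ENNReal.ofReal_zero, mul_zero] at h0
    obtain ⟨η, h1, h2⟩ := ((h0.eventually_le_const hε).and self_mem_nhdsWithin).exists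
    exact ⟨η, h2, h1⟩
  obtain ⟨z, ⟨φ, hφ, -⟩, hwz⟩ := SobolevWZero.exists_testField_near w hη
  filter_upwards [eventually_notMem_thickening_compl Ω.isOpen φ.hasCompactSupport φ.tsupport_subset 4,
    self_mem_nhdsWithin, Ioo_mem_nhdsGT hδ] with s hs4 hs0 hsδ
  have hsub := hle s hs0 hsδ.2 f (w - z)
  refine le_trans (le_trans (lintegral_mono_ae ?_) hsub) (le_trans ?_ hηε)
  · filter_upwards [hφ, Lp.coeFn_sub (SobolevWZero.field w) (SobolevWZero.field z)] with x hx hx2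
    gcongr ‖f x‖ₑ * ?_
    by_cases hxs : x ∈ tsupport φ
    · rw [fderiv_cutoff_eq_zero hs0 (hs4 x hxs)]
      simp
    · have h0 : SobolevWZero.field z x = 0 := by
        exact hx.trans (image_eq_zero_of_notMem_tsupport hxs)
      rw [SobolevWZero.field_sub, hx2, Pi.sub_apply, h0, sub_zero]
  · gcongr
    rw [← ofReal_norm]
    exact ENNReal.ofReal_le_ofReal hwz.le

end CutoffLimit

/-! ### Products and integrals as continuous maps on Lebesgue spaces. -/

section Pairings

variable {N : ℕ} {Ω : Opens (EuclideanSpace ℝ (Fin N))} {p q : ℝ≥0∞}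

theorem IsSmoothDomain.isFiniteMeasure (hΩ : IsSmoothDomain Ω) :
    IsFiniteMeasure (volume.restrict (Ω : Set (EuclideanSpace ℝ (Fin N)))) :=
  ⟨by simpa using hΩ.isBounded.measure_lt_top⟩

theorem integrable_clm_apply_LpOn_one {F : Type} [NormedAddCommGroup F] [NormedSpace ℝ F]
    {L : EuclideanSpace ℝ (Fin N) → F →L[ℝ] ℝ}
    (hL : AEStronglyMeasurable L (volume.restrict (Ω : Set (EuclideanSpace ℝ (Fin N))))) {Z : ℝ}
    (hZ : ∀ x ∈ (Ω : Set (EuclideanSpace ℝ (Fin N))), ‖L x‖ ≤ Z) (h : LpOn Ω 1 F) :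
    Integrable (fun x => L x (h x)) (volume.restrict (Ω : Set (EuclideanSpace ℝ (Fin N)))) := by
  refine Integrable.mono' ((L1.integrable_coeFn h).norm.const_mul Z)
    ((ContinuousLinearMap.id ℝ (F →L[ℝ] ℝ)).aestronglyMeasurable_comp₂ hL (Lp.aestronglyMeasurable h)) ?_
  filter_upwards [ae_restrict_mem (measurableSet_domain Ω)] with x hx
  exact (L x).le_of_opNorm_le (hZ x hx) _

/-- Integration on the domain against a bounded field of linear forms. -/
noncomputable def integralAgainst {F : Type} [NormedAddCommGroup F] [NormedSpace ℝ F]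
    {L : EuclideanSpace ℝ (Fin N) → F →L[ℝ] ℝ}
    (hL : AEStronglyMeasurable L (volume.restrict (Ω : Set (EuclideanSpace ℝ (Fin N))))) {Z : ℝ}
    (hZ : ∀ x ∈ (Ω : Set (EuclideanSpace ℝ (Fin N))), ‖L x‖ ≤ Z) : LpOn Ω 1 F →L[ℝ] ℝ :=
  LinearMap.mkContinuous
    { toFun := fun h => ∫ x in (Ω : Set (EuclideanSpace ℝ (Fin N))), L x (h x)
      map_add' := fun h₁ h₂ => by
        rw [← integral_add (integrable_clm_apply_LpOn_one hL hZ h₁)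
          (integrable_clm_apply_LpOn_one hL hZ h₂)]
        refine integral_congr_ae ?_
        filter_upwards [Lp.coeFn_add h₁ h₂] with x hx
        rw [hx, Pi.add_apply, map_add]
      map_smul' := fun c h => by
        rw [RingHom.id_apply, ← integral_smul]
        refine integral_congr_ae ?_
        filter_upwards [Lp.coeFn_smul c h] with x hx
        rw [hx, Pi.smul_apply, map_smul] } Z fun h => by
    rw [L1.norm_eq_integral_norm, ← integral_const_mul]
    refine norm_integral_le_of_norm_le ((L1.integrable_coeFn h).norm.const_mul Z) ?_
    filter_upwards [ae_restrict_mem (measurableSet_domain Ω)] with x hx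
    exact (L x).le_of_opNorm_le (hZ x hx) _

theorem norm_integral_clm_apply_LpOn_one_le {F : Type} [NormedAddCommGroup F] [NormedSpace ℝ F]
    {L : EuclideanSpace ℝ (Fin N) → F →L[ℝ] ℝ} {Z : ℝ}
    (hZ : ∀ x ∈ (Ω : Set (EuclideanSpace ℝ (Fin N))), ‖L x‖ ≤ Z) (h : LpOn Ω 1 F) :
    ‖∫ x in (Ω : Set (EuclideanSpace ℝ (Fin N))), L x (h x)‖ ≤ Z * ‖h‖ := by
  rw [L1.norm_eq_integral_norm, ← integral_const_mul]
  refine norm_integral_le_of_norm_le ((L1.integrable_coeFn h).norm.const_mul Z) ?_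
  filter_upwards [ae_restrict_mem (measurableSet_domain Ω)] with x hx
  exact (L x).le_of_opNorm_le (hZ x hx) _

/-- The product of `f ∈ L^p` and `v ∈ L^q` as an element of `L^1`, for conjugate exponents. -/
noncomputable def mulL (Ω : Opens (EuclideanSpace ℝ (Fin N))) (p q : ℝ≥0∞) [Fact (1 ≤ p)]
    [Fact (1 ≤ q)] [ENNReal.HolderConjugate p q] (F : Type) [NormedAddCommGroup F]
    [NormedSpace ℝ F] : LpOn Ω p ℝ →L[ℝ] LpOn Ω q F →L[ℝ] LpOn Ω 1 F :=
  (ContinuousLinearMap.lsmul ℝ ℝ : ℝ →L[ℝ] F →L[ℝ] F).holderL _ p q 1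

theorem coeFn_mulL [Fact (1 ≤ p)] [Fact (1 ≤ q)] [ENNReal.HolderConjugate p q] {F : Type}
    [NormedAddCommGroup F] [NormedSpace ℝ F] (f : LpOn Ω p ℝ) (v : LpOn Ω q F) :
    mulL Ω p q F f v =ᵐ[volume.restrict (Ω : Set (EuclideanSpace ℝ (Fin N)))]
      fun x => f x • v x :=
  ContinuousLinearMap.coeFn_holder _ f v

theorem norm_mulL_le [Fact (1 ≤ p)] [Fact (1 ≤ q)] [ENNReal.HolderConjugate p q] {F : Type}
    [NormedAddCommGroup F] [NormedSpace ℝ F] (f : LpOn Ω p ℝ) (v : LpOn Ω q F) :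
    ‖mulL Ω p q F f v‖ ≤ ‖f‖ * ‖v‖ := by
  refine (ContinuousLinearMap.norm_holder_apply_apply_le _ f v).trans ?_
  have h : ‖(ContinuousLinearMap.lsmul ℝ ℝ : ℝ →L[ℝ] F →L[ℝ] F)‖ ≤ 1 :=
    ContinuousLinearMap.opNorm_lsmul_le
  calc _ ≤ 1 * ‖f‖ * ‖v‖ := by gcongr
    _ = _ := by rw [one_mul]

/-- The constant function one in `L^q` of a domain of finite measure. -/
noncomputable def oneLp (Ω : Opens (EuclideanSpace ℝ (Fin N))) (q : ℝ≥0∞)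
    [IsFiniteMeasure (volume.restrict (Ω : Set (EuclideanSpace ℝ (Fin N))))] : LpOn Ω q ℝ :=
  (memLp_const (1 : ℝ)).toLp fun _ => 1

theorem coeFn_oneLp [IsFiniteMeasure (volume.restrict (Ω : Set (EuclideanSpace ℝ (Fin N))))] :
    oneLp Ω q =ᵐ[volume.restrict (Ω : Set (EuclideanSpace ℝ (Fin N)))] fun _ => 1 :=
  MemLp.coeFn_toLp _

/-- The inclusion of `L^p` into `L^1` on a domain of finite measure. -/
noncomputable def inclL (Ω : Opens (EuclideanSpace ℝ (Fin N))) (p q : ℝ≥0∞) [Fact (1 ≤ p)]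
    [Fact (1 ≤ q)] [ENNReal.HolderConjugate p q]
    [IsFiniteMeasure (volume.restrict (Ω : Set (EuclideanSpace ℝ (Fin N))))] :
    LpOn Ω p ℝ →L[ℝ] LpOn Ω 1 ℝ :=
  (mulL Ω p q ℝ).flip (oneLp Ω q)

theorem coeFn_inclL [Fact (1 ≤ p)] [Fact (1 ≤ q)] [ENNReal.HolderConjugate p q]
    [IsFiniteMeasure (volume.restrict (Ω : Set (EuclideanSpace ℝ (Fin N))))] (f : LpOn Ω p ℝ) :
    inclL Ω p q f =ᵐ[volume.restrict (Ω : Set (EuclideanSpace ℝ (Fin N)))] f := by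
  filter_upwards [coeFn_mulL f (oneLp Ω q), coeFn_oneLp (Ω := Ω) (q := q)] with x h1 h2
  exact h1.trans (by simp [h2])

theorem exists_bound_on_domain (hΩ : IsSmoothDomain Ω) {F : Type*} [NormedAddCommGroup F]
    {L : EuclideanSpace ℝ (Fin N) → F} (hL : Continuous L) :
    ∃ Z : ℝ, 0 ≤ Z ∧ ∀ x ∈ (Ω : Set (EuclideanSpace ℝ (Fin N))), ‖L x‖ ≤ Z := by
  have hc : IsCompact (closure (Ω : Set (EuclideanSpace ℝ (Fin N)))) :=
    hΩ.isBounded.isCompact_closure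
  obtain ⟨Z, hZ⟩ := hc.exists_bound_of_continuousOn hL.continuousOn
  exact ⟨max Z 0, le_max_right _ _, fun x hx => (hZ x (subset_closure hx)).trans (le_max_left _ _)⟩

end Pairings

/-! ### Test functions that do not vanish at the boundary. -/

section ExtendedWeakForms

variable {N : ℕ} {Ω : Opens (EuclideanSpace ℝ (Fin N))} {p q : ℝ≥0∞} [Fact (1 ≤ p)] [Fact (1 ≤ q)]
  [hpq : ENNReal.HolderConjugate p q]

theorem continuous_smul_one {ζ : EuclideanSpace ℝ (Fin N) → ℝ} (hζ : Continuous ζ) :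
    Continuous fun x => ζ x • ContinuousLinearMap.id ℝ ℝ := hζ.smul continuous_const

theorem fderiv_cutoff_mul {s : ℝ} (hs : 0 < s) {ζ : EuclideanSpace ℝ (Fin N) → ℝ}
    (hζ : ContDiff ℝ ∞ ζ) (x : EuclideanSpace ℝ (Fin N)) :
    fderiv ℝ (fun x => cutoff (Ω : Set (EuclideanSpace ℝ (Fin N))) s x * ζ x) x =
      cutoff (Ω : Set (EuclideanSpace ℝ (Fin N))) s x • fderiv ℝ ζ x +
        ζ x • fderiv ℝ (cutoff (Ω : Set (EuclideanSpace ℝ (Fin N))) s) x :=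
  fderiv_fun_mul ((contDiff_cutoff _ hs).differentiable (by simp) x)
    (hζ.differentiable (by simp) x)

theorem tendsto_integral_cutoff_smul {g : EuclideanSpace ℝ (Fin N) → ℝ}
    (hg : Integrable g (volume.restrict (Ω : Set (EuclideanSpace ℝ (Fin N))))) :
    Tendsto (fun s => ∫ x in (Ω : Set (EuclideanSpace ℝ (Fin N))),
        cutoff (Ω : Set (EuclideanSpace ℝ (Fin N))) s x • g x) (𝓝[>] 0)
      (𝓝 (∫ x in (Ω : Set (EuclideanSpace ℝ (Fin N))), g x)) := by
  refine tendsto_integral_filter_of_dominated_convergence _ ?_ ?_ hg.norm ?_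
  · filter_upwards [self_mem_nhdsWithin] with s hs
    exact (contDiff_cutoff _ hs).continuous.aestronglyMeasurable.smul hg.1
  · filter_upwards [self_mem_nhdsWithin] with s hs
    refine Eventually.of_forall fun x => ?_
    rw [norm_smul, Real.norm_of_nonneg (cutoff_nonneg _ hs x)]
    exact mul_le_of_le_one_left (norm_nonneg _) (cutoff_le_one _ hs x)
  · filter_upwards [ae_restrict_mem (measurableSet_domain Ω)] with x hx
    have := (tendsto_cutoff Ω.isOpen hx).smul_const (g x)
    rwa [one_smul] at this

/-- In the product rule for the cutoff times `ζ`, the term with the gradient of the cutoff is the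
only one left in the difference. -/
theorem enorm_integral_transport_sub_le (hΩ : IsSmoothDomain Ω) {s : ℝ} (hs : 0 < s)
    {ζ : EuclideanSpace ℝ (Fin N) → ℝ} (hζ : ContDiff ℝ ∞ ζ) {Z : ℝ}
    (hZ : ∀ x ∈ (Ω : Set (EuclideanSpace ℝ (Fin N))), ‖ζ x‖ ≤ Z)
    (f : LpOn Ω p ℝ) (w : SobolevWZero Ω q) :
    ‖(∫ x in (Ω : Set (EuclideanSpace ℝ (Fin N))), fderiv ℝ
        (fun x => cutoff (Ω : Set (EuclideanSpace ℝ (Fin N))) s x * ζ x) x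
          (mulL Ω p q _ f (SobolevWZero.field w) x)) -
      ∫ x in (Ω : Set (EuclideanSpace ℝ (Fin N))),
        cutoff (Ω : Set (EuclideanSpace ℝ (Fin N))) s x • fderiv ℝ ζ x
          (mulL Ω p q _ f (SobolevWZero.field w) x)‖ₑ ≤
      ENNReal.ofReal Z * ∫⁻ x in (Ω : Set (EuclideanSpace ℝ (Fin N))), ‖f x‖ₑ *
        (‖fderiv ℝ (cutoff (Ω : Set (EuclideanSpace ℝ (Fin N))) s) x‖ₑ *
          ‖SobolevWZero.field w x‖ₑ) := by
  have hc := (contDiff_cutoff (Ω : Set (EuclideanSpace ℝ (Fin N))) hs)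
  have hc1 : Continuous (fderiv ℝ
      (fun x => cutoff (Ω : Set (EuclideanSpace ℝ (Fin N))) s x * ζ x)) :=
    (hc.mul hζ).continuous_fderiv (by simp)
  have hc2 : Continuous fun x =>
      cutoff (Ω : Set (EuclideanSpace ℝ (Fin N))) s x • fderiv ℝ ζ x :=
    hc.continuous.smul (hζ.continuous_fderiv (by simp))
  obtain ⟨Z1, -, hZ1⟩ := exists_bound_on_domain hΩ hc1
  obtain ⟨Z2, -, hZ2⟩ := exists_bound_on_domain hΩ hc2
  have hi1 := integrable_clm_apply_LpOn_one hc1.aestronglyMeasurable hZ1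
    (mulL Ω p q _ f (SobolevWZero.field w))
  have hi2 := integrable_clm_apply_LpOn_one hc2.aestronglyMeasurable hZ2
    (mulL Ω p q _ f (SobolevWZero.field w))
  have h := integral_sub hi1 hi2
  simp only [smul_apply] at h
  rw [← h]
  refine (enorm_integral_le_lintegral_enorm _).trans ?_
  rw [← lintegral_const_mul' _ _ ENNReal.ofReal_ne_top]
  refine lintegral_mono_ae ?_
  filter_upwards [coeFn_mulL f (SobolevWZero.field w),
    ae_restrict_mem (measurableSet_domain Ω)] with x hx hxΩ
  rw [fderiv_cutoff_mul hs hζ, add_apply, smul_apply, add_sub_cancel_left, hx, smul_apply,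
    map_smul, enorm_smul, enorm_smul]
  gcongr
  · rw [← ofReal_norm]
    exact ENNReal.ofReal_le_ofReal (hZ x hxΩ)
  · exact ContinuousLinearMap.le_opENorm _ _

theorem tendsto_integral_transport_cutoff (hΩ : IsSmoothDomain Ω) (hq' : q ≠ ⊤)
    {ζ : EuclideanSpace ℝ (Fin N) → ℝ} (hζ : ContDiff ℝ ∞ ζ)
    (f : LpOn Ω p ℝ) (w : SobolevWZero Ω q) :
    Tendsto (fun s => ∫ x in (Ω : Set (EuclideanSpace ℝ (Fin N))), fderiv ℝ
        (fun x => cutoff (Ω : Set (EuclideanSpace ℝ (Fin N))) s x * ζ x) x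
          (mulL Ω p q _ f (SobolevWZero.field w) x)) (𝓝[>] 0)
      (𝓝 (∫ x in (Ω : Set (EuclideanSpace ℝ (Fin N))), fderiv ℝ ζ x
          (mulL Ω p q _ f (SobolevWZero.field w) x))) := by
  obtain ⟨Z, hZ0, hZ⟩ := exists_bound_on_domain hΩ hζ.continuous
  have hc1 : Continuous (fderiv ℝ ζ) := hζ.continuous_fderiv (by simp)
  obtain ⟨Z1, hZ10, hZ1⟩ := exists_bound_on_domain hΩ hc1
  have hi1 := integrable_clm_apply_LpOn_one hc1.aestronglyMeasurable hZ1
    (mulL Ω p q _ f (SobolevWZero.field w))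
  have h1 : Tendsto (fun s => ∫ x in (Ω : Set (EuclideanSpace ℝ (Fin N))),
        cutoff (Ω : Set (EuclideanSpace ℝ (Fin N))) s x • fderiv ℝ ζ x
          (mulL Ω p q _ f (SobolevWZero.field w) x)) (𝓝[>] 0)
      (𝓝 (∫ x in (Ω : Set (EuclideanSpace ℝ (Fin N))), fderiv ℝ ζ x
          (mulL Ω p q _ f (SobolevWZero.field w) x))) := tendsto_integral_cutoff_smul hi1
  have h2 := ENNReal.Tendsto.const_mul (tendsto_lintegral_fderiv_cutoff hΩ hq' hpq f w)
    (Or.inr (ENNReal.ofReal_ne_top (r := Z)))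
  rw [mul_zero] at h2
  have h3 : Tendsto (fun s => (∫ x in (Ω : Set (EuclideanSpace ℝ (Fin N))), fderiv ℝ
        (fun x => cutoff (Ω : Set (EuclideanSpace ℝ (Fin N))) s x * ζ x) x
          (mulL Ω p q _ f (SobolevWZero.field w) x)) -
      ∫ x in (Ω : Set (EuclideanSpace ℝ (Fin N))),
        cutoff (Ω : Set (EuclideanSpace ℝ (Fin N))) s x • fderiv ℝ ζ x
          (mulL Ω p q _ f (SobolevWZero.field w) x)) (𝓝[>] 0) (𝓝 0) := by
    rw [tendsto_zero_iff_enorm_tendsto_zero]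
    refine tendsto_of_tendsto_of_tendsto_of_le_of_le' tendsto_const_nhds h2
      (Eventually.of_forall fun _ => zero_le) ?_
    filter_upwards [self_mem_nhdsWithin] with s hs
    exact enorm_integral_transport_sub_le hΩ hs hζ hZ f w
  simpa using h3.add h1

/-- The bound is uniform in `s`, which gives the majorant in time needed in
`IsWeakSolution.weak_eq_smooth`. -/
theorem exists_norm_integral_transport_cutoff_le (hΩ : IsSmoothDomain Ω) (hq' : q ≠ ⊤)
    {ζ : EuclideanSpace ℝ (Fin N) → ℝ} (hζ : ContDiff ℝ ∞ ζ) :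
    ∃ C : ℝ, 0 ≤ C ∧ ∃ δ > 0, ∀ s, 0 < s → s < δ → ∀ (f : LpOn Ω p ℝ) (w : SobolevWZero Ω q),
      ‖∫ x in (Ω : Set (EuclideanSpace ℝ (Fin N))), fderiv ℝ
        (fun x => cutoff (Ω : Set (EuclideanSpace ℝ (Fin N))) s x * ζ x) x
          (mulL Ω p q _ f (SobolevWZero.field w) x)‖ ≤ C * (‖f‖ * ‖w‖) := by
  obtain ⟨C, hC, δ, hδ, hle⟩ := exists_lintegral_fderiv_cutoff_le (p := p) hΩ hq' hpq
  obtain ⟨Z, hZ0, hZ⟩ := exists_bound_on_domain hΩ hζ.continuous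
  have hc1 : Continuous (fderiv ℝ ζ) := hζ.continuous_fderiv (by simp)
  obtain ⟨Z1, hZ10, hZ1⟩ := exists_bound_on_domain hΩ hc1
  refine ⟨Z * C + Z1, by positivity, δ, hδ, fun s hs hsδ f w => ?_⟩
  have h1 := (enorm_integral_transport_sub_le hΩ hs hζ hZ f w).trans
    (mul_le_mul_right (hle s hs hsδ f w) _)
  rw [← mul_assoc, ← ENNReal.ofReal_mul hZ0, ← ofReal_norm, ← ofReal_norm, ← ofReal_norm,
    ← ENNReal.ofReal_mul (norm_nonneg _), ← ENNReal.ofReal_mul (by positivity),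
    ENNReal.ofReal_le_ofReal_iff (by positivity)] at h1
  have h2 : ‖∫ x in (Ω : Set (EuclideanSpace ℝ (Fin N))),
        cutoff (Ω : Set (EuclideanSpace ℝ (Fin N))) s x • fderiv ℝ ζ x
          (mulL Ω p q _ f (SobolevWZero.field w) x)‖ ≤ Z1 * (‖f‖ * ‖w‖) := by
    have := norm_integral_clm_apply_LpOn_one_le (Ω := Ω)
      (L := fun x => cutoff (Ω : Set (EuclideanSpace ℝ (Fin N))) s x • fderiv ℝ ζ x) (Z := Z1)
      (fun x hx => by
        rw [norm_smul, Real.norm_of_nonneg (cutoff_nonneg _ hs x)]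
        exact (mul_le_of_le_one_left (norm_nonneg _) (cutoff_le_one _ hs x)).trans (hZ1 x hx))
      (mulL Ω p q _ f (SobolevWZero.field w))
    refine this.trans ?_
    gcongr
    refine (norm_mulL_le _ _).trans ?_
    gcongr
    exact norm_fst_le w.1.1
  calc _ = ‖_‖ := congrArg _ (sub_add_cancel _ (∫ x in (Ω : Set (EuclideanSpace ℝ (Fin N))),
        cutoff (Ω : Set (EuclideanSpace ℝ (Fin N))) s x • fderiv ℝ ζ x
          (mulL Ω p q _ f (SobolevWZero.field w) x))).symm
    _ ≤ _ := norm_add_le _ _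
    _ ≤ Z * C * (‖f‖ * ‖w‖) + Z1 * (‖f‖ * ‖w‖) := add_le_add h1 h2
    _ = _ := by ring

theorem inner_gradient_eq_fderiv (g : EuclideanSpace ℝ (Fin N) → ℝ)
    (x v : EuclideanSpace ℝ (Fin N)) : inner ℝ v (gradient g x) = fderiv ℝ g x v := by
  rw [real_inner_comm, gradient, InnerProductSpace.toDual_symm_apply]

/-- The cutoff times `ζ` is an admissible test function, and no flux survives as the cutoff is
removed. -/
theorem IsDivergenceFree.integral_fderiv_eq_zero (hΩ : IsSmoothDomain Ω) (hq' : q ≠ ⊤)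
    {w : SobolevWZero Ω q} (hw : IsDivergenceFree Ω (SobolevWZero.field w))
    {ζ : EuclideanSpace ℝ (Fin N) → ℝ} (hζ : ContDiff ℝ ∞ ζ) :
    ∫ x in (Ω : Set (EuclideanSpace ℝ (Fin N))), fderiv ℝ ζ x (SobolevWZero.field w x) = 0 := by
  have := hΩ.isFiniteMeasure
  let p := q.conjExponent
  have hpq' : ENNReal.HolderConjugate p q := (ENNReal.HolderConjugate.conjExponent Fact.out).symm
  have : Fact (1 ≤ p) := ⟨ENNReal.HolderConjugate.one_le p q⟩
  -- The constant one, taken in the conjugate space, reduces the pairing to the plain integral of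
  -- the field.
  have h := tendsto_integral_transport_cutoff hΩ hq' hζ (oneLp Ω p) w
  have hae : ∀ g : EuclideanSpace ℝ (Fin N) → ℝ,
      ∫ x in (Ω : Set (EuclideanSpace ℝ (Fin N))),
        fderiv ℝ g x (mulL Ω p q _ (oneLp Ω p) (SobolevWZero.field w) x) =
      ∫ x in (Ω : Set (EuclideanSpace ℝ (Fin N))), fderiv ℝ g x (SobolevWZero.field w x) := by
    intro g
    refine integral_congr_ae ?_
    filter_upwards [coeFn_mulL (oneLp Ω p) (SobolevWZero.field w),
      coeFn_oneLp (Ω := Ω) (q := p)] with x h1 h2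
    rw [h1, h2, one_smul]
  simp only [hae] at h
  refine tendsto_nhds_unique h (tendsto_const_nhds.congr' ?_)
  filter_upwards [self_mem_nhdsWithin] with s hs
  have := hw (cutoffTest hΩ.isBounded hs hζ)
  simp only [inner_gradient_eq_fderiv] at this
  exact this.symm

end ExtendedWeakForms

/-! ### A bound for the solution valid at almost every time. -/

section WeakSolutionBound

theorem IsWeakSolution.exists_bound {N : ℕ} {Ω : Opens (EuclideanSpace ℝ (Fin N))}
    {p : ℝ≥0∞} [Fact (1 ≤ p)] {T : ℝ} {ρ₀ : LpOn Ω p ℝ}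
    {u : ℝ → EuclideanSpace ℝ (Fin N) → EuclideanSpace ℝ (Fin N)} {ρ : ℝ → LpOn Ω p ℝ}
    (hρ : IsWeakSolution Ω T p u ρ₀ ρ) :
    ∃ K : ℝ, 0 ≤ K ∧ ∀ᵐ t ∂volume.restrict (Ioo 0 T), ‖ρ t‖ ≤ K := by
  have h := hρ.memLp.2
  rw [eLpNorm_exponent_top] at h
  refine ⟨(eLpNormEssSup ρ (volume.restrict (Ioo 0 T))).toReal, ENNReal.toReal_nonneg, ?_⟩
  filter_upwards [enorm_ae_le_eLpNormEssSup ρ (volume.restrict (Ioo 0 T))] with t ht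
  rw [← toReal_enorm]
  exact ENNReal.toReal_mono h.ne ht

end WeakSolutionBound

/-! ### The weak equation for arbitrary smooth functions of space. -/

section ExtendedTransport

variable {N : ℕ} {Ω : Opens (EuclideanSpace ℝ (Fin N))} {p q : ℝ≥0∞} [Fact (1 ≤ p)] [Fact (1 ≤ q)]
  [hpq : ENNReal.HolderConjugate p q]

theorem continuous_field : Continuous
    (SobolevWZero.field : SobolevWZero Ω q → LpOn Ω q (EuclideanSpace ℝ (Fin N))) :=
  continuous_fst.comp (continuous_subtype_val.comp continuous_subtype_val)

/-- The product of a function of time and a function supported in the domain, as a space-time test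
function. -/
noncomputable def prodTest {T : ℝ} {ψ : ℝ → ℝ} (hψ : ContDiff ℝ ∞ ψ) (hc : HasCompactSupport ψ)
    (hT : tsupport ψ ⊆ Iio T) (g : 𝓓(Ω, ℝ)) : 𝓓(spaceTime T Ω, ℝ) where
  toFun z := ψ z.1 * g z.2
  contDiff' := (hψ.comp contDiff_fst).mul (g.contDiff.comp contDiff_snd)
  hasCompactSupport' := by
    refine HasCompactSupport.of_support_subset_isCompact (hc.prod g.hasCompactSupport) ?_
    intro z hz
    exact ⟨subset_tsupport _ (left_ne_zero_of_mul hz), subset_tsupport _ (right_ne_zero_of_mul hz)⟩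
  tsupport_subset' := by
    have h : tsupport (fun z : ℝ × EuclideanSpace ℝ (Fin N) => ψ z.1 * g z.2) ⊆
        tsupport ψ ×ˢ tsupport g :=
      closure_minimal (fun z hz => ⟨subset_tsupport _ (left_ne_zero_of_mul hz),
        subset_tsupport _ (right_ne_zero_of_mul hz)⟩)
        ((isClosed_tsupport _).prod (isClosed_tsupport _))
    exact h.trans (prod_mono hT g.tsupport_subset)

theorem aestronglyMeasurable_field {T : ℝ} {u : ℝ → SobolevWZero Ω q}
    (hu : AEStronglyMeasurable u (volume.restrict (Ioo 0 T))) :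
    AEStronglyMeasurable (fun t => SobolevWZero.field (u t)) (volume.restrict (Ioo 0 T)) :=
  continuous_field.comp_aestronglyMeasurable hu

theorem aestronglyMeasurable_mulL {T : ℝ} {ρ : ℝ → LpOn Ω p ℝ}
    {v : ℝ → LpOn Ω q (EuclideanSpace ℝ (Fin N))}
    (hρ : AEStronglyMeasurable ρ (volume.restrict (Ioo 0 T)))
    (hv : AEStronglyMeasurable v (volume.restrict (Ioo 0 T))) :
    AEStronglyMeasurable (fun t => mulL Ω p q (EuclideanSpace ℝ (Fin N)) (ρ t) (v t))
      (volume.restrict (Ioo 0 T)) := by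
  have h : Continuous fun z : LpOn Ω p ℝ × LpOn Ω q (EuclideanSpace ℝ (Fin N)) =>
      mulL Ω p q (EuclideanSpace ℝ (Fin N)) z.1 z.2 :=
    (mulL Ω p q (EuclideanSpace ℝ (Fin N))).continuous₂
  exact Continuous.comp_aestronglyMeasurable (f := fun t => (ρ t, v t)) h (hρ.prodMk hv)

theorem aestronglyMeasurable_integral_transport {T : ℝ} {ρ : ℝ → LpOn Ω p ℝ}
    {u : ℝ → SobolevWZero Ω q} (hΩ : IsSmoothDomain Ω)
    (hρ : AEStronglyMeasurable ρ (volume.restrict (Ioo 0 T)))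
    (hu : AEStronglyMeasurable u (volume.restrict (Ioo 0 T)))
    {ζ : EuclideanSpace ℝ (Fin N) → ℝ} (hζ : ContDiff ℝ ∞ ζ) :
    AEStronglyMeasurable (fun t => ∫ x in (Ω : Set (EuclideanSpace ℝ (Fin N))),
      fderiv ℝ ζ x (mulL Ω p q _ (ρ t) (SobolevWZero.field (u t)) x))
      (volume.restrict (Ioo 0 T)) := by
  have hc : Continuous (fderiv ℝ ζ) := hζ.continuous_fderiv (by simp)
  obtain ⟨Z, hZ0, hZ⟩ := exists_bound_on_domain hΩ hc
  exact (integralAgainst hc.aestronglyMeasurable hZ).continuous.comp_aestronglyMeasurable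
    (aestronglyMeasurable_mulL hρ (aestronglyMeasurable_field hu))

variable [IsFiniteMeasure (volume.restrict (Ω : Set (EuclideanSpace ℝ (Fin N))))]

/-- Products of a function of time and a function of space are the only space-time test functions
needed. Writing the pairings through `inclL` and `mulL` makes them continuous functionals of
`L^1`-valued maps, hence measurable in time. -/
theorem IsWeakSolution.weak_eq_prod {T : ℝ} {ρ₀ : LpOn Ω p ℝ} {u : ℝ → SobolevWZero Ω q}
    {ρ : ℝ → LpOn Ω p ℝ}
    (hρ : IsWeakSolution Ω T p (fun t => (SobolevWZero.field (u t))) ρ₀ ρ)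
    {ψ : ℝ → ℝ} (hψ : ContDiff ℝ ∞ ψ) (hc : HasCompactSupport ψ) (hT : tsupport ψ ⊆ Iio T)
    (g : 𝓓(Ω, ℝ)) :
    - (∫ t in Ioo 0 T, deriv ψ t *
        ∫ x in (Ω : Set (EuclideanSpace ℝ (Fin N))), g x * inclL Ω p q (ρ t) x)
      - ψ 0 * (∫ x in (Ω : Set (EuclideanSpace ℝ (Fin N))), g x * inclL Ω p q ρ₀ x)
      + (∫ t in Ioo 0 T, ψ t * ∫ x in (Ω : Set (EuclideanSpace ℝ (Fin N))),
        fderiv ℝ g x (mulL Ω p q _ (ρ t) (SobolevWZero.field (u t)) x)) = 0 := by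
  refine Eq.trans ?_ (hρ.weak_eq (prodTest hψ hc hT g))
  congr 1
  · congr 1
    · congr 1
      refine integral_congr_ae (Eventually.of_forall fun t => ?_)
      simp only
      rw [← integral_const_mul]
      refine integral_congr_ae ?_
      filter_upwards [coeFn_inclL (q := q) (ρ t)] with x hx
      have h : deriv (fun s => prodTest hψ hc hT g (s, x)) t = deriv ψ t * g x := by
        change deriv (fun s => ψ s * g x) t = _
        rw [deriv_mul_const_field]
      rw [h, hx]
      ring
    · rw [← integral_const_mul]
      refine integral_congr_ae ?_
      filter_upwards [coeFn_inclL (q := q) ρ₀] with x hx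
      rw [hx]
      change _ = ρ₀ x * (ψ 0 * g x)
      ring
  · refine integral_congr_ae (Eventually.of_forall fun t => ?_)
    simp only
    rw [← integral_const_mul]
    refine integral_congr_ae ?_
    filter_upwards [coeFn_mulL (ρ t) (SobolevWZero.field (u t))] with x hx
    rw [inner_gradient_eq_fderiv]
    have h : fderiv ℝ (fun y => prodTest hψ hc hT g (t, y)) x = ψ t • fderiv ℝ g x := by
      change fderiv ℝ (fun y => ψ t * g y) x = _
      rw [fderiv_const_mul (g.contDiff.differentiable (by simp) x)]
    rw [h, hx, map_smul, smul_apply, smul_eq_mul, smul_eq_mul]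
    ring

theorem aestronglyMeasurable_integral_inclL {T : ℝ} {ρ : ℝ → LpOn Ω p ℝ} (hΩ : IsSmoothDomain Ω)
    (hρ : AEStronglyMeasurable ρ (volume.restrict (Ioo 0 T)))
    {ζ : EuclideanSpace ℝ (Fin N) → ℝ} (hζ : Continuous ζ) :
    AEStronglyMeasurable (fun t => ∫ x in (Ω : Set (EuclideanSpace ℝ (Fin N))),
      ζ x * inclL Ω p q (ρ t) x) (volume.restrict (Ioo 0 T)) := by
  obtain ⟨Z, hZ0, hZ⟩ := exists_bound_on_domain hΩ (continuous_smul_one hζ)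
  exact ((integralAgainst (continuous_smul_one hζ).aestronglyMeasurable hZ).comp
    (inclL Ω p q)).continuous.comp_aestronglyMeasurable hρ

/-- The equation holds for the cutoff times `ζ`, and the cutoff is removed by dominated convergence
in time: a constant dominates the term in `deriv ψ`, and a multiple of `‖u t‖` the transport term.
-/
theorem IsWeakSolution.weak_eq_smooth {T : ℝ} {ρ₀ : LpOn Ω p ℝ} {u : ℝ → SobolevWZero Ω q}
    {ρ : ℝ → LpOn Ω p ℝ} (hΩ : IsSmoothDomain Ω) (hq' : q ≠ ⊤)
    (hu : Integrable u (volume.restrict (Ioo 0 T)))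
    (hρ : IsWeakSolution Ω T p (fun t => (SobolevWZero.field (u t))) ρ₀ ρ)
    {ψ : ℝ → ℝ} (hψ : ContDiff ℝ ∞ ψ) (hc : HasCompactSupport ψ) (hT : tsupport ψ ⊆ Iio T)
    {ζ : EuclideanSpace ℝ (Fin N) → ℝ} (hζ : ContDiff ℝ ∞ ζ) :
    - (∫ t in Ioo 0 T, deriv ψ t *
        ∫ x in (Ω : Set (EuclideanSpace ℝ (Fin N))), ζ x * inclL Ω p q (ρ t) x)
      - ψ 0 * (∫ x in (Ω : Set (EuclideanSpace ℝ (Fin N))), ζ x * inclL Ω p q ρ₀ x)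
      + (∫ t in Ioo 0 T, ψ t * ∫ x in (Ω : Set (EuclideanSpace ℝ (Fin N))),
        fderiv ℝ ζ x (mulL Ω p q _ (ρ t) (SobolevWZero.field (u t)) x)) = 0 := by
  obtain ⟨K, hK0, hK⟩ := hρ.exists_bound
  obtain ⟨P, hP⟩ := hc.exists_bound_of_continuous hψ.continuous
  obtain ⟨P', hP'⟩ := hc.deriv.exists_bound_of_continuous (hψ.continuous_deriv (by simp))
  obtain ⟨Z, hZ0, hZ⟩ := exists_bound_on_domain hΩ hζ.continuous
  obtain ⟨C, hC0, δ, hδ, hC⟩ := exists_norm_integral_transport_cutoff_le (p := p) hΩ hq' hζ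
  have hcut : ∀ s, 0 < s → ContDiff ℝ ∞
      (fun x => cutoff (Ω : Set (EuclideanSpace ℝ (Fin N))) s x * ζ x) :=
    fun s hs => (contDiff_cutoff _ hs).mul hζ
  have hζi : ∀ f : LpOn Ω p ℝ, Integrable (fun x => ζ x * inclL Ω p q f x)
      (volume.restrict (Ω : Set (EuclideanSpace ℝ (Fin N)))) := fun f =>
    (L1.integrable_coeFn (inclL Ω p q f)).bdd_mul hζ.continuous.aestronglyMeasurable
      ((ae_restrict_mem (measurableSet_domain Ω)).mono hZ)
  have hA : ∀ f : LpOn Ω p ℝ, Tendsto (fun s => ∫ x in (Ω : Set (EuclideanSpace ℝ (Fin N))),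
      cutoff (Ω : Set (EuclideanSpace ℝ (Fin N))) s x * ζ x * inclL Ω p q f x) (𝓝[>] 0)
      (𝓝 (∫ x in (Ω : Set (EuclideanSpace ℝ (Fin N))), ζ x * inclL Ω p q f x)) := by
    intro f
    simpa only [smul_eq_mul, mul_assoc] using tendsto_integral_cutoff_smul (hζi f)
  have hAle : ∀ s, 0 < s → ∀ f : LpOn Ω p ℝ, ‖∫ x in (Ω : Set (EuclideanSpace ℝ (Fin N))),
      cutoff (Ω : Set (EuclideanSpace ℝ (Fin N))) s x * ζ x * inclL Ω p q f x‖ ≤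
      Z * (‖inclL Ω p q‖ * ‖f‖) := by
    intro s hs f
    have h1 := norm_integral_clm_apply_LpOn_one_le (Ω := Ω) (Z := Z)
      (L := fun x => (cutoff (Ω : Set (EuclideanSpace ℝ (Fin N))) s x * ζ x) •
        ContinuousLinearMap.id ℝ ℝ) (fun x hx => ?_) (inclL Ω p q f)
    · refine h1.trans ?_
      gcongr
      exact (inclL Ω p q).le_opNorm f
    · refine (norm_smul_le _ _).trans ?_
      rw [ContinuousLinearMap.norm_id, mul_one, norm_mul,
        Real.norm_of_nonneg (cutoff_nonneg _ hs x)]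
      exact (mul_le_of_le_one_left (norm_nonneg _) (cutoff_le_one _ hs x)).trans (hZ x hx)
  have hfin : IsFiniteMeasure (volume.restrict (Ioo 0 T)) := ⟨by simp⟩
  have l1 : Tendsto (fun s => ∫ t in Ioo 0 T, deriv ψ t *
      ∫ x in (Ω : Set (EuclideanSpace ℝ (Fin N))),
        cutoff (Ω : Set (EuclideanSpace ℝ (Fin N))) s x * ζ x * inclL Ω p q (ρ t) x) (𝓝[>] 0)
      (𝓝 (∫ t in Ioo 0 T, deriv ψ t *
        ∫ x in (Ω : Set (EuclideanSpace ℝ (Fin N))), ζ x * inclL Ω p q (ρ t) x)) := by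
    refine tendsto_integral_filter_of_dominated_convergence
      (fun _ => P' * (Z * (‖inclL Ω p q‖ * K))) ?_ ?_ (integrable_const _) ?_
    · filter_upwards [self_mem_nhdsWithin] with s hs
      exact (hψ.continuous_deriv (by simp)).aestronglyMeasurable.mul
        (aestronglyMeasurable_integral_inclL hΩ hρ.memLp.1 (hcut s hs).continuous)
    · filter_upwards [self_mem_nhdsWithin] with s hs
      filter_upwards [hK] with t ht
      rw [norm_mul]
      have := (norm_nonneg _).trans (hP' t)
      refine mul_le_mul (hP' t) ((hAle s hs (ρ t)).trans ?_) (norm_nonneg _) this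
      gcongr
    · exact Eventually.of_forall fun t => (hA (ρ t)).const_mul _
  have l3 : Tendsto (fun s => ∫ t in Ioo 0 T, ψ t *
      ∫ x in (Ω : Set (EuclideanSpace ℝ (Fin N))),
        fderiv ℝ (fun x => cutoff (Ω : Set (EuclideanSpace ℝ (Fin N))) s x * ζ x) x
          (mulL Ω p q _ (ρ t) (SobolevWZero.field (u t)) x)) (𝓝[>] 0)
      (𝓝 (∫ t in Ioo 0 T, ψ t * ∫ x in (Ω : Set (EuclideanSpace ℝ (Fin N))),
        fderiv ℝ ζ x (mulL Ω p q _ (ρ t) (SobolevWZero.field (u t)) x))) := by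
    refine tendsto_integral_filter_of_dominated_convergence
      (fun t => P * (C * (K * ‖u t‖))) ?_ ?_ (((hu.norm.const_mul K).const_mul C).const_mul P) ?_
    · filter_upwards [self_mem_nhdsWithin] with s hs
      exact hψ.continuous.aestronglyMeasurable.mul
        (aestronglyMeasurable_integral_transport hΩ hρ.memLp.1 hu.1 (hcut s hs))
    · filter_upwards [self_mem_nhdsWithin, Ioo_mem_nhdsGT hδ] with s hs hsδ
      filter_upwards [hK] with t ht
      rw [norm_mul]
      have := (norm_nonneg _).trans (hP t)
      refine mul_le_mul (hP t) ((hC s hs hsδ.2 (ρ t) (u t)).trans ?_) (norm_nonneg _) this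
      gcongr
    · exact Eventually.of_forall fun t =>
        (tendsto_integral_transport_cutoff hΩ hq' hζ (ρ t) (u t)).const_mul _
  refine tendsto_nhds_unique ((l1.neg.sub ((hA ρ₀).const_mul (ψ 0))).add l3) ?_
  refine tendsto_const_nhds.congr' ?_
  filter_upwards [self_mem_nhdsWithin] with s hs
  exact (hρ.weak_eq_prod hψ hc hT (cutoffTest hΩ.isBounded hs hζ)).symm

end ExtendedTransport

/-! ### Convolution operators with values in bounded continuous functions. -/

section ConvolutionOperators

open scoped BoundedContinuousFunction

variable {N : ℕ} {Ω : Opens (EuclideanSpace ℝ (Fin N))}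

section Kernel

variable {F : Type} [NormedAddCommGroup F] [NormedSpace ℝ F]
  {k : EuclideanSpace ℝ (Fin N) → F →L[ℝ] ℝ}

theorem integrable_convolution_kernel (hk : Continuous k) {B : ℝ} (hB : ∀ x, ‖k x‖ ≤ B)
    (h : LpOn Ω 1 F) (x : EuclideanSpace ℝ (Fin N)) :
    Integrable (fun y => k (x - y) (h y))
      (volume.restrict (Ω : Set (EuclideanSpace ℝ (Fin N)))) :=
  integrable_clm_apply_LpOn_one (L := fun y => k (x - y))
    (hk.comp (continuous_const.sub continuous_id)).aestronglyMeasurable (fun y _ => hB (x - y)) h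

theorem continuous_convolution_kernel (hk : Continuous k) {B : ℝ} (hB : ∀ x, ‖k x‖ ≤ B)
    (h : LpOn Ω 1 F) :
    Continuous fun x => ∫ y in (Ω : Set (EuclideanSpace ℝ (Fin N))), k (x - y) (h y) := by
  refine continuous_of_dominated (bound := fun y => B * ‖h y‖)
    (fun x => (integrable_convolution_kernel hk hB h x).1)
    (fun x => Eventually.of_forall fun y => (k (x - y)).le_of_opNorm_le (hB _) _)
    ((L1.integrable_coeFn h).norm.const_mul B) (Eventually.of_forall fun y => ?_)
  exact (hk.comp (continuous_id.sub continuous_const)).clm_apply continuous_const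

/-- Convolution of an integrable function on the domain with a bounded continuous kernel. -/
noncomputable def convL (Ω : Opens (EuclideanSpace ℝ (Fin N))) (hk : Continuous k)
    (hB : ∃ B, ∀ x, ‖k x‖ ≤ B) : LpOn Ω 1 F →L[ℝ] (EuclideanSpace ℝ (Fin N) →ᵇ ℝ) :=
  LinearMap.mkContinuous
    { toFun := fun h => BoundedContinuousFunction.ofNormedAddCommGroup
        (fun x => ∫ y in (Ω : Set (EuclideanSpace ℝ (Fin N))), k (x - y) (h y))
        (continuous_convolution_kernel hk hB.choose_spec h) (hB.choose * ‖h‖)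
        fun x => norm_integral_clm_apply_LpOn_one_le (L := fun y => k (x - y))
          (fun _ _ => hB.choose_spec _) h
      map_add' := fun h₁ h₂ => by
        ext x
        exact map_add (integralAgainst (L := fun y => k (x - y))
          (hk.comp (continuous_const.sub continuous_id)).aestronglyMeasurable
          (fun y _ => hB.choose_spec (x - y))) h₁ h₂
      map_smul' := fun c h => by
        ext x
        exact map_smul (integralAgainst (L := fun y => k (x - y))
          (hk.comp (continuous_const.sub continuous_id)).aestronglyMeasurable
          (fun y _ => hB.choose_spec (x - y))) c h } hB.choose fun h =>
    BoundedContinuousFunction.norm_ofNormedAddCommGroup_le _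
      (mul_nonneg ((norm_nonneg _).trans (hB.choose_spec 0)) (norm_nonneg _))
      fun x => norm_integral_clm_apply_LpOn_one_le (L := fun y => k (x - y))
        (fun _ _ => hB.choose_spec _) h

end Kernel

variable {k : EuclideanSpace ℝ (Fin N) → ℝ}

theorem exists_bound_kernel (hk : ContDiff ℝ ∞ k) (hc : HasCompactSupport k) :
    ∃ B, ∀ x, ‖k x • ContinuousLinearMap.id ℝ ℝ‖ ≤ B :=
  (hc.smul_right (f' := fun _ => ContinuousLinearMap.id ℝ ℝ)).exists_bound_of_continuous
    (continuous_smul_one hk.continuous)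

theorem exists_bound_fderiv_kernel (hk : ContDiff ℝ ∞ k) (hc : HasCompactSupport k) :
    ∃ B, ∀ x, ‖fderiv ℝ k x‖ ≤ B :=
  (hc.fderiv ℝ).exists_bound_of_continuous (hk.continuous_fderiv (by simp))

/-- Convolution of a function on the domain with a smooth kernel. -/
noncomputable def smoothL (Ω : Opens (EuclideanSpace ℝ (Fin N))) (hk : ContDiff ℝ ∞ k)
    (hc : HasCompactSupport k) : LpOn Ω 1 ℝ →L[ℝ] (EuclideanSpace ℝ (Fin N) →ᵇ ℝ) :=
  convL Ω (continuous_smul_one hk.continuous) (exists_bound_kernel hk hc)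

/-- The divergence of the convolution of a vector field on the domain with a smooth kernel. -/
noncomputable def smoothDivL (Ω : Opens (EuclideanSpace ℝ (Fin N))) (hk : ContDiff ℝ ∞ k)
    (hc : HasCompactSupport k) :
    LpOn Ω 1 (EuclideanSpace ℝ (Fin N)) →L[ℝ] (EuclideanSpace ℝ (Fin N) →ᵇ ℝ) :=
  convL Ω (hk.continuous_fderiv (by simp)) (exists_bound_fderiv_kernel hk hc)

theorem smoothL_apply (hk : ContDiff ℝ ∞ k) (hc : HasCompactSupport k) (f : LpOn Ω 1 ℝ)
    (x : EuclideanSpace ℝ (Fin N)) : smoothL Ω hk hc f x =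
      ∫ y in (Ω : Set (EuclideanSpace ℝ (Fin N))), k (x - y) * f y := rfl

theorem smoothDivL_apply (hk : ContDiff ℝ ∞ k) (hc : HasCompactSupport k)
    (f : LpOn Ω 1 (EuclideanSpace ℝ (Fin N)))
    (x : EuclideanSpace ℝ (Fin N)) : smoothDivL Ω hk hc f x =
      ∫ y in (Ω : Set (EuclideanSpace ℝ (Fin N))), fderiv ℝ k (x - y) (f y) := rfl

theorem smoothL_eq_convolution (hk : ContDiff ℝ ∞ k) (hc : HasCompactSupport k)
    (f : LpOn Ω 1 ℝ) : (smoothL Ω hk hc f : EuclideanSpace ℝ (Fin N) → ℝ) =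
      convolution ((Ω : Set (EuclideanSpace ℝ (Fin N))).indicator f) k
        (ContinuousLinearMap.lsmul ℝ ℝ) volume := by
  ext x
  rw [smoothL_apply, convolution, ← integral_indicator (measurableSet_domain Ω)]
  refine integral_congr_ae (Eventually.of_forall fun y => ?_)
  by_cases hy : y ∈ (Ω : Set (EuclideanSpace ℝ (Fin N)))
  · simp [hy, mul_comm]
  · simp [hy]

theorem integrable_indicator_LpOn_one (f : LpOn Ω 1 ℝ) :
    Integrable ((Ω : Set (EuclideanSpace ℝ (Fin N))).indicator f) volume :=
  (integrable_indicator_iff (measurableSet_domain Ω)).2 (L1.integrable_coeFn f)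

theorem contDiff_smoothL (hk : ContDiff ℝ ∞ k) (hc : HasCompactSupport k) (f : LpOn Ω 1 ℝ) :
    ContDiff ℝ ∞ (smoothL Ω hk hc f) := by
  rw [smoothL_eq_convolution]
  exact hc.contDiff_convolution_right _ (integrable_indicator_LpOn_one f).locallyIntegrable hk

theorem fderiv_smoothL_apply (hk : ContDiff ℝ ∞ k) (hc : HasCompactSupport k) (f : LpOn Ω 1 ℝ)
    (x v : EuclideanSpace ℝ (Fin N)) : fderiv ℝ (smoothL Ω hk hc f) x v =
      ∫ y in (Ω : Set (EuclideanSpace ℝ (Fin N))), f y * fderiv ℝ k (x - y) v := by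
  have hf := integrable_indicator_LpOn_one f
  have h := hc.hasFDerivAt_convolution_right (ContinuousLinearMap.lsmul ℝ ℝ)
    hf.locallyIntegrable (hk.of_le (by simp)) x
  have hi : Integrable (fun y => (ContinuousLinearMap.precompR (EuclideanSpace ℝ (Fin N))
      (ContinuousLinearMap.lsmul ℝ ℝ)) ((Ω : Set (EuclideanSpace ℝ (Fin N))).indicator f y)
        (fderiv ℝ k (x - y))) volume :=
    (hc.fderiv ℝ).convolutionExists_right _ hf.locallyIntegrable
      (hk.continuous_fderiv (by simp)) x
  rw [smoothL_eq_convolution, h.fderiv, convolution, ContinuousLinearMap.integral_apply hi,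
    ← integral_indicator (measurableSet_domain Ω)]
  refine integral_congr_ae (Eventually.of_forall fun y => ?_)
  by_cases hy : y ∈ (Ω : Set (EuclideanSpace ℝ (Fin N)))
  · simp [ContinuousLinearMap.precompR_apply, hy]
  · simp [hy]

end ConvolutionOperators

/-! ### The commutator estimate. -/

section Commutator

variable {N : ℕ} {Ω : Opens (EuclideanSpace ℝ (Fin N))} {p q : ℝ≥0∞} [Fact (1 ≤ p)] [Fact (1 ≤ q)]
  [hpq : ENNReal.HolderConjugate p q]
  {k : EuclideanSpace ℝ (Fin N) → ℝ}

theorem integral_domain_eq_indicator (g : EuclideanSpace ℝ (Fin N) → ℝ) :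
    ∫ y in (Ω : Set (EuclideanSpace ℝ (Fin N))), g y =
      ∫ y, (Ω : Set (EuclideanSpace ℝ (Fin N))).indicator g y :=
  (integral_indicator (measurableSet_domain Ω)).symm

theorem integrable_indicator_domain {g : EuclideanSpace ℝ (Fin N) → ℝ}
    (hg : Integrable g (volume.restrict (Ω : Set (EuclideanSpace ℝ (Fin N))))) :
    Integrable ((Ω : Set (EuclideanSpace ℝ (Fin N))).indicator g) volume :=
  (integrable_indicator_iff (measurableSet_domain Ω)).2 hg

theorem measurable_indicator_LpOn {p : ℝ≥0∞} {F : Type} [NormedAddCommGroup F] [MeasurableSpace F]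
    [BorelSpace F] (f : LpOn Ω p F) :
    Measurable ((Ω : Set (EuclideanSpace ℝ (Fin N))).indicator f) :=
  (Lp.stronglyMeasurable f).measurable.indicator (measurableSet_domain Ω)

theorem fderiv_comp_const_sub_kernel (hk : ContDiff ℝ ∞ k) (x y : EuclideanSpace ℝ (Fin N)) :
    fderiv ℝ (fun y => k (x - y)) y = -fderiv ℝ k (x - y) := by
  have h : HasFDerivAt (fun y => k (x - y))
      (fderiv ℝ k (x - y) ∘L (-ContinuousLinearMap.id ℝ _)) y :=
    ((hk.differentiable (by simp)) (x - y)).hasFDerivAt.comp y ((hasFDerivAt_id y).const_sub x)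
  rw [h.fderiv]
  ext z
  simp

theorem integral_fderiv_kernel_sub (hk : ContDiff ℝ ∞ k) (hc : HasCompactSupport k)
    (hk0 : ∫ x, fderiv ℝ k x = 0) (x v : EuclideanSpace ℝ (Fin N)) :
    ∫ y, fderiv ℝ k (x - y) v = 0 := by
  have hi : Integrable (fun y => fderiv ℝ k (x - y)) volume :=
    ((hk.continuous_fderiv (by simp)).integrable_of_hasCompactSupport (hc.fderiv ℝ)).comp_sub_left x
  rw [← ContinuousLinearMap.integral_apply hi, integral_sub_left_eq_self (fderiv ℝ k) volume x, hk0,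
    zero_apply]

/-- The translated kernel need not be supported in `Ω` when `x` is near the boundary, so the
extended form of the divergence condition is needed. -/
theorem integral_fderiv_kernel_field (hΩ : IsSmoothDomain Ω) (hq' : q ≠ ⊤)
    (hk : ContDiff ℝ ∞ k) {w : SobolevWZero Ω q} (hw : IsDivergenceFree Ω (SobolevWZero.field w))
    (x : EuclideanSpace ℝ (Fin N)) :
    ∫ y in (Ω : Set (EuclideanSpace ℝ (Fin N))),
      fderiv ℝ k (x - y) (SobolevWZero.field w y) = 0 := by
  have h := hw.integral_fderiv_eq_zero hΩ hq' (ζ := fun y => k (x - y))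
    (hk.comp (contDiff_const.sub contDiff_id))
  simp only [fderiv_comp_const_sub_kernel hk, neg_apply, integral_neg, neg_eq_zero] at h
  exact h

variable [IsFiniteMeasure (volume.restrict (Ω : Set (EuclideanSpace ℝ (Fin N))))]

/-- The commutator between convolution and transport. -/
noncomputable def transportCommutator (hk : ContDiff ℝ ∞ k) (hc : HasCompactSupport k)
    (f : LpOn Ω p ℝ) (v : LpOn Ω q (EuclideanSpace ℝ (Fin N))) (x : EuclideanSpace ℝ (Fin N)) : ℝ :=
  smoothDivL Ω hk hc (mulL Ω p q _ f v) x - fderiv ℝ (smoothL Ω hk hc (inclL Ω p q f)) x (v x)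

theorem integrable_field (v : LpOn Ω q (EuclideanSpace ℝ (Fin N))) :
    Integrable v (volume.restrict (Ω : Set (EuclideanSpace ℝ (Fin N)))) :=
  (Lp.memLp v).integrable Fact.out

/-- Two integrals equal to zero are inserted: `f x` times the integral of `∇k (x - y) · w y`, by the
divergence condition, and `f x` times that of `∇k (x - y) · w x`, because `∇k` has mean zero. The
latter runs over the whole space, which is why extensions by zero appear. -/
theorem commutator_eq (hΩ : IsSmoothDomain Ω) (hq' : q ≠ ⊤) (hk : ContDiff ℝ ∞ k)
    (hc : HasCompactSupport k) (hk0 : ∫ x, fderiv ℝ k x = 0) (f : LpOn Ω p ℝ)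
    {w : SobolevWZero Ω q} (hw : IsDivergenceFree Ω (SobolevWZero.field w))
    {x : EuclideanSpace ℝ (Fin N)} (hx : x ∈ (Ω : Set (EuclideanSpace ℝ (Fin N)))) :
    transportCommutator hk hc f (SobolevWZero.field w) x = ∫ y,
      ((Ω : Set (EuclideanSpace ℝ (Fin N))).indicator f y -
        (Ω : Set (EuclideanSpace ℝ (Fin N))).indicator f x) * fderiv ℝ k (x - y)
      ((Ω : Set (EuclideanSpace ℝ (Fin N))).indicator (SobolevWZero.field w) y -
        (Ω : Set (EuclideanSpace ℝ (Fin N))).indicator (SobolevWZero.field w) x) := by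
  set v := SobolevWZero.field w with hv
  set O := (Ω : Set (EuclideanSpace ℝ (Fin N))) with hO
  have hcont : Continuous (fderiv ℝ k) := hk.continuous_fderiv (by simp)
  obtain ⟨B, hB⟩ := exists_bound_fderiv_kernel hk hc
  have i1 : Integrable (fun y => fderiv ℝ k (x - y) (mulL Ω p q _ f v y)) (volume.restrict O) :=
    integrable_convolution_kernel hcont hB _ x
  have e1 : (fun y => fderiv ℝ k (x - y) (mulL Ω p q _ f v y)) =ᵐ[volume.restrict O]
      fun y => f y * fderiv ℝ k (x - y) (v y) := by
    filter_upwards [coeFn_mulL f v] with y hy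
    rw [hy, map_smul, smul_eq_mul]
  have hmeas : Continuous fun y => fderiv ℝ k (x - y) (v x) :=
    (hcont.comp (continuous_const.sub continuous_id)).clm_apply continuous_const
  have i2 : Integrable (fun y => f y * fderiv ℝ k (x - y) (v x)) (volume.restrict O) := by
    refine ((Lp.memLp f).integrable Fact.out).mul_bdd (c := B * ‖v x‖)
      hmeas.aestronglyMeasurable (Eventually.of_forall fun y => ?_)
    exact (fderiv ℝ k (x - y)).le_of_opNorm_le (hB _) _
  have i3 : Integrable (fun y => fderiv ℝ k (x - y) (v y)) (volume.restrict O) := by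
    refine Integrable.mono' ((integrable_field v).norm.const_mul B) ?_
      (Eventually.of_forall fun y => (fderiv ℝ k (x - y)).le_of_opNorm_le (hB _) _)
    exact (ContinuousLinearMap.id ℝ (EuclideanSpace ℝ (Fin N) →L[ℝ] ℝ)).aestronglyMeasurable_comp₂
      (hcont.comp (continuous_const.sub continuous_id)).aestronglyMeasurable
      (Lp.aestronglyMeasurable v)
  have i4 : Integrable (fun y => fderiv ℝ k (x - y) (v x)) volume :=
    ((hcont.integrable_of_hasCompactSupport (hc.fderiv ℝ)).comp_sub_left
      x).apply_continuousLinearMap (v x)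
  have i1' := integrable_indicator_domain (i1.congr e1)
  have i2' := integrable_indicator_domain i2
  have i3' := (integrable_indicator_domain i3).const_mul (f x)
  have i4' := i4.const_mul (f x)
  have e2 : ∫ y in O, inclL Ω p q f y * fderiv ℝ k (x - y) (v x) =
      ∫ y in O, f y * fderiv ℝ k (x - y) (v x) := by
    refine integral_congr_ae ?_
    filter_upwards [coeFn_inclL (q := q) f] with y hy
    rw [hy]
  rw [transportCommutator, smoothDivL_apply, fderiv_smoothL_apply, integral_congr_ae e1, e2,
    integral_domain_eq_indicator, integral_domain_eq_indicator]
  have z3 : ∫ y, f x * O.indicator (fun y => fderiv ℝ k (x - y) (v y)) y = 0 := by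
    rw [integral_const_mul, ← integral_domain_eq_indicator,
      integral_fderiv_kernel_field hΩ hq' hk hw, mul_zero]
  have z4 : ∫ y, f x * fderiv ℝ k (x - y) (v x) = 0 := by
    rw [integral_const_mul, integral_fderiv_kernel_sub hk hc hk0, mul_zero]
  have hsum : ∫ y, (O.indicator (fun y => f y * fderiv ℝ k (x - y) (v y)) y -
      O.indicator (fun y => f y * fderiv ℝ k (x - y) (v x)) y -
      f x * O.indicator (fun y => fderiv ℝ k (x - y) (v y)) y + f x * fderiv ℝ k (x - y) (v x)) =
      (∫ y, O.indicator (fun y => f y * fderiv ℝ k (x - y) (v y)) y) -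
      (∫ y, O.indicator (fun y => f y * fderiv ℝ k (x - y) (v x)) y) - 0 + 0 := by
    have h4 := integral_add ((i1'.sub i2').sub i3') i4'
    have h3 := integral_sub (i1'.sub i2') i3'
    have h2 := integral_sub i1' i2'
    simp only [Pi.sub_apply] at h2 h3 h4
    rw [h4, h3, h2, z3, z4]
  rw [sub_zero, add_zero] at hsum
  rw [← hsum]
  refine integral_congr_ae (Eventually.of_forall fun y => ?_)
  change _ = (O.indicator f y - O.indicator f x) *
    fderiv ℝ k (x - y) (O.indicator v y - O.indicator v x)
  rw [indicator_of_mem hx, indicator_of_mem hx]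
  by_cases hy : y ∈ O
  · simp only [indicator_of_mem hy, map_sub]
    ring
  · simp only [indicator_of_notMem hy, zero_sub, map_neg]
    ring

/-- The gradient of the kernel has `L^1` norm of order `1/s`, while the increments of the field over
its support are at most `s * ‖w‖` in `L^q`. By Hölder the scale cancels and the modulus `κ` of `f`
is left. All smallness comes from `f`, so `w` need not be approximated. -/
theorem lintegral_commutator_mollifier_le (hΩ : IsSmoothDomain Ω) (hq' : q ≠ ⊤) {s : ℝ}
    (hs : 0 < s) (f : LpOn Ω p ℝ) {w : SobolevWZero Ω q}
    (hw : IsDivergenceFree Ω (SobolevWZero.field w)) {κ : ℝ≥0∞}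
    (hκ : ∀ z : EuclideanSpace ℝ (Fin N), ‖z‖ ≤ s → eLpNorm (fun x =>
      (Ω : Set (EuclideanSpace ℝ (Fin N))).indicator f (x + z) -
        (Ω : Set (EuclideanSpace ℝ (Fin N))).indicator f x) p volume ≤ κ) :
    ∫⁻ x in (Ω : Set (EuclideanSpace ℝ (Fin N))), ‖transportCommutator (contDiff_mollifier s)
      (hasCompactSupport_mollifier hs) f (SobolevWZero.field w) x‖ₑ ≤
      ENNReal.ofReal (mollifierConst (EuclideanSpace ℝ (Fin N))) * (κ * ‖w‖ₑ) := by
  set V := (Ω : Set (EuclideanSpace ℝ (Fin N))).indicator (SobolevWZero.field w) with hV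
  set f' := (Ω : Set (EuclideanSpace ℝ (Fin N))).indicator f with hf'
  set K := fderiv ℝ (mollifier s : EuclideanSpace ℝ (Fin N) → ℝ) with hK
  have hKc : Continuous K := continuous_fderiv_mollifier s
  have hVm : Measurable V := measurable_indicator_LpOn _
  have hfm : Measurable f' := measurable_indicator_LpOn _
  calc ∫⁻ x in (Ω : Set (EuclideanSpace ℝ (Fin N))), ‖transportCommutator (contDiff_mollifier s)
        (hasCompactSupport_mollifier hs) f (SobolevWZero.field w) x‖ₑ
      ≤ ∫⁻ x in (Ω : Set (EuclideanSpace ℝ (Fin N))),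
          ∫⁻ z, ‖K z‖ₑ * (‖f' (x - z) - f' x‖ₑ * ‖V (x - z) - V x‖ₑ) := by
        refine setLIntegral_mono' (measurableSet_domain Ω) fun x hx => ?_
        rw [commutator_eq hΩ hq' _ _ (integral_fderiv_mollifier s) f hw hx]
        refine (enorm_integral_le_lintegral_enorm _).trans ?_
        -- The change of variables `z = x - y` frees the kernel from `x`, ready for exchanging the
        -- integrals.
        rw [← lintegral_sub_left_eq_self (fun z => ‖K z‖ₑ *
          (‖f' (x - z) - f' x‖ₑ * ‖V (x - z) - V x‖ₑ)) x]
        refine lintegral_mono fun y => ?_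
        rw [sub_sub_cancel, enorm_mul, mul_left_comm]
        gcongr
        exact ContinuousLinearMap.le_opENorm _ _
    _ ≤ ∫⁻ x, ∫⁻ z, ‖K z‖ₑ * (‖f' (x - z) - f' x‖ₑ * ‖V (x - z) - V x‖ₑ) :=
        setLIntegral_le_lintegral _ _
    _ = ∫⁻ z, ∫⁻ x, ‖K z‖ₑ * (‖f' (x - z) - f' x‖ₑ * ‖V (x - z) - V x‖ₑ) := by
        refine lintegral_lintegral_swap (Measurable.aemeasurable ?_)
        have h1 : Measurable fun a : EuclideanSpace ℝ (Fin N) × EuclideanSpace ℝ (Fin N) =>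
            ‖K a.2‖ₑ := (hKc.comp continuous_snd).enorm.measurable
        have h2 : Measurable fun a : EuclideanSpace ℝ (Fin N) × EuclideanSpace ℝ (Fin N) =>
            f' (a.1 - a.2) - f' a.1 :=
          (hfm.comp (measurable_fst.sub measurable_snd)).sub (hfm.comp measurable_fst)
        have h3 : Measurable fun a : EuclideanSpace ℝ (Fin N) × EuclideanSpace ℝ (Fin N) =>
            V (a.1 - a.2) - V a.1 :=
          (hVm.comp (measurable_fst.sub measurable_snd)).sub (hVm.comp measurable_fst)
        exact h1.mul (h2.enorm.mul h3.enorm)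
    _ ≤ ∫⁻ z, ‖K z‖ₑ * (κ * (ENNReal.ofReal s * ‖w‖ₑ)) := by
        refine lintegral_mono fun z => ?_
        rw [lintegral_const_mul' _ _ enorm_ne_top]
        by_cases hz : s < ‖z‖
        · rw [hK, fderiv_mollifier_eq_zero hs hz]
          simp
        rw [not_lt] at hz
        gcongr
        refine (lintegral_enorm_mul_le_of_holderConjugate hpq (f := fun x => f' (x - z) - f' x)
          (g := fun x => V (x - z) - V x) ?_ ?_).trans ?_
        · exact ((hfm.comp (measurable_id.sub_const z)).sub hfm).aestronglyMeasurable
        · exact ((hVm.comp (measurable_id.sub_const z)).sub hVm).aestronglyMeasurable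
        · have h1 := hκ (-z) (by rwa [norm_neg])
          have h2 := eLpNorm_translate_field_le hq' w (-z)
          simp only [← sub_eq_add_neg] at h1 h2
          refine mul_le_mul' h1 (h2.trans ?_)
          gcongr
          rw [enorm_neg, ← ofReal_norm]
          exact ENNReal.ofReal_le_ofReal hz
    _ = (∫⁻ z, ‖K z‖ₑ) * (κ * (ENNReal.ofReal s * ‖w‖ₑ)) :=
        lintegral_mul_const _ hKc.enorm.measurable
    _ = ENNReal.ofReal (mollifierConst (EuclideanSpace ℝ (Fin N))) * (κ * ‖w‖ₑ) := by
        rw [hK, lintegral_enorm_fderiv_mollifier hs, mul_left_comm κ, ← mul_assoc,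
          ← ENNReal.ofReal_mul (div_nonneg mollifierConst_nonneg hs.le), div_mul_cancel₀ _ hs.ne']

/-- The crude modulus `2 * ‖f‖` gives a bound independent of the scale, from which the majorant in
time is built. -/
theorem lintegral_commutator_mollifier_le_norm (hΩ : IsSmoothDomain Ω) (hq' : q ≠ ⊤) {s : ℝ}
    (hs : 0 < s) (f : LpOn Ω p ℝ) {w : SobolevWZero Ω q}
    (hw : IsDivergenceFree Ω (SobolevWZero.field w)) :
    ∫⁻ x in (Ω : Set (EuclideanSpace ℝ (Fin N))), ‖transportCommutator (contDiff_mollifier s)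
      (hasCompactSupport_mollifier hs) f (SobolevWZero.field w) x‖ₑ ≤
      ENNReal.ofReal (mollifierConst (EuclideanSpace ℝ (Fin N))) * (2 * ‖f‖ₑ * ‖w‖ₑ) := by
  refine lintegral_commutator_mollifier_le hΩ hq' hs f hw fun z _ => ?_
  rw [← eLpNorm_indicator_LpOn]
  exact eLpNorm_comp_add_right_sub_le Fact.out (memLp_indicator_LpOn f).1 z

theorem eventually_lintegral_commutator_mollifier_le (hΩ : IsSmoothDomain Ω) (hp' : p ≠ ⊤)
    (hq' : q ≠ ⊤) (f : LpOn Ω p ℝ) {w : SobolevWZero Ω q}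
    (hw : IsDivergenceFree Ω (SobolevWZero.field w)) {ε : ℝ≥0∞} (hε : 0 < ε) :
    ∃ δ > 0, ∀ s, ∀ hs : 0 < s, s < δ →
      ∫⁻ x in (Ω : Set (EuclideanSpace ℝ (Fin N))), ‖transportCommutator (contDiff_mollifier s)
        (hasCompactSupport_mollifier hs) f (SobolevWZero.field w) x‖ₑ ≤ ε := by
  have hlim := tendsto_eLpNorm_comp_add_right_sub hp' (memLp_indicator_LpOn f)
  obtain ⟨κ, hκ, hκε⟩ : ∃ κ : ℝ≥0∞, 0 < κ ∧
      ENNReal.ofReal (mollifierConst (EuclideanSpace ℝ (Fin N))) * (κ * ‖w‖ₑ) ≤ ε := by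
    have h0 : Tendsto (fun κ : ℝ≥0∞ =>
        ENNReal.ofReal (mollifierConst (EuclideanSpace ℝ (Fin N))) * (κ * ‖w‖ₑ)) (𝓝[>] 0)
        (𝓝 (ENNReal.ofReal (mollifierConst (EuclideanSpace ℝ (Fin N))) * (0 * ‖w‖ₑ))) := by
      refine Tendsto.mono_left ?_ nhdsWithin_le_nhds
      exact ENNReal.Tendsto.const_mul (ENNReal.Tendsto.mul_const tendsto_id
        (Or.inr enorm_ne_top)) (Or.inr ENNReal.ofReal_ne_top)
    rw [zero_mul, mul_zero] at h0
    obtain ⟨κ, h1, h2⟩ := ((h0.eventually_le_const hε).and self_mem_nhdsWithin).exists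
    exact ⟨κ, h2, h1⟩
  obtain ⟨δ, hδ, hball⟩ := Metric.eventually_nhds_iff.1 (hlim.eventually_le_const hκ)
  refine ⟨δ, hδ, fun s hs hsδ => ?_⟩
  refine (lintegral_commutator_mollifier_le hΩ hq' hs f hw fun z hz => ?_).trans hκε
  exact hball (by simpa using hz.trans_lt hsδ)

end Commutator

/-! ### Weak derivatives in time of Banach-valued paths. -/

section DuBoisReymond

variable {X : Type*} [NormedAddCommGroup X] [NormedSpace ℝ X] [CompleteSpace X]

theorem contDiff_intervalIntegral_right {g : ℝ → ℝ} (hg : ContDiff ℝ ∞ g) (a : ℝ) :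
    ContDiff ℝ ∞ fun t => ∫ s in a..t, g s := by
  have hd : ∀ t, HasDerivAt (fun t => ∫ s in a..t, g s) (g t) t := fun t =>
    intervalIntegral.integral_hasDerivAt_right (hg.continuous.intervalIntegrable _ _)
      (hg.continuous.stronglyMeasurableAtFilter _ _) hg.continuous.continuousAt
  rw [contDiff_infty_iff_deriv]
  refine ⟨fun t => (hd t).differentiableAt, ?_⟩
  rwa [show deriv (fun t => ∫ s in a..t, g s) = g from funext fun t => (hd t).deriv]

/-- Fubini on the triangle `t < s`; it replaces an integration by parts. -/
theorem setIntegral_Ioo_intervalIntegral_smul_swap {T : ℝ} {g : ℝ → ℝ} {F : ℝ → X}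
    (hg : IntegrableOn g (Ioo 0 T)) (hF : IntegrableOn F (Ioo 0 T)) :
    ∫ t in Ioo 0 T, (∫ s in t..T, g s) • F t = ∫ s in Ioo 0 T, g s • ∫ t in (0 : ℝ)..s, F t := by
  have hprod : Integrable (fun z : ℝ × ℝ => {z : ℝ × ℝ | z.1 < z.2}.indicator
      (fun z => g z.2 • F z.1) z) ((volume.restrict (Ioo 0 T)).prod (volume.restrict (Ioo 0 T))) := by
    refine Integrable.indicator ?_ (measurableSet_lt measurable_fst measurable_snd)
    have h := (hg.smul_prod hF).swap
    exact h
  have h := integral_integral_swap (f := fun t s : ℝ => {z : ℝ × ℝ | z.1 < z.2}.indicator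
    (fun z => g z.2 • F z.1) (t, s)) hprod
  have e1 : ∀ t ∈ Ioo 0 T, ∫ s in Ioo 0 T, {z : ℝ × ℝ | z.1 < z.2}.indicator
      (fun z => g z.2 • F z.1) (t, s) = (∫ s in t..T, g s) • F t := by
    intro t ht
    have : (fun s => {z : ℝ × ℝ | z.1 < z.2}.indicator (fun z => g z.2 • F z.1) (t, s)) =
        (Ioi t).indicator fun s => g s • F t := by
      ext s
      by_cases hs : t < s <;> simp [hs]
    rw [this, setIntegral_indicator measurableSet_Ioi, integral_smul_const,
      intervalIntegral.integral_of_le ht.2.le, integral_Ioc_eq_integral_Ioo]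
    congr 3
    ext s
    simp only [mem_inter_iff, mem_Ioo, mem_Ioi]
    exact ⟨fun h => ⟨h.2, h.1.2⟩, fun h => ⟨⟨ht.1.trans h.1, h.2⟩, h.1⟩⟩
  have e2 : ∀ s ∈ Ioo 0 T, ∫ t in Ioo 0 T, {z : ℝ × ℝ | z.1 < z.2}.indicator
      (fun z => g z.2 • F z.1) (t, s) = g s • ∫ t in (0 : ℝ)..s, F t := by
    intro s hs
    have : (fun t => {z : ℝ × ℝ | z.1 < z.2}.indicator (fun z => g z.2 • F z.1) (t, s)) =
        (Iio s).indicator fun t => g s • F t := by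
      ext t
      by_cases hts : t < s <;> simp [hts]
    rw [this, setIntegral_indicator measurableSet_Iio, integral_smul,
      intervalIntegral.integral_of_le hs.1.le, integral_Ioc_eq_integral_Ioo]
    congr 3
    ext t
    simp only [mem_inter_iff, mem_Ioo, mem_Iio]
    exact ⟨fun h => ⟨h.1.1, h.2⟩, fun h => ⟨⟨h.1, h.2.trans hs.2⟩, h.2⟩⟩
  rw [setIntegral_congr_fun measurableSet_Ioo e1, setIntegral_congr_fun measurableSet_Ioo e2] at h
  exact h

/-- The equation is tested with a primitive of an arbitrary `g` supported in `(0, T)`. Test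
functions may be nonzero at time zero, and this identifies the constant of integration as `R₀`. -/
theorem ae_eq_add_integral_of_weak_deriv {T : ℝ} (hT : 0 < T) {R F : ℝ → X} {R₀ : X}
    (hR : IntegrableOn R (Ioo 0 T)) (hF : IntegrableOn F (Ioo 0 T))
    (h : ∀ ψ : ℝ → ℝ, ContDiff ℝ ∞ ψ → HasCompactSupport ψ → tsupport ψ ⊆ Iio T →
      (∫ t in Ioo 0 T, deriv ψ t • R t) + ψ 0 • R₀ + (∫ t in Ioo 0 T, ψ t • F t) = 0) :
    ∀ᵐ t ∂volume.restrict (Ioo 0 T), R t = R₀ + ∫ s in (0 : ℝ)..t, F s := by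
  have hFI : IntervalIntegrable F volume 0 T := by
    rw [intervalIntegrable_iff_integrableOn_Ioo_of_le hT.le]
    exact hF
  have hGc : ContinuousOn (fun t => ∫ s in (0 : ℝ)..t, F s) (Icc 0 T) := by
    have := intervalIntegral.continuousOn_primitive_interval (a := (0 : ℝ)) (b := T) (f := F)
      (μ := volume) (by
        rw [uIcc_of_le hT.le, integrableOn_Icc_iff_integrableOn_Ioo]
        exact hF)
    rwa [uIcc_of_le hT.le] at this
  have hGi : IntegrableOn (fun t => ∫ s in (0 : ℝ)..t, F s) (Ioo 0 T) :=
    (hGc.integrableOn_compact isCompact_Icc).mono_set Ioo_subset_Icc_self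
  have hci : IntegrableOn (fun _ : ℝ => R₀) (Ioo 0 T) := integrableOn_const (by simp)
  have key := isOpen_Ioo.ae_eq_zero_of_integral_contDiff_smul_eq_zero (μ := volume) (U := Ioo 0 T)
    (f := fun t => R t - R₀ - ∫ s in (0 : ℝ)..t, F s)
    (((hR.sub hci).sub hGi).locallyIntegrableOn) ?_
  · rw [ae_restrict_iff' measurableSet_Ioo]
    filter_upwards [key] with t ht hmem
    have := ht hmem
    rw [sub_sub, sub_eq_zero] at this
    exact this
  intro g hg hgc hgT
  have hg0 : ∀ t ∉ Ioo 0 T, g t = 0 := fun t ht => image_eq_zero_of_notMem_tsupport fun h' =>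
    ht (hgT h')
  -- The support of `g` ends strictly before `T`, so its primitive based at `T` vanishes from `b`
  -- on.
  obtain ⟨b, hb0, hbT, hb⟩ : ∃ b, 0 ≤ b ∧ b < T ∧ ∀ t, b < t → g t = 0 := by
    rcases (tsupport g).eq_empty_or_nonempty with hempty | hne
    · exact ⟨0, le_rfl, hT, fun t _ => image_eq_zero_of_notMem_tsupport (by simp [hempty])⟩
    · obtain ⟨b, hbmem, hbmax⟩ := hgc.exists_isMaxOn hne continuous_id.continuousOn
      refine ⟨b, (hgT hbmem).1.le, (hgT hbmem).2, fun t ht => ?_⟩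
      exact image_eq_zero_of_notMem_tsupport fun hmem => absurd (hbmax hmem) (not_le.2 ht)
  set P : ℝ → ℝ := fun t => ∫ s in T..t, g s with hP
  have hPsm : ContDiff ℝ ∞ P := contDiff_intervalIntegral_right hg T
  have hPd : ∀ t, HasDerivAt P (g t) t := fun t =>
    intervalIntegral.integral_hasDerivAt_right (hg.continuous.intervalIntegrable _ _)
      (hg.continuous.stronglyMeasurableAtFilter _ _) hg.continuous.continuousAt
  have hPb : ∀ t, b ≤ t → P t = 0 := by
    intro t ht
    refine intervalIntegral.integral_zero_ae (Eventually.of_forall fun s hs => hb s ?_)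
    exact (le_min hbT.le ht).trans_lt hs.1
  -- For negative times the primitive is a possibly nonzero constant. The transition, zero up to
  -- `-2` and one from `-1`, makes the support compact without altering anything on `[0, T]`.
  set ψ : ℝ → ℝ := fun t => Real.smoothTransition (t + 2) * P t with hψ
  have hψsm : ContDiff ℝ ∞ ψ :=
    (Real.smoothTransition.contDiff.comp (contDiff_id.add contDiff_const)).mul hPsm
  have hψts : tsupport ψ ⊆ Icc (-2) b := by
    refine closure_minimal (fun t ht => ?_) isClosed_Icc
    by_contra hcon
    rw [mem_Icc, not_and_or, not_le, not_le] at hcon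
    rcases hcon with h1 | h1
    · exact ht (by simp only [hψ]; rw [Real.smoothTransition.zero_of_nonpos (by linarith), zero_mul])
    · exact ht (by simp only [hψ]; rw [hPb t h1.le, mul_zero])
  have hψP : ∀ t, -1 ≤ t → ψ t = P t := by
    intro t ht
    simp only [hψ]
    rw [Real.smoothTransition.one_of_one_le (by linarith), one_mul]
  have hψd : ∀ t ∈ Ioo 0 T, deriv ψ t = g t := by
    intro t ht
    have : ψ =ᶠ[𝓝 t] P := by
      filter_upwards [Ioi_mem_nhds (show (-1 : ℝ) < t by linarith [ht.1])] with s hs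
      exact hψP s (le_of_lt hs)
    rw [this.deriv_eq, (hPd t).deriv]
  have h1 := h ψ hψsm (isCompact_Icc.of_isClosed_subset (isClosed_tsupport _) hψts)
    (hψts.trans fun t ht => ht.2.trans_lt hbT)
  rw [hψP 0 (by norm_num), setIntegral_congr_fun measurableSet_Ioo
    (g := fun t => g t • R t) fun t ht => by simp only [hψd t ht]] at h1
  have h2 : ∫ t in Ioo 0 T, ψ t • F t = - ∫ s in Ioo 0 T, g s • ∫ t in (0 : ℝ)..s, F t := by
    rw [← setIntegral_Ioo_intervalIntegral_smul_swap
      (hg.continuous.integrable_of_hasCompactSupport hgc).integrableOn hF, ← integral_neg]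
    refine setIntegral_congr_fun measurableSet_Ioo fun t ht => ?_
    rw [hψP t (by linarith [ht.1]), ← neg_smul, ← intervalIntegral.integral_symm]
  have h3 : P 0 • R₀ = -∫ t in Ioo 0 T, g t • R₀ := by
    rw [integral_smul_const, ← neg_smul, ← integral_Ioc_eq_integral_Ioo,
      ← intervalIntegral.integral_of_le hT.le, ← intervalIntegral.integral_symm]
  obtain ⟨M, hM⟩ := hgc.exists_bound_of_continuous hg.continuous
  have hsm : ∀ {f : ℝ → X}, IntegrableOn f (Ioo 0 T) → IntegrableOn (fun t => g t • f t) (Ioo 0 T) :=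
    fun hf => hf.bdd_smul M hg.continuous.aestronglyMeasurable (Eventually.of_forall hM)
  rw [h2, h3] at h1
  rw [← setIntegral_eq_integral_of_forall_compl_eq_zero (s := Ioo 0 T)
    fun t ht => by rw [hg0 t ht, zero_smul]]
  have h4 : ∫ t in Ioo 0 T, g t • (R t - R₀ - ∫ s in (0 : ℝ)..t, F s) =
      (∫ t in Ioo 0 T, g t • R t) - (∫ t in Ioo 0 T, g t • R₀) -
        ∫ t in Ioo 0 T, g t • ∫ s in (0 : ℝ)..t, F s := by
    have h5 := integral_sub (hsm hR) (hsm hci)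
    have h6 := integral_sub ((hsm hR).sub (hsm hci)) (hsm hGi)
    simp only [Pi.sub_apply] at h5 h6
    rw [← h5, ← h6]
    simp only [smul_sub]
  rw [h4, ← h1]
  abel

end DuBoisReymond

/-! ### The equation satisfied by the mollified solution. -/

section SmoothedEquation

open scoped BoundedContinuousFunction

variable {N : ℕ} {Ω : Opens (EuclideanSpace ℝ (Fin N))} {p : ℝ≥0∞} [Fact (1 ≤ p)]
  {T : ℝ} {ρ₀ : LpOn Ω p ℝ} {ρ : ℝ → LpOn Ω p ℝ}

theorem IsWeakSolution.integrable
    {v : ℝ → EuclideanSpace ℝ (Fin N) → EuclideanSpace ℝ (Fin N)}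
    (hρ : IsWeakSolution Ω T p v ρ₀ ρ) :
    IntegrableOn ρ (Ioo 0 T) := by
  have hfin : IsFiniteMeasure (volume.restrict (Ioo 0 T)) := ⟨by simp⟩
  exact hρ.memLp.integrable le_top

variable {q : ℝ≥0∞} [Fact (1 ≤ q)] [hpq : ENNReal.HolderConjugate p q]
  {u : ℝ → SobolevWZero Ω q}

theorem IsWeakSolution.integrable_mulL
    (hu : Integrable u (volume.restrict (Ioo 0 T)))
    (hρ : IsWeakSolution Ω T p (fun t => (SobolevWZero.field (u t))) ρ₀ ρ) :
    IntegrableOn (fun t => mulL Ω p q (EuclideanSpace ℝ (Fin N)) (ρ t) (SobolevWZero.field (u t)))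
      (Ioo 0 T) := by
  obtain ⟨K, hK0, hK⟩ := hρ.exists_bound
  refine Integrable.mono' (hu.norm.const_mul K)
    (aestronglyMeasurable_mulL hρ.memLp.1 (aestronglyMeasurable_field hu.1)) ?_
  filter_upwards [hK] with t ht
  refine (norm_mulL_le _ _).trans ?_
  gcongr
  exact norm_fst_le (u t).1.1

theorem IsWeakSolution.integrable_smoothDivL {k : EuclideanSpace ℝ (Fin N) → ℝ}
    (hk : ContDiff ℝ ∞ k) (hc : HasCompactSupport k)
    (hu : Integrable u (volume.restrict (Ioo 0 T)))
    (hρ : IsWeakSolution Ω T p (fun t => (SobolevWZero.field (u t))) ρ₀ ρ) :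
    IntegrableOn (fun t => smoothDivL Ω hk hc
      (mulL Ω p q (EuclideanSpace ℝ (Fin N)) (ρ t) (SobolevWZero.field (u t)))) (Ioo 0 T) :=
  (smoothDivL Ω hk hc).integrable_comp (hρ.integrable_mulL hu)

variable [IsFiniteMeasure (volume.restrict (Ω : Set (EuclideanSpace ℝ (Fin N))))]
  {k : EuclideanSpace ℝ (Fin N) → ℝ}

theorem IsWeakSolution.integrable_smoothL (hk : ContDiff ℝ ∞ k) (hc : HasCompactSupport k)
    (hρ : IsWeakSolution Ω T p (fun t => (SobolevWZero.field (u t))) ρ₀ ρ) :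
    IntegrableOn (fun t => smoothL Ω hk hc (inclL Ω p q (ρ t))) (Ioo 0 T) :=
  ContinuousLinearMap.integrable_comp ((smoothL Ω hk hc).comp (inclL Ω p q)) hρ.integrable

/-- Testing with `y ↦ k (x - y)` gives, for each `x`, the evaluation at `x` of one identity between
bounded continuous functions. Integrating the function-valued identity in time yields an exceptional
set of times independent of `x`. -/
theorem IsWeakSolution.smoothL_eq_add_integral (hΩ : IsSmoothDomain Ω) (hq' : q ≠ ⊤) (hT : 0 < T)
    (hu : Integrable u (volume.restrict (Ioo 0 T)))
    (hρ : IsWeakSolution Ω T p (fun t => (SobolevWZero.field (u t))) ρ₀ ρ)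
    (hk : ContDiff ℝ ∞ k) (hc : HasCompactSupport k) :
    ∀ᵐ t ∂volume.restrict (Ioo 0 T), smoothL Ω hk hc (inclL Ω p q (ρ t)) =
      smoothL Ω hk hc (inclL Ω p q ρ₀) + ∫ s in (0 : ℝ)..t, smoothDivL Ω hk hc
        (mulL Ω p q (EuclideanSpace ℝ (Fin N)) (ρ s) (SobolevWZero.field (u s))) := by
  have hRi := hρ.integrable_smoothL (q := q) hk hc
  have hFi := hρ.integrable_smoothDivL hk hc hu
  refine ae_eq_add_integral_of_weak_deriv hT hRi hFi fun ψ hψ hψc hψT => ?_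
  obtain ⟨M, hM⟩ := hψc.exists_bound_of_continuous hψ.continuous
  obtain ⟨M', hM'⟩ := hψc.deriv.exists_bound_of_continuous (hψ.continuous_deriv (by simp))
  have i1 : IntegrableOn (fun t => deriv ψ t • smoothL Ω hk hc (inclL Ω p q (ρ t))) (Ioo 0 T) :=
    hRi.bdd_smul M' (hψ.continuous_deriv (by simp)).aestronglyMeasurable (Eventually.of_forall hM')
  have i2 : IntegrableOn (fun t => ψ t • smoothDivL Ω hk hc
      (mulL Ω p q (EuclideanSpace ℝ (Fin N)) (ρ t) (SobolevWZero.field (u t)))) (Ioo 0 T) :=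
    hFi.bdd_smul M hψ.continuous.aestronglyMeasurable (Eventually.of_forall hM)
  ext x
  have h := hρ.weak_eq_smooth hΩ hq' hu hψ hψc hψT (ζ := fun y => k (x - y))
    (hk.comp (contDiff_const.sub contDiff_id))
  simp only [fderiv_comp_const_sub_kernel hk, neg_apply, integral_neg, mul_neg] at h
  have e1 := (BoundedContinuousFunction.evalCLM ℝ x).integral_comp_comm i1
  have e2 := (BoundedContinuousFunction.evalCLM ℝ x).integral_comp_comm i2
  simp only [BoundedContinuousFunction.evalCLM_apply, BoundedContinuousFunction.smul_apply,
    smul_eq_mul, smoothL_apply, smoothDivL_apply] at e1 e2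
  simp only [BoundedContinuousFunction.add_apply, BoundedContinuousFunction.smul_apply,
    BoundedContinuousFunction.coe_zero, Pi.zero_apply, ← e1, ← e2, smoothL_apply, smul_eq_mul]
  linarith

end SmoothedEquation

/-! ### Chain rule along absolutely continuous paths. -/

section ChainRule

variable {X : Type*} [NormedAddCommGroup X] [NormedSpace ℝ X]

/-- Increments are at most `K` times the integral of `‖F‖`, whose absolute continuity carries over.
-/
theorem absolutelyContinuousOnInterval_comp_integral {Φ : X → ℝ} {K : NNReal}
    (hΦ : LipschitzWith K Φ) {F : ℝ → X} {a b : ℝ} (hF : IntervalIntegrable F volume a b) (R₀ : X) :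
    AbsolutelyContinuousOnInterval (fun t => Φ (R₀ + ∫ s in a..t, F s)) a b := by
  have hA : AbsolutelyContinuousOnInterval (fun t => (K : ℝ) * ∫ s in a..t, ‖F s‖) a b :=
    (hF.norm.absolutelyContinuousOnInterval_intervalIntegral (c := a) left_mem_uIcc).const_mul _
  rw [absolutelyContinuousOnInterval_iff] at hA ⊢
  intro ε hε
  obtain ⟨δ, hδ, h⟩ := hA ε hε
  refine ⟨δ, hδ, fun E hE hlen => lt_of_le_of_lt (Finset.sum_le_sum fun i hi => ?_) (h E hE hlen)⟩
  obtain ⟨hx, hy⟩ := hE.1 i hi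
  set x := (E.2 i).1
  set y := (E.2 i).2
  have hax : IntervalIntegrable F volume a x :=
    hF.mono_set (uIcc_subset_uIcc left_mem_uIcc hx)
  have hay : IntervalIntegrable F volume a y :=
    hF.mono_set (uIcc_subset_uIcc left_mem_uIcc hy)
  refine (hΦ.dist_le_mul _ _).trans ?_
  rw [dist_add_left, dist_eq_norm, dist_eq_norm, ← mul_sub, norm_mul, NNReal.norm_eq,
    intervalIntegral.integral_interval_sub_left hax hay,
    intervalIntegral.integral_interval_sub_left hax.norm hay.norm]
  gcongr
  exact intervalIntegral.norm_integral_le_abs_integral_norm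

/-- As `F` is merely integrable, the path is differentiable only at almost every time; absolute
continuity is what justifies integrating the derivative. -/
theorem sub_eq_integral_fderiv_comp [CompleteSpace X] {Φ : X → ℝ} {Φ' : X → X →L[ℝ] ℝ} {K : NNReal}
    (hΦ : LipschitzWith K Φ) (hΦ' : ∀ w, HasFDerivAt Φ (Φ' w) w) {F : ℝ → X} {a b : ℝ}
    (hF : IntervalIntegrable F volume a b) (R₀ : X) :
    Φ (R₀ + ∫ s in a..b, F s) - Φ R₀ = ∫ t in a..b, Φ' (R₀ + ∫ s in a..t, F s) (F t) := by
  have h := (absolutelyContinuousOnInterval_comp_integral hΦ hF R₀).integral_deriv_eq_sub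
  simp only [intervalIntegral.integral_same, add_zero] at h
  rw [← h]
  refine intervalIntegral.integral_congr_ae ?_
  filter_upwards [hF.ae_hasDerivAt_integral] with t ht hmem
  have h1 := ht (uIoc_subset_uIcc hmem) a left_mem_uIcc
  exact ((hΦ' _).comp_hasDerivAt t (h1.const_add R₀)).deriv

end ChainRule

/-! ### Differentiability of integral functionals on bounded continuous functions. -/

section Functional

open scoped BoundedContinuousFunction

variable {E : Type*} [TopologicalSpace E] [MeasurableSpace E] [OpensMeasurableSpace E]
  {μ : Measure E} [IsFiniteMeasure μ] {β : ℝ → ℝ}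

theorem integrable_comp_bcf {γ : ℝ → ℝ} (hγ : Continuous γ) (w : E →ᵇ ℝ) :
    Integrable (fun x => γ (w x)) μ := by
  obtain ⟨C, hC⟩ := (isCompact_closedBall (0 : ℝ) ‖w‖).exists_bound_of_continuousOn
    hγ.continuousOn
  refine Integrable.of_bound (hγ.comp w.continuous).measurable.aestronglyMeasurable C
    (Eventually.of_forall fun x => hC _ ?_)
  simpa using w.norm_coe_le_norm x

theorem integrable_comp_bcf_mul {γ : ℝ → ℝ} (hγ : Continuous γ) (w h : E →ᵇ ℝ) :
    Integrable (fun x => γ (w x) * h x) μ :=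
  (integrable_comp_bcf hγ w).mul_bdd (c := ‖h‖) h.continuous.measurable.aestronglyMeasurable
    (Eventually.of_forall fun x => h.norm_coe_le_norm x)

/-- The linear functional `h ↦ ∫ γ(w) h` for a bounded continuous function `γ`. -/
noncomputable def weightedIntegral (μ : Measure E) [IsFiniteMeasure μ] {γ : ℝ → ℝ}
    (hγ : Continuous γ) (w : E →ᵇ ℝ) {L : ℝ} (hL : ∀ x, |γ x| ≤ L) : (E →ᵇ ℝ) →L[ℝ] ℝ :=
  LinearMap.mkContinuous
    { toFun := fun h => ∫ x, γ (w x) * h x ∂μ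
      map_add' := fun h₁ h₂ => by
        rw [← integral_add (integrable_comp_bcf_mul hγ w h₁) (integrable_comp_bcf_mul hγ w h₂)]
        simp only [BoundedContinuousFunction.add_apply, mul_add]
      map_smul' := fun c h => by
        rw [RingHom.id_apply, smul_eq_mul, ← integral_const_mul]
        simp only [BoundedContinuousFunction.smul_apply, smul_eq_mul, mul_left_comm] }
    (L * μ.real univ) fun h => by
      refine (norm_integral_le_of_norm_le_const (C := L * ‖h‖)
        (Eventually.of_forall fun x => ?_)).trans (le_of_eq ?_)
      · rw [norm_mul]
        exact mul_le_mul (hL _) (h.norm_coe_le_norm x) (norm_nonneg _) ((abs_nonneg _).trans (hL 0))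
      · ring

theorem weightedIntegral_apply {γ : ℝ → ℝ} (hγ : Continuous γ) (w : E →ᵇ ℝ) {L : ℝ}
    (hL : ∀ x, |γ x| ≤ L) (h : E →ᵇ ℝ) :
    weightedIntegral μ hγ w hL h = ∫ x, γ (w x) * h x ∂μ := rfl

/-- Continuity in operator norm makes the derivative along a measurable path measurable in time. -/
theorem continuous_weightedIntegral {γ : ℝ → ℝ} (hγ : Continuous γ) {L : ℝ}
    (hL : ∀ x, |γ x| ≤ L) {M : NNReal} (hM : LipschitzWith M γ) :
    Continuous fun w : E →ᵇ ℝ => weightedIntegral μ hγ w hL := by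
  refine LipschitzWith.continuous (K := M * (μ.real univ).toNNReal)
    (LipschitzWith.of_dist_le_mul fun w w' => ?_)
  rw [dist_eq_norm, dist_eq_norm]
  refine ContinuousLinearMap.opNorm_le_bound _ (by positivity) fun h => ?_
  rw [sub_apply, weightedIntegral_apply, weightedIntegral_apply,
    ← integral_sub (integrable_comp_bcf_mul hγ w h) (integrable_comp_bcf_mul hγ w' h)]
  refine (norm_integral_le_of_norm_le_const (C := M * ‖w - w'‖ * ‖h‖)
    (Eventually.of_forall fun x => ?_)).trans (le_of_eq ?_)
  · rw [← sub_mul, norm_mul]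
    gcongr
    · refine (hM.norm_sub_le _ _).trans ?_
      gcongr
      exact (w - w').norm_coe_le_norm x
    · exact h.norm_coe_le_norm x
  · rw [NNReal.coe_mul, Real.coe_toNNReal _ measureReal_nonneg]
    ring

theorem abs_taylor_le (hβ : Differentiable ℝ β) {M : NNReal} (hM : LipschitzWith M (deriv β))
    (a h : ℝ) : |β (a + h) - β a - deriv β a * h| ≤ M * h ^ 2 := by
  have hd : ∀ x ∈ Metric.closedBall a |h|, HasDerivWithinAt (fun x => β x - deriv β a * x)
      (deriv β x - deriv β a) (Metric.closedBall a |h|) x := fun x _ => by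
    have := ((hβ x).hasDerivAt.sub ((hasDerivAt_id x).const_mul (deriv β a))).hasDerivWithinAt
      (s := Metric.closedBall a |h|)
    rw [mul_one] at this
    exact this
  have hb : ∀ x ∈ Metric.closedBall a |h|, ‖deriv β x - deriv β a‖ ≤ M * |h| := fun x hx => by
    refine (hM.norm_sub_le _ _).trans ?_
    gcongr
    rwa [← dist_eq_norm]
  have := (convex_closedBall a |h|).norm_image_sub_le_of_norm_hasDerivWithin_le hd hb
    (Metric.mem_closedBall_self (abs_nonneg _)) (show a + h ∈ Metric.closedBall a |h| by simp)
  rw [Real.norm_eq_abs, add_sub_cancel_left, Real.norm_eq_abs, mul_assoc, ← sq, sq_abs] at this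
  refine le_of_eq_of_le (congrArg _ ?_) this
  ring

/-- The Taylor remainder is quadratic in the sup norm, since `deriv β` is Lipschitz and the measure
is finite. -/
theorem hasFDerivAt_integral_comp_bcf (hβ : Differentiable ℝ β) (hβ' : Continuous (deriv β))
    {L : ℝ} (hL : ∀ x, |deriv β x| ≤ L) {M : NNReal} (hM : LipschitzWith M (deriv β))
    (w : E →ᵇ ℝ) :
    HasFDerivAt (fun w : E →ᵇ ℝ => ∫ x, β (w x) ∂μ) (weightedIntegral μ hβ' w hL) w := by
  rw [hasFDerivAt_iff_isLittleO_nhds_zero]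
  have hO : (fun h : E →ᵇ ℝ => (∫ x, β ((w + h) x) ∂μ) - (∫ x, β (w x) ∂μ) -
      weightedIntegral μ hβ' w hL h) =O[𝓝 0] fun h => ‖h‖ ^ 2 := by
    refine Asymptotics.IsBigO.of_bound (M * μ.real univ) (Eventually.of_forall fun h => ?_)
    have i1 := integrable_comp_bcf (μ := μ) hβ.continuous (w + h)
    have i2 := integrable_comp_bcf (μ := μ) hβ.continuous w
    have i3 := integrable_comp_bcf_mul (μ := μ) hβ' w h
    have e1 := integral_sub i1 i2
    have e2 := integral_sub (i1.sub i2) i3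
    simp only [Pi.sub_apply] at e1 e2
    rw [weightedIntegral_apply, ← e1, ← e2]
    refine (norm_integral_le_of_norm_le_const (C := M * ‖h‖ ^ 2)
      (Eventually.of_forall fun x => ?_)).trans (le_of_eq ?_)
    · refine (abs_taylor_le hβ hM (w x) (h x)).trans ?_
      rw [← sq_abs (h x)]
      gcongr
      exact h.norm_coe_le_norm x
    · rw [norm_pow, norm_norm]
      ring
  exact hO.trans_isLittleO (Asymptotics.isLittleO_norm_pow_id one_lt_two)

theorem lipschitzWith_integral_comp_bcf (hβ : Differentiable ℝ β) {L : NNReal}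
    (hL : ∀ x, |deriv β x| ≤ L) :
    LipschitzWith (L * (μ.real univ).toNNReal) fun w : E →ᵇ ℝ => ∫ x, β (w x) ∂μ := by
  have hlip : LipschitzWith L β := lipschitzWith_of_nnnorm_deriv_le hβ fun x => by
    rw [← NNReal.coe_le_coe, coe_nnnorm]
    exact hL x
  refine LipschitzWith.of_dist_le_mul fun w w' => ?_
  rw [dist_eq_norm, dist_eq_norm, ← integral_sub (integrable_comp_bcf hβ.continuous w)
    (integrable_comp_bcf hβ.continuous w')]
  refine (norm_integral_le_of_norm_le_const (C := L * ‖w - w'‖)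
    (Eventually.of_forall fun x => ?_)).trans (le_of_eq ?_)
  · refine (hlip.norm_sub_le _ _).trans ?_
    gcongr
    exact (w - w').norm_coe_le_norm x
  · rw [NNReal.coe_mul, Real.coe_toNNReal _ measureReal_nonneg]
    ring

end Functional

/-! ### Renormalized energy of the mollified solution. -/

section Energy

open scoped BoundedContinuousFunction

variable {N : ℕ} {Ω : Opens (EuclideanSpace ℝ (Fin N))} {p q : ℝ≥0∞} [Fact (1 ≤ p)] [Fact (1 ≤ q)]
  [hpq : ENNReal.HolderConjugate p q]
  {T : ℝ} {ρ₀ : LpOn Ω p ℝ} {u : ℝ → SobolevWZero Ω q} {ρ : ℝ → LpOn Ω p ℝ}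
  [IsFiniteMeasure (volume.restrict (Ω : Set (EuclideanSpace ℝ (Fin N))))]
  {k : EuclideanSpace ℝ (Fin N) → ℝ}

/-- The continuous representative in time of the smoothed solution. -/
noncomputable def smoothPath (hk : ContDiff ℝ ∞ k) (hc : HasCompactSupport k) (ρ₀ : LpOn Ω p ℝ)
    (u : ℝ → SobolevWZero Ω q) (ρ : ℝ → LpOn Ω p ℝ) (t : ℝ) : EuclideanSpace ℝ (Fin N) →ᵇ ℝ :=
  smoothL Ω hk hc (inclL Ω p q ρ₀) + ∫ s in (0 : ℝ)..t, smoothDivL Ω hk hc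
    (mulL Ω p q (EuclideanSpace ℝ (Fin N)) (ρ s) (SobolevWZero.field (u s)))

/-- With `r` the mollification of `f`, the integral of `∇(β ∘ r) · w = β'(r) ∇r · w` vanishes by the
divergence condition. Subtracting it leaves `β'(r)` times the commutator. -/
theorem enorm_weightedIntegral_smoothDivL_le (hΩ : IsSmoothDomain Ω) (hq' : q ≠ ⊤)
    (hk : ContDiff ℝ ∞ k) (hc : HasCompactSupport k) (f : LpOn Ω p ℝ) {w : SobolevWZero Ω q}
    (hw : IsDivergenceFree Ω (SobolevWZero.field w)) {β : ℝ → ℝ} (hβ : ContDiff ℝ ∞ β)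
    (hβ' : Continuous (deriv β)) {L : NNReal} (hL : ∀ x, |deriv β x| ≤ L) :
    ‖weightedIntegral (volume.restrict (Ω : Set (EuclideanSpace ℝ (Fin N)))) hβ'
      (smoothL Ω hk hc (inclL Ω p q f)) hL
      (smoothDivL Ω hk hc (mulL Ω p q _ f (SobolevWZero.field w)))‖ₑ ≤
    L * ∫⁻ x in (Ω : Set (EuclideanSpace ℝ (Fin N))),
      ‖transportCommutator hk hc f (SobolevWZero.field w) x‖ₑ := by
  set r := smoothL Ω hk hc (inclL Ω p q f) with hr
  set v := SobolevWZero.field w with hv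
  have hrs : ContDiff ℝ ∞ r := contDiff_smoothL hk hc _
  have hβr : ContDiff ℝ ∞ (fun x => β (r x)) := hβ.comp hrs
  have hfd : ∀ x, fderiv ℝ (fun x => β (r x)) x = deriv β (r x) • fderiv ℝ r x := fun x =>
    ((hβ.differentiable (by simp) (r x)).hasDerivAt.comp_hasFDerivAt x
      (hrs.differentiable (by simp) x).hasFDerivAt).fderiv
  have h0 := IsDivergenceFree.integral_fderiv_eq_zero hΩ hq' hw hβr
  have hcf : Continuous (fderiv ℝ fun x => β (r x)) := hβr.continuous_fderiv (by simp)
  obtain ⟨Z, -, hZ⟩ := exists_bound_on_domain hΩ hcf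
  have i2 : Integrable (fun x => fderiv ℝ (fun x => β (r x)) x (v x))
      (volume.restrict (Ω : Set (EuclideanSpace ℝ (Fin N)))) := by
    refine Integrable.mono' ((integrable_field v).norm.const_mul Z)
      ((ContinuousLinearMap.id ℝ (EuclideanSpace ℝ (Fin N) →L[ℝ] ℝ)).aestronglyMeasurable_comp₂
        hcf.aestronglyMeasurable (Lp.aestronglyMeasurable v)) ?_
    filter_upwards [ae_restrict_mem (measurableSet_domain Ω)] with x hx
    exact (fderiv ℝ (fun x => β (r x)) x).le_of_opNorm_le (hZ x hx) _
  rw [weightedIntegral_apply, ← sub_zero (∫ x, _ ∂_), ← h0,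
    ← integral_sub (integrable_comp_bcf_mul hβ' _ _) i2]
  refine (enorm_integral_le_lintegral_enorm _).trans ?_
  rw [← lintegral_const_mul' _ _ ENNReal.coe_ne_top]
  refine lintegral_mono fun x => ?_
  rw [hfd, smul_apply, smul_eq_mul, ← mul_sub, enorm_mul]
  refine mul_le_mul' ?_ le_rfl
  rw [enorm_le_coe, ← NNReal.coe_le_coe, coe_nnnorm]
  exact hL _

/-- The rate `g` is the derivative of the energy along the continuous path, which agrees with the
mollified solution at almost every time; there the commutator bound applies. Dominated convergence
will be applied to `g`, so measurability in time of the commutator's norm never has to be shown.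
Integrating over all of `(0, T)` makes the estimate uniform in `t`. -/
theorem IsWeakSolution.exists_energy_rate (hΩ : IsSmoothDomain Ω) (hq' : q ≠ ⊤) (hT : 0 < T)
    (hu : Integrable u (volume.restrict (Ioo 0 T)))
    (hdiv : ∀ᵐ t ∂volume.restrict (Ioo 0 T), IsDivergenceFree Ω (SobolevWZero.field (u t)))
    (hρ : IsWeakSolution Ω T p (fun t => (SobolevWZero.field (u t))) ρ₀ ρ)
    (hk : ContDiff ℝ ∞ k) (hc : HasCompactSupport k) {β : ℝ → ℝ} (hβ : ContDiff ℝ ∞ β)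
    {L M : NNReal} (hL : ∀ x, |deriv β x| ≤ L) (hM : LipschitzWith M (deriv β)) :
    ∃ g : ℝ → ℝ, AEStronglyMeasurable g (volume.restrict (Ioo 0 T)) ∧
      (∀ᵐ t ∂volume.restrict (Ioo 0 T), ‖g t‖ₑ ≤
        L * ∫⁻ x in (Ω : Set (EuclideanSpace ℝ (Fin N))),
          ‖transportCommutator hk hc (ρ t) (SobolevWZero.field (u t)) x‖ₑ) ∧
      ∀ t ∈ Icc 0 T, ‖(∫ x in (Ω : Set (EuclideanSpace ℝ (Fin N))),
        β (smoothPath hk hc ρ₀ u ρ t x)) - ∫ x in (Ω : Set (EuclideanSpace ℝ (Fin N))),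
          β (smoothL Ω hk hc (inclL Ω p q ρ₀) x)‖ₑ ≤ ∫⁻ t in Ioo 0 T, ‖g t‖ₑ := by
  have hβ' : Continuous (deriv β) := hβ.continuous_deriv (by simp)
  have hβd : Differentiable ℝ β := hβ.differentiable (by simp)
  have hFi := hρ.integrable_smoothDivL hk hc hu
  have hFI : ∀ t ∈ Icc 0 T, IntervalIntegrable (fun t => smoothDivL Ω hk hc
      (mulL Ω p q (EuclideanSpace ℝ (Fin N)) (ρ t) (SobolevWZero.field (u t)))) volume 0 t := by
    intro t ht
    rw [intervalIntegrable_iff_integrableOn_Ioo_of_le ht.1]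
    exact hFi.mono_set (Ioo_subset_Ioo_right ht.2)
  refine ⟨fun t => weightedIntegral (volume.restrict (Ω : Set (EuclideanSpace ℝ (Fin N)))) hβ'
    (smoothPath hk hc ρ₀ u ρ t) hL (smoothDivL Ω hk hc
      (mulL Ω p q (EuclideanSpace ℝ (Fin N)) (ρ t) (SobolevWZero.field (u t)))), ?_, ?_, ?_⟩
  · have h1 : AEStronglyMeasurable (smoothPath hk hc ρ₀ u ρ) (volume.restrict (Ioo 0 T)) := by
      refine (hρ.integrable_smoothL (q := q) hk hc).1.congr ?_
      exact hρ.smoothL_eq_add_integral hΩ hq' hT hu hk hc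
    have h2 := (continuous_weightedIntegral
      (μ := volume.restrict (Ω : Set (EuclideanSpace ℝ (Fin N)))) hβ' hL
      hM).comp_aestronglyMeasurable h1
    exact (ContinuousLinearMap.id ℝ
      ((EuclideanSpace ℝ (Fin N) →ᵇ ℝ) →L[ℝ] ℝ)).aestronglyMeasurable_comp₂ h2 hFi.1
  · filter_upwards [hρ.smoothL_eq_add_integral hΩ hq' hT hu hk hc, hdiv] with t ht hdt
    have ht' : smoothPath hk hc ρ₀ u ρ t = smoothL Ω hk hc (inclL Ω p q (ρ t)) := ht.symm
    rw [ht']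
    exact enorm_weightedIntegral_smoothDivL_le hΩ hq' hk hc (ρ t) hdt hβ hβ' hL
  · intro t ht
    have h := sub_eq_integral_fderiv_comp
      (lipschitzWith_integral_comp_bcf (μ := volume.restrict (Ω : Set (EuclideanSpace ℝ (Fin N))))
        hβd hL) (hasFDerivAt_integral_comp_bcf hβd hβ' hL hM) (hFI t ht)
        (smoothL Ω hk hc (inclL Ω p q ρ₀))
    refine (congrArg _ h).trans_le ?_
    rw [intervalIntegral.integral_of_le ht.1, integral_Ioc_eq_integral_Ioo]
    refine (enorm_integral_le_lintegral_enorm _).trans ?_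
    exact lintegral_mono_set (Ioo_subset_Ioo_right ht.2)

end Energy

/-! ### A smooth approximation of the absolute value. -/

section Regularization

theorem hasDerivAt_sqrt_sq_add {δ : ℝ} (hδ : 0 < δ) (x : ℝ) :
    HasDerivAt (fun x => √(x ^ 2 + δ ^ 2)) (x / √(x ^ 2 + δ ^ 2)) x := by
  have h := ((hasDerivAt_pow 2 x).add_const (δ ^ 2)).sqrt (by positivity)
  convert h using 1
  have : √(x ^ 2 + δ ^ 2) ≠ 0 := by positivity
  field_simp
  simp [mul_comm]

theorem deriv_sqrt_sq_add {δ : ℝ} (hδ : 0 < δ) :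
    deriv (fun x => √(x ^ 2 + δ ^ 2)) = fun x => x / √(x ^ 2 + δ ^ 2) :=
  funext fun x => (hasDerivAt_sqrt_sq_add hδ x).deriv

theorem contDiff_sqrt_sq_add {δ : ℝ} (hδ : 0 < δ) : ContDiff ℝ ∞ fun x => √(x ^ 2 + δ ^ 2) :=
  ((contDiff_id.pow 2).add contDiff_const).sqrt fun x => by
    have := sq_nonneg x
    change x ^ 2 + δ ^ 2 ≠ 0
    positivity

theorem abs_le_sqrt_sq_add (δ x : ℝ) : |x| ≤ √(x ^ 2 + δ ^ 2) := by
  rw [← Real.sqrt_sq_eq_abs]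
  exact Real.sqrt_le_sqrt (by nlinarith [sq_nonneg δ])

theorem sqrt_sq_add_le {δ : ℝ} (hδ : 0 < δ) (x : ℝ) : √(x ^ 2 + δ ^ 2) ≤ |x| + δ := by
  rw [Real.sqrt_le_left (by positivity)]
  nlinarith [sq_abs x, mul_nonneg (abs_nonneg x) hδ.le]

theorem abs_deriv_sqrt_sq_add_le {δ : ℝ} (hδ : 0 < δ) (x : ℝ) :
    |deriv (fun x => √(x ^ 2 + δ ^ 2)) x| ≤ 1 := by
  rw [deriv_sqrt_sq_add hδ, abs_div, abs_of_nonneg (Real.sqrt_nonneg _)]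
  exact div_le_one_of_le₀ (abs_le_sqrt_sq_add δ x) (Real.sqrt_nonneg _)

theorem lipschitzWith_deriv_sqrt_sq_add {δ : ℝ} (hδ : 0 < δ) :
    LipschitzWith (Real.toNNReal δ⁻¹) (deriv fun x => √(x ^ 2 + δ ^ 2)) := by
  rw [deriv_sqrt_sq_add hδ]
  -- As the root is at least `δ`, this second derivative is at most `δ⁻¹`.
  have hd : ∀ x, HasDerivAt (fun x => x / √(x ^ 2 + δ ^ 2)) (δ ^ 2 / √(x ^ 2 + δ ^ 2) ^ 3) x := by
    intro x
    have h0 : √(x ^ 2 + δ ^ 2) ≠ 0 := by positivity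
    have hs : √(x ^ 2 + δ ^ 2) ^ 2 = x ^ 2 + δ ^ 2 := Real.sq_sqrt (by positivity)
    have h := (hasDerivAt_id x).div (hasDerivAt_sqrt_sq_add hδ x) h0
    refine h.congr_deriv ?_
    rw [id]
    field_simp
    linear_combination hs
  refine lipschitzWith_of_nnnorm_deriv_le (fun x => (hd x).differentiableAt) fun x => ?_
  rw [(hd x).deriv, ← NNReal.coe_le_coe, coe_nnnorm, Real.coe_toNNReal _ (by positivity),
    Real.norm_of_nonneg (by positivity), div_le_iff₀ (by positivity)]
  have h1 : δ ≤ √(x ^ 2 + δ ^ 2) := (le_abs_self δ).trans (by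
    rw [add_comm]
    exact abs_le_sqrt_sq_add x δ)
  calc δ ^ 2 = δ⁻¹ * δ ^ 3 := by field_simp
    _ ≤ δ⁻¹ * √(x ^ 2 + δ ^ 2) ^ 3 := by gcongr

end Regularization

/-! ### From `L^1` continuity and equality of laws to `L^p` continuity. -/

section ConvergenceInLp

variable {α : Type*} [MeasurableSpace α] {μ : Measure α} [IsFiniteMeasure μ]

theorem integrable_comp_of_lipschitz {β : ℝ → ℝ} {K : NNReal} (hβ : LipschitzWith K β)
    {f : α → ℝ} (hf : Integrable f μ) : Integrable (fun x => β (f x)) μ := by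
  refine Integrable.mono' (g := fun x => |β 0| + K * |f x|)
    ((integrable_const _).add (hf.abs.const_mul _))
    (hβ.continuous.comp_aestronglyMeasurable hf.1) (Eventually.of_forall fun x => ?_)
  have h1 := hβ.norm_sub_le (f x) 0
  rw [sub_zero] at h1
  calc ‖β (f x)‖ = ‖β 0 + (β (f x) - β 0)‖ := by rw [add_sub_cancel]
    _ ≤ ‖β 0‖ + ‖β (f x) - β 0‖ := norm_add_le _ _
    _ ≤ _ := add_le_add le_rfl h1

theorem continuous_integral_comp_of_lipschitz {β : ℝ → ℝ} {K : NNReal} (hβ : LipschitzWith K β) :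
    Continuous fun f : Lp ℝ 1 μ => ∫ x, β (f x) ∂μ := by
  refine LipschitzWith.continuous (K := K) (LipschitzWith.of_dist_le_mul fun f g => ?_)
  rw [dist_eq_norm, dist_eq_norm, L1.norm_eq_integral_norm,
    ← integral_sub (integrable_comp_of_lipschitz hβ (L1.integrable_coeFn f))
      (integrable_comp_of_lipschitz hβ (L1.integrable_coeFn g)), ← integral_const_mul]
  refine norm_integral_le_of_norm_le ((L1.integrable_coeFn (f - g)).norm.const_mul _) ?_
  filter_upwards [Lp.coeFn_sub f g] with x hx
  rw [hx]
  exact hβ.norm_sub_le _ _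

/-- A finite measure is determined by its characteristic function. Its real and imaginary parts are
integrals of smooth functions with bounded derivatives, which the energy estimate admits. -/
theorem identDistrib_of_integral_cos_sin {f g : α → ℝ} (hf : AEMeasurable f μ)
    (hg : AEMeasurable g μ) (hcos : ∀ ξ : ℝ, ∫ x, Real.cos (ξ * f x) ∂μ = ∫ x, Real.cos (ξ * g x) ∂μ)
    (hsin : ∀ ξ : ℝ, ∫ x, Real.sin (ξ * f x) ∂μ = ∫ x, Real.sin (ξ * g x) ∂μ) :
    ProbabilityTheory.IdentDistrib f g μ μ := by
  refine ⟨hf, hg, Measure.ext_of_charFun (funext fun ξ => ?_)⟩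
  have key : ∀ h : α → ℝ, AEMeasurable h μ → charFun (μ.map h) ξ =
      ((∫ x, Real.cos (ξ * h x) ∂μ : ℝ) : ℂ) + (∫ x, Real.sin (ξ * h x) ∂μ : ℝ) * Complex.I := by
    intro h hh
    have i1 : Integrable (fun x => ((Real.cos (ξ * h x) : ℝ) : ℂ)) μ :=
      Integrable.of_bound ((Complex.measurable_ofReal.comp Real.measurable_cos).comp_aemeasurable
        (hh.const_mul ξ)).aestronglyMeasurable 1 (Eventually.of_forall fun x => by
          rw [Complex.norm_real]; exact Real.abs_cos_le_one _)
    have i2 : Integrable (fun x => ((Real.sin (ξ * h x) : ℝ) : ℂ)) μ :=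
      Integrable.of_bound ((Complex.measurable_ofReal.comp Real.measurable_sin).comp_aemeasurable
        (hh.const_mul ξ)).aestronglyMeasurable 1 (Eventually.of_forall fun x => by
          rw [Complex.norm_real]; exact Real.abs_sin_le_one _)
    rw [charFun_apply_real, integral_map hh (by fun_prop), ← integral_complex_ofReal,
      ← integral_complex_ofReal, ← integral_mul_const, ← integral_add i1 (i2.mul_const _)]
    refine integral_congr_ae (Eventually.of_forall fun x => ?_)
    simp only
    rw [← Complex.ofReal_mul, Complex.exp_mul_I, Complex.ofReal_cos, Complex.ofReal_sin]
  rw [key f hf, key g hg, hcos, hsin]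

/-- Vitali's theorem: `L^1` convergence gives convergence in measure, and a common law in `L^p`
gives uniform integrability of the `p`-th powers. -/
theorem exists_continuousOn_Lp_of_identDistrib {p : ℝ≥0∞} [hp : Fact (1 ≤ p)] (hp' : p ≠ ⊤)
    {s : Set ℝ} {R : ℝ → Lp ℝ 1 μ} (hR : ContinuousOn R s) {f : α → ℝ} (hf : MemLp f p μ)
    (h : ∀ t ∈ s, ProbabilityTheory.IdentDistrib (R t) f μ μ) :
    ∃ r : ℝ → Lp ℝ p μ, ContinuousOn r s ∧ ∀ t ∈ s, r t =ᵐ[μ] R t := by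
  classical
  have hm : ∀ t ∈ s, MemLp (R t) p μ := fun t ht => (h t ht).memLp_iff.2 hf
  refine ⟨fun t => if ht : t ∈ s then (hm t ht).toLp (R t) else 0, ?_, fun t ht => ?_⟩
  · intro t ht
    rw [ContinuousWithinAt, tendsto_iff_seq_tendsto]
    intro x hx
    have hx1 := (tendsto_nhdsWithin_iff.1 hx).1
    -- The sequence is shifted to lie entirely in `s`, where membership in `L^p` and the law are
    -- known.
    obtain ⟨n₀, hn₀⟩ := eventually_atTop.1 (tendsto_nhdsWithin_iff.1 hx).2
    rw [← tendsto_add_atTop_iff_nat n₀]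
    set y : ℕ → ℝ := fun n => x (n + n₀) with hy
    have hys : ∀ n, y n ∈ s := fun n => hn₀ _ (Nat.le_add_left _ _)
    have hyt : Tendsto y atTop (𝓝[s] t) := hx.comp (tendsto_add_atTop_nat n₀)
    have hRt : Tendsto (fun n => R (y n)) atTop (𝓝 (R t)) := (hR t ht).tendsto.comp hyt
    have hmeas : TendstoInMeasure μ (fun n => R (y n)) atTop (R t) :=
      tendstoInMeasure_of_tendsto_Lp hRt
    have hui : UnifIntegrable (fun n => (R (y n) : α → ℝ)) p μ :=
      (ProbabilityTheory.MemLp.uniformIntegrable_of_identDistrib (j := 0) hp.out hp' (hm _ (hys 0))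
        fun n => (h _ (hys n)).trans (h _ (hys 0)).symm).unifIntegrable
    have hlim := tendsto_Lp_finite_of_tendstoInMeasure hp.out hp'
      (fun n => Lp.aestronglyMeasurable (R (y n))) (hm t ht) hui hmeas
    rw [dif_pos ht]
    have e : (fun n => if ht : x (n + n₀) ∈ s then (hm _ ht).toLp (R (x (n + n₀))) else 0) =
        fun n => (hm _ (hys n)).toLp (R (y n)) := funext fun n => dif_pos (hys n)
    change Tendsto (fun n => if ht : x (n + n₀) ∈ s then (hm _ ht).toLp (R (x (n + n₀))) else 0) _ _
    rw [e]
    exact (Lp.tendsto_Lp_iff_tendsto_eLpNorm'' _ (fun n => hm _ (hys n)) _ (hm t ht)).2 hlim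
  · simp only [dif_pos ht]
    exact (hm t ht).coeFn_toLp

theorem exists_tendstoUniformlyOn_of_cauchy {X : Type*} [MetricSpace X] [CompleteSpace X] [Nonempty X]
    {s : Set ℝ} {W : ℕ → ℝ → X} (h : UniformCauchySeqOn W atTop s)
    (hW : ∀ n, ContinuousOn (W n) s) :
    ∃ R : ℝ → X, ContinuousOn R s ∧ ∀ t ∈ s, Tendsto (fun n => W n t) atTop (𝓝 (R t)) := by
  have h1 : ∀ t, ∃ x, t ∈ s → Tendsto (fun n => W n t) atTop (𝓝 x) := fun t => by
    by_cases ht : t ∈ s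
    · obtain ⟨x, hx⟩ := cauchySeq_tendsto_of_complete (h.cauchySeq ht)
      exact ⟨x, fun _ => hx⟩
    · exact ⟨Classical.arbitrary X, fun h => absurd h ht⟩
  choose R hR using h1
  exact ⟨R, (h.tendstoUniformlyOn_of_tendsto hR).continuousOn (Frequently.of_forall hW), hR⟩

end ConvergenceInLp

/-! ### Convergence of mollifications in `L^1`. -/

section MollifiedFunction

open scoped BoundedContinuousFunction

variable {N : ℕ} {Ω : Opens (EuclideanSpace ℝ (Fin N))}

theorem smoothL_mollifier_sub_eq {s : ℝ} (hs : 0 < s) (f : LpOn Ω 1 ℝ)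
    {x : EuclideanSpace ℝ (Fin N)} (hx : x ∈ (Ω : Set (EuclideanSpace ℝ (Fin N)))) :
    smoothL Ω (contDiff_mollifier s) (hasCompactSupport_mollifier hs) f x - f x =
      ∫ y, mollifier s (x - y) * ((Ω : Set (EuclideanSpace ℝ (Fin N))).indicator f y -
        (Ω : Set (EuclideanSpace ℝ (Fin N))).indicator f x) := by
  set O := (Ω : Set (EuclideanSpace ℝ (Fin N))) with hO
  obtain ⟨B, hB⟩ := (hasCompactSupport_mollifier (E := EuclideanSpace ℝ (Fin N))
    hs).exists_bound_of_continuous (contDiff_mollifier s).continuous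
  have hcont : Continuous fun y : EuclideanSpace ℝ (Fin N) => mollifier s (x - y) :=
    (contDiff_mollifier s).continuous.comp (continuous_const.sub continuous_id)
  have i1 : Integrable (fun y => mollifier s (x - y) * O.indicator f y) volume :=
    (integrable_indicator_LpOn_one f).bdd_mul (c := B) hcont.aestronglyMeasurable
      (Eventually.of_forall fun y => hB _)
  have i2 := (integrable_mollifier_sub hs x).mul_const (f x)
  have h := integral_sub i1 i2
  rw [integral_mul_const, integral_mollifier_sub hs, one_mul] at h
  rw [indicator_of_mem hx]
  simp only [mul_sub]
  rw [h, smoothL_apply, integral_domain_eq_indicator]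
  congr 2
  ext y
  change O.indicator (fun y => mollifier s (x - y) * f y) y = mollifier s (x - y) * O.indicator f y
  by_cases hy : y ∈ O
  · rw [indicator_of_mem hy, indicator_of_mem hy]
  · rw [indicator_of_notMem hy, indicator_of_notMem hy, mul_zero]

/-- As the mollifier is nonnegative with mass one, the error is an average of translation increments
over the ball of radius `s`. -/
theorem lintegral_smoothL_mollifier_sub_le {s : ℝ} (hs : 0 < s) (f : LpOn Ω 1 ℝ) {κ : ℝ≥0∞}
    (hκ : ∀ z : EuclideanSpace ℝ (Fin N), ‖z‖ ≤ s → eLpNorm (fun x =>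
      (Ω : Set (EuclideanSpace ℝ (Fin N))).indicator f (x + z) -
        (Ω : Set (EuclideanSpace ℝ (Fin N))).indicator f x) 1 volume ≤ κ) :
    ∫⁻ x in (Ω : Set (EuclideanSpace ℝ (Fin N))),
      ‖smoothL Ω (contDiff_mollifier s) (hasCompactSupport_mollifier hs) f x - f x‖ₑ ≤ κ := by
  set f' := (Ω : Set (EuclideanSpace ℝ (Fin N))).indicator f with hf'
  set K := (mollifier s : EuclideanSpace ℝ (Fin N) → ℝ) with hK
  have hKc : Continuous K := (contDiff_mollifier s).continuous
  have hfm : Measurable f' := measurable_indicator_LpOn _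
  calc ∫⁻ x in (Ω : Set (EuclideanSpace ℝ (Fin N))),
        ‖smoothL Ω (contDiff_mollifier s) (hasCompactSupport_mollifier hs) f x - f x‖ₑ
      ≤ ∫⁻ x in (Ω : Set (EuclideanSpace ℝ (Fin N))), ∫⁻ z, ‖K z‖ₑ * ‖f' (x - z) - f' x‖ₑ := by
        refine setLIntegral_mono' (measurableSet_domain Ω) fun x hx => ?_
        rw [smoothL_mollifier_sub_eq hs f hx]
        refine (enorm_integral_le_lintegral_enorm _).trans ?_
        rw [← lintegral_sub_left_eq_self (fun z => ‖K z‖ₑ * ‖f' (x - z) - f' x‖ₑ) x]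
        refine lintegral_mono fun y => ?_
        rw [sub_sub_cancel, enorm_mul]
    _ ≤ ∫⁻ x, ∫⁻ z, ‖K z‖ₑ * ‖f' (x - z) - f' x‖ₑ := setLIntegral_le_lintegral _ _
    _ = ∫⁻ z, ∫⁻ x, ‖K z‖ₑ * ‖f' (x - z) - f' x‖ₑ := by
        refine lintegral_lintegral_swap (Measurable.aemeasurable ?_)
        have h1 : Measurable fun a : EuclideanSpace ℝ (Fin N) × EuclideanSpace ℝ (Fin N) =>
            ‖K a.2‖ₑ := (hKc.comp continuous_snd).enorm.measurable
        have h2 : Measurable fun a : EuclideanSpace ℝ (Fin N) × EuclideanSpace ℝ (Fin N) =>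
            f' (a.1 - a.2) - f' a.1 :=
          (hfm.comp (measurable_fst.sub measurable_snd)).sub (hfm.comp measurable_fst)
        exact h1.mul h2.enorm
    _ ≤ ∫⁻ z, ‖K z‖ₑ * κ := by
        refine lintegral_mono fun z => ?_
        rw [lintegral_const_mul' _ _ enorm_ne_top]
        by_cases hz : s ≤ ‖z‖
        · rw [hK, mollifier_eq_zero hs hz]
          simp
        rw [not_le] at hz
        gcongr
        have h1 := hκ (-z) (by rw [norm_neg]; exact hz.le)
        rwa [eLpNorm_one_eq_lintegral_enorm] at h1
    _ = (∫⁻ z, ‖K z‖ₑ) * κ := lintegral_mul_const _ hKc.enorm.measurable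
    _ = κ := by
        have h1 : ∫⁻ z, ‖K z‖ₑ = 1 := by
          rw [← ofReal_integral_norm_eq_lintegral_enorm
            (hKc.integrable_of_hasCompactSupport (hasCompactSupport_mollifier hs))]
          simp only [hK, Real.norm_of_nonneg (mollifier_nonneg hs _)]
          rw [integral_mollifier hs, ENNReal.ofReal_one]
        rw [h1, one_mul]

variable [IsFiniteMeasure (volume.restrict (Ω : Set (EuclideanSpace ℝ (Fin N))))]

/-- A bounded continuous function as an integrable function on the domain. -/
noncomputable def toL1 (Ω : Opens (EuclideanSpace ℝ (Fin N)))
    [IsFiniteMeasure (volume.restrict (Ω : Set (EuclideanSpace ℝ (Fin N))))] :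
    (EuclideanSpace ℝ (Fin N) →ᵇ ℝ) →L[ℝ] LpOn Ω 1 ℝ :=
  BoundedContinuousFunction.toLp 1 (volume.restrict (Ω : Set (EuclideanSpace ℝ (Fin N)))) ℝ

theorem coeFn_toL1 (w : EuclideanSpace ℝ (Fin N) →ᵇ ℝ) :
    toL1 Ω w =ᵐ[volume.restrict (Ω : Set (EuclideanSpace ℝ (Fin N)))] w :=
  BoundedContinuousFunction.coeFn_toLp _ _ _ w

theorem integral_comp_toL1 (γ : ℝ → ℝ) (w : EuclideanSpace ℝ (Fin N) →ᵇ ℝ) :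
    ∫ x in (Ω : Set (EuclideanSpace ℝ (Fin N))), γ (toL1 Ω w x) =
      ∫ x in (Ω : Set (EuclideanSpace ℝ (Fin N))), γ (w x) := by
  refine integral_congr_ae ?_
  filter_upwards [coeFn_toL1 (Ω := Ω) w] with x hx
  rw [hx]

theorem norm_toL1 (w : EuclideanSpace ℝ (Fin N) →ᵇ ℝ) :
    ‖toL1 Ω w‖ = ∫ x in (Ω : Set (EuclideanSpace ℝ (Fin N))), |w x| := by
  rw [L1.norm_eq_integral_norm]
  exact integral_comp_toL1 (fun x => |x|) w

theorem tendsto_toL1_smoothL_mollifier (f : LpOn Ω 1 ℝ) :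
    Tendsto (fun n : ℕ => toL1 Ω (smoothL Ω (contDiff_mollifier (1 / ((n : ℝ) + 1)))
      (hasCompactSupport_mollifier Nat.one_div_pos_of_nat) f)) atTop (𝓝 f) := by
  rw [tendsto_iff_edist_tendsto_0, ENNReal.tendsto_nhds_zero]
  intro ε hε
  have hlim := tendsto_eLpNorm_comp_add_right_sub ENNReal.one_ne_top (memLp_indicator_LpOn f)
  obtain ⟨δ, hδ, hball⟩ := Metric.eventually_nhds_iff.1 (hlim.eventually_le_const hε)
  filter_upwards [tendsto_one_div_add_atTop_nhds_zero_nat.eventually_lt_const hδ] with n hn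
  rw [edist_eq_enorm_sub, Lp.enorm_def, eLpNorm_one_eq_lintegral_enorm]
  refine le_of_eq_of_le ?_ (lintegral_smoothL_mollifier_sub_le Nat.one_div_pos_of_nat f
    fun z hz => hball (by simpa using hz.trans_lt hn))
  refine lintegral_congr_ae ?_
  filter_upwards [Lp.coeFn_sub (toL1 Ω (smoothL Ω (contDiff_mollifier (1 / ((n : ℝ) + 1)))
      (hasCompactSupport_mollifier Nat.one_div_pos_of_nat) f)) f,
    coeFn_toL1 (Ω := Ω) (smoothL Ω (contDiff_mollifier (1 / ((n : ℝ) + 1)))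
      (hasCompactSupport_mollifier Nat.one_div_pos_of_nat) f)] with x h1 h2
  rw [h1, Pi.sub_apply, h2]

end MollifiedFunction

/-! ### Linearity in the kernel. -/

section KernelDifference

open scoped BoundedContinuousFunction

variable {N : ℕ} {Ω : Opens (EuclideanSpace ℝ (Fin N))}
  {k₁ k₂ : EuclideanSpace ℝ (Fin N) → ℝ}

theorem smoothL_sub_kernel (hk₁ : ContDiff ℝ ∞ k₁) (hc₁ : HasCompactSupport k₁)
    (hk₂ : ContDiff ℝ ∞ k₂) (hc₂ : HasCompactSupport k₂) (hk : ContDiff ℝ ∞ (k₁ - k₂))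
    (hc : HasCompactSupport (k₁ - k₂)) (f : LpOn Ω 1 ℝ) :
    smoothL Ω hk hc f = smoothL Ω hk₁ hc₁ f - smoothL Ω hk₂ hc₂ f := by
  ext x
  rw [BoundedContinuousFunction.sub_apply, smoothL_apply, smoothL_apply, smoothL_apply]
  refine Eq.trans ?_ (integral_sub
    (integrable_convolution_kernel (continuous_smul_one hk₁.continuous)
      (exists_bound_kernel hk₁ hc₁).choose_spec f x)
    (integrable_convolution_kernel (continuous_smul_one hk₂.continuous)
      (exists_bound_kernel hk₂ hc₂).choose_spec f x))
  refine integral_congr_ae (Eventually.of_forall fun y => ?_)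
  simp [sub_mul]

theorem smoothDivL_sub_kernel (hk₁ : ContDiff ℝ ∞ k₁) (hc₁ : HasCompactSupport k₁)
    (hk₂ : ContDiff ℝ ∞ k₂) (hc₂ : HasCompactSupport k₂) (hk : ContDiff ℝ ∞ (k₁ - k₂))
    (hc : HasCompactSupport (k₁ - k₂)) (f : LpOn Ω 1 (EuclideanSpace ℝ (Fin N))) :
    smoothDivL Ω hk hc f = smoothDivL Ω hk₁ hc₁ f - smoothDivL Ω hk₂ hc₂ f := by
  ext x
  rw [BoundedContinuousFunction.sub_apply, smoothDivL_apply, smoothDivL_apply, smoothDivL_apply]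
  refine Eq.trans ?_ (integral_sub
    (integrable_convolution_kernel (hk₁.continuous_fderiv (by simp))
      (exists_bound_fderiv_kernel hk₁ hc₁).choose_spec f x)
    (integrable_convolution_kernel (hk₂.continuous_fderiv (by simp))
      (exists_bound_fderiv_kernel hk₂ hc₂).choose_spec f x))
  refine integral_congr_ae (Eventually.of_forall fun y => ?_)
  simp only
  rw [fderiv_sub (hk₁.differentiable (by simp) _) (hk₂.differentiable (by simp) _), sub_apply]

variable {p q : ℝ≥0∞} [Fact (1 ≤ p)] [Fact (1 ≤ q)] [hpq : ENNReal.HolderConjugate p q]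
  [IsFiniteMeasure (volume.restrict (Ω : Set (EuclideanSpace ℝ (Fin N))))]

theorem transportCommutator_sub_kernel (hk₁ : ContDiff ℝ ∞ k₁) (hc₁ : HasCompactSupport k₁)
    (hk₂ : ContDiff ℝ ∞ k₂) (hc₂ : HasCompactSupport k₂) (hk : ContDiff ℝ ∞ (k₁ - k₂))
    (hc : HasCompactSupport (k₁ - k₂)) (f : LpOn Ω p ℝ) (v : LpOn Ω q (EuclideanSpace ℝ (Fin N)))
    (x : EuclideanSpace ℝ (Fin N)) :
    transportCommutator hk hc f v x =
      transportCommutator hk₁ hc₁ f v x - transportCommutator hk₂ hc₂ f v x := by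
  rw [transportCommutator, transportCommutator, transportCommutator,
    smoothDivL_sub_kernel hk₁ hc₁ hk₂ hc₂, smoothL_sub_kernel hk₁ hc₁ hk₂ hc₂,
    BoundedContinuousFunction.coe_sub, BoundedContinuousFunction.coe_sub,
    fderiv_sub ((contDiff_smoothL hk₁ hc₁ _).differentiable (by simp) _)
      ((contDiff_smoothL hk₂ hc₂ _).differentiable (by simp) _), sub_apply, Pi.sub_apply]
  ring

theorem aestronglyMeasurable_transportCommutator (hk : ContDiff ℝ ∞ k₁) (hc : HasCompactSupport k₁)
    (f : LpOn Ω p ℝ) (v : LpOn Ω q (EuclideanSpace ℝ (Fin N))) :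
    AEStronglyMeasurable (transportCommutator hk hc f v)
      (volume.restrict (Ω : Set (EuclideanSpace ℝ (Fin N)))) :=
  (smoothDivL Ω hk hc _).continuous.aestronglyMeasurable.sub
    ((ContinuousLinearMap.id ℝ (EuclideanSpace ℝ (Fin N) →L[ℝ] ℝ)).aestronglyMeasurable_comp₂
      ((contDiff_smoothL hk hc _).continuous_fderiv (by simp)).aestronglyMeasurable
      (Lp.aestronglyMeasurable v))

theorem lintegral_transportCommutator_sub_kernel_le (hk₁ : ContDiff ℝ ∞ k₁)
    (hc₁ : HasCompactSupport k₁) (hk₂ : ContDiff ℝ ∞ k₂) (hc₂ : HasCompactSupport k₂)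
    (hk : ContDiff ℝ ∞ (k₁ - k₂)) (hc : HasCompactSupport (k₁ - k₂)) (f : LpOn Ω p ℝ)
    (v : LpOn Ω q (EuclideanSpace ℝ (Fin N))) :
    ∫⁻ x in (Ω : Set (EuclideanSpace ℝ (Fin N))), ‖transportCommutator hk hc f v x‖ₑ ≤
      (∫⁻ x in (Ω : Set (EuclideanSpace ℝ (Fin N))), ‖transportCommutator hk₁ hc₁ f v x‖ₑ) +
      ∫⁻ x in (Ω : Set (EuclideanSpace ℝ (Fin N))), ‖transportCommutator hk₂ hc₂ f v x‖ₑ := by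
  rw [← lintegral_add_left' (aestronglyMeasurable_transportCommutator hk₁ hc₁ f v).enorm]
  refine lintegral_mono fun x => ?_
  rw [transportCommutator_sub_kernel hk₁ hc₁ hk₂ hc₂]
  exact enorm_sub_le

/-- A difference of two mollified solutions is the path of the kernel `k₁ - k₂`, so the energy
estimate applies to it unchanged. -/
theorem IsWeakSolution.smoothPath_sub_kernel {T : ℝ} {ρ₀ : LpOn Ω p ℝ} {u : ℝ → SobolevWZero Ω q}
    {ρ : ℝ → LpOn Ω p ℝ} (hu : Integrable u (volume.restrict (Ioo 0 T)))
    (hρ : IsWeakSolution Ω T p (fun t => (SobolevWZero.field (u t))) ρ₀ ρ)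
    (hk₁ : ContDiff ℝ ∞ k₁) (hc₁ : HasCompactSupport k₁)
    (hk₂ : ContDiff ℝ ∞ k₂) (hc₂ : HasCompactSupport k₂) (hk : ContDiff ℝ ∞ (k₁ - k₂))
    (hc : HasCompactSupport (k₁ - k₂)) {t : ℝ} (ht : t ∈ Icc 0 T) :
    smoothPath hk hc ρ₀ u ρ t = smoothPath hk₁ hc₁ ρ₀ u ρ t - smoothPath hk₂ hc₂ ρ₀ u ρ t := by
  have hI : ∀ {k : EuclideanSpace ℝ (Fin N) → ℝ} (hk : ContDiff ℝ ∞ k) (hc : HasCompactSupport k),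
      IntervalIntegrable (fun t => smoothDivL Ω hk hc
        (mulL Ω p q (EuclideanSpace ℝ (Fin N)) (ρ t) (SobolevWZero.field (u t)))) volume 0 t := by
    intro k hk hc
    rw [intervalIntegrable_iff_integrableOn_Ioo_of_le ht.1]
    exact (hρ.integrable_smoothDivL hk hc hu).mono_set (Ioo_subset_Ioo_right ht.2)
  simp only [smoothPath, smoothL_sub_kernel hk₁ hc₁ hk₂ hc₂, smoothDivL_sub_kernel hk₁ hc₁ hk₂ hc₂]
  rw [intervalIntegral.integral_sub (hI hk₁ hc₁) (hI hk₂ hc₂)]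
  abel

end KernelDifference

/-! ### Uniform convergence in `L^1` and conservation of the law. -/

section Conclusion

open scoped BoundedContinuousFunction

variable {N : ℕ} {Ω : Opens (EuclideanSpace ℝ (Fin N))} {p q : ℝ≥0∞} [Fact (1 ≤ p)] [Fact (1 ≤ q)]
  [hpq : ENNReal.HolderConjugate p q]
  {T : ℝ} {ρ₀ : LpOn Ω p ℝ} {u : ℝ → SobolevWZero Ω q} {ρ : ℝ → LpOn Ω p ℝ}
  [IsFiniteMeasure (volume.restrict (Ω : Set (EuclideanSpace ℝ (Fin N))))]

/-- Dominated convergence in time for the energy rates. Index and filter are left free because both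
single kernels and differences of two kernels, indexed by pairs, are needed. -/
theorem IsWeakSolution.eventually_energy_le (hΩ : IsSmoothDomain Ω) (hq' : q ≠ ⊤) (hT : 0 < T)
    (hu : Integrable u (volume.restrict (Ioo 0 T)))
    (hdiv : ∀ᵐ t ∂volume.restrict (Ioo 0 T), IsDivergenceFree Ω (SobolevWZero.field (u t)))
    (hρ : IsWeakSolution Ω T p (fun t => (SobolevWZero.field (u t))) ρ₀ ρ)
    {ι : Type*} [Countable ι] {l : Filter ι} [l.IsCountablyGenerated]
    {k : ι → EuclideanSpace ℝ (Fin N) → ℝ} (hk : ∀ i, ContDiff ℝ ∞ (k i))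
    (hc : ∀ i, HasCompactSupport (k i)) {G : ℝ → ℝ≥0∞} (hG : ∫⁻ t in Ioo 0 T, G t ≠ ⊤)
    (hle : ∀ᵐ t ∂volume.restrict (Ioo 0 T), ∀ i, ∫⁻ x in (Ω : Set (EuclideanSpace ℝ (Fin N))),
      ‖transportCommutator (hk i) (hc i) (ρ t) (SobolevWZero.field (u t)) x‖ₑ ≤ G t)
    (hlim : ∀ᵐ t ∂volume.restrict (Ioo 0 T), Tendsto (fun i =>
      ∫⁻ x in (Ω : Set (EuclideanSpace ℝ (Fin N))),
        ‖transportCommutator (hk i) (hc i) (ρ t) (SobolevWZero.field (u t)) x‖ₑ) l (𝓝 0))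
    {β : ℝ → ℝ} (hβ : ContDiff ℝ ∞ β) {L M : NNReal} (hL : ∀ x, |deriv β x| ≤ L)
    (hM : LipschitzWith M (deriv β)) {ε : ℝ} (hε : 0 < ε) :
    ∀ᶠ i in l, ∀ t ∈ Icc 0 T, |(∫ x in (Ω : Set (EuclideanSpace ℝ (Fin N))),
      β (smoothPath (hk i) (hc i) ρ₀ u ρ t x)) - ∫ x in (Ω : Set (EuclideanSpace ℝ (Fin N))),
        β (smoothL Ω (hk i) (hc i) (inclL Ω p q ρ₀) x)| ≤ ε := by
  choose g hgm hgle hg using fun i =>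
    hρ.exists_energy_rate hΩ hq' hT hu hdiv (hk i) (hc i) hβ hL hM
  have hgle' := ae_all_iff.2 hgle
  have htend : Tendsto (fun i => ∫⁻ t in Ioo 0 T, ‖g i t‖ₑ) l (𝓝 (∫⁻ t in Ioo 0 T, 0)) := by
    refine tendsto_lintegral_filter_of_dominated_convergence' (fun t => L * G t)
      (Eventually.of_forall fun i => (hgm i).enorm) (Eventually.of_forall fun i => ?_) ?_ ?_
    · filter_upwards [hle, hgle'] with t h1 h2
      exact (h2 i).trans (mul_le_mul' le_rfl (h1 i))
    · rw [lintegral_const_mul' _ _ ENNReal.coe_ne_top]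
      exact ENNReal.mul_ne_top ENNReal.coe_ne_top hG
    · filter_upwards [hlim, hgle'] with t h1 h2
      have h3 := ENNReal.Tendsto.const_mul (a := (L : ℝ≥0∞)) h1 (Or.inr ENNReal.coe_ne_top)
      rw [mul_zero] at h3
      exact tendsto_of_tendsto_of_tendsto_of_le_of_le tendsto_const_nhds h3 (fun _ => zero_le) h2
  rw [lintegral_zero] at htend
  filter_upwards [htend.eventually_le_const (ENNReal.ofReal_pos.2 hε)] with i hi t ht
  have h := (hg i t ht).trans hi
  rwa [← ofReal_norm, ENNReal.ofReal_le_ofReal_iff hε.le] at h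

/-- The `n`-th element of a sequence of kernels approximating the identity. -/
noncomputable def approxKernel (E : Type*) [NormedAddCommGroup E] [InnerProductSpace ℝ E]
    [FiniteDimensional ℝ E] [MeasurableSpace E] [BorelSpace E] (n : ℕ) : E → ℝ :=
  mollifier (1 / ((n : ℝ) + 1))

theorem contDiff_approxKernel (n : ℕ) :
    ContDiff ℝ ∞ (approxKernel (EuclideanSpace ℝ (Fin N)) n) := contDiff_mollifier _

theorem hasCompactSupport_approxKernel (n : ℕ) :
    HasCompactSupport (approxKernel (EuclideanSpace ℝ (Fin N)) n) :=
  hasCompactSupport_mollifier Nat.one_div_pos_of_nat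

theorem contDiff_approxKernel_sub (i : ℕ × ℕ) : ContDiff ℝ ∞
    (approxKernel (EuclideanSpace ℝ (Fin N)) i.1 - approxKernel (EuclideanSpace ℝ (Fin N)) i.2) :=
  (contDiff_approxKernel i.1).sub (contDiff_approxKernel i.2)

theorem hasCompactSupport_approxKernel_sub (i : ℕ × ℕ) : HasCompactSupport
    (approxKernel (EuclideanSpace ℝ (Fin N)) i.1 - approxKernel (EuclideanSpace ℝ (Fin N)) i.2) :=
  (hasCompactSupport_approxKernel i.1).sub (hasCompactSupport_approxKernel i.2)

/-- The bound on the norms of `ρ t` leaves a multiple of `‖u t‖`, which is integrable. -/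
theorem IsWeakSolution.exists_commutator_majorant (hΩ : IsSmoothDomain Ω) (hq' : q ≠ ⊤)
    (hu : Integrable u (volume.restrict (Ioo 0 T)))
    (hdiv : ∀ᵐ t ∂volume.restrict (Ioo 0 T), IsDivergenceFree Ω (SobolevWZero.field (u t)))
    (hρ : IsWeakSolution Ω T p (fun t => (SobolevWZero.field (u t))) ρ₀ ρ) :
    ∃ G : ℝ → ℝ≥0∞, AEMeasurable G (volume.restrict (Ioo 0 T)) ∧ ∫⁻ t in Ioo 0 T, G t ≠ ⊤ ∧
      ∀ᵐ t ∂volume.restrict (Ioo 0 T), ∀ n, ∫⁻ x in (Ω : Set (EuclideanSpace ℝ (Fin N))),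
        ‖transportCommutator (contDiff_approxKernel n) (hasCompactSupport_approxKernel n) (ρ t)
          (SobolevWZero.field (u t)) x‖ₑ ≤ G t := by
  obtain ⟨K, hK0, hK⟩ := hρ.exists_bound
  refine ⟨fun t => ENNReal.ofReal (mollifierConst (EuclideanSpace ℝ (Fin N))) *
    (2 * ENNReal.ofReal K * ‖u t‖ₑ), ?_, ?_, ?_⟩
  · exact (hu.1.enorm.const_mul _).const_mul _
  · rw [lintegral_const_mul' _ _ ENNReal.ofReal_ne_top, lintegral_const_mul' _ _ (by finiteness)]
    exact ENNReal.mul_ne_top ENNReal.ofReal_ne_top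
      (ENNReal.mul_ne_top (by finiteness) hu.2.ne)
  · filter_upwards [hK, hdiv] with t h1 h2 n
    refine (lintegral_commutator_mollifier_le_norm hΩ hq' Nat.one_div_pos_of_nat (ρ t) h2).trans ?_
    gcongr
    rw [← ofReal_norm]
    exact ENNReal.ofReal_le_ofReal h1

theorem tendsto_lintegral_commutator (hΩ : IsSmoothDomain Ω) (hp' : p ≠ ⊤) (hq' : q ≠ ⊤)
    (f : LpOn Ω p ℝ) {w : SobolevWZero Ω q} (hw : IsDivergenceFree Ω (SobolevWZero.field w)) :
    Tendsto (fun n => ∫⁻ x in (Ω : Set (EuclideanSpace ℝ (Fin N))),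
      ‖transportCommutator (contDiff_approxKernel n) (hasCompactSupport_approxKernel n) f
        (SobolevWZero.field w) x‖ₑ) atTop (𝓝 0) := by
  rw [ENNReal.tendsto_nhds_zero]
  intro ε hε
  obtain ⟨δ, hδ, h⟩ := eventually_lintegral_commutator_mollifier_le hΩ hp' hq' f hw hε
  filter_upwards [tendsto_one_div_add_atTop_nhds_zero_nat.eventually_lt_const hδ] with n hn
  exact h _ Nat.one_div_pos_of_nat hn

/-- The smoothed solutions, as a sequence of curves of integrable functions. -/
noncomputable def approxPath (ρ₀ : LpOn Ω p ℝ) (u : ℝ → SobolevWZero Ω q) (ρ : ℝ → LpOn Ω p ℝ)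
    (n : ℕ) (t : ℝ) : LpOn Ω 1 ℝ :=
  toL1 Ω (smoothPath (contDiff_approxKernel n) (hasCompactSupport_approxKernel n) ρ₀ u ρ t)

theorem tendsto_toL1_smoothL_approxKernel (f : LpOn Ω 1 ℝ) :
    Tendsto (fun n : ℕ => toL1 Ω (smoothL Ω (contDiff_approxKernel n)
      (hasCompactSupport_approxKernel n) f)) atTop (𝓝 f) :=
  tendsto_toL1_smoothL_mollifier f

theorem IsWeakSolution.continuousOn_approxPath (hu : Integrable u (volume.restrict (Ioo 0 T)))
    (hT : 0 < T) (hρ : IsWeakSolution Ω T p (fun t => (SobolevWZero.field (u t))) ρ₀ ρ) (n : ℕ) :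
    ContinuousOn (approxPath ρ₀ u ρ n) (Icc 0 T) := by
  have h := intervalIntegral.continuousOn_primitive_interval (a := (0 : ℝ)) (b := T) (μ := volume)
    (f := fun t => smoothDivL Ω (contDiff_approxKernel n) (hasCompactSupport_approxKernel n)
      (mulL Ω p q (EuclideanSpace ℝ (Fin N)) (ρ t) (SobolevWZero.field (u t)))) (by
        rw [uIcc_of_le hT.le, integrableOn_Icc_iff_integrableOn_Ioo]
        exact hρ.integrable_smoothDivL _ _ hu)
  rw [uIcc_of_le hT.le] at h
  exact (toL1 Ω).continuous.comp_continuousOn (continuousOn_const.add h)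

/-- Let `w` be the difference of two smoothed paths at time `t` and `w₀` the difference at time
zero. With `β x = √(x ^ 2 + δ ^ 2)`, `∫ |w| ≤ ∫ β(w) ≤ ∫ β(w₀) + ε / 4 ≤ ∫ |w₀| + δ |Ω| + ε / 4`,
and the mollified initial data are Cauchy in `L^1`. -/
theorem IsWeakSolution.uniformCauchySeqOn_approxPath (hΩ : IsSmoothDomain Ω) (hp' : p ≠ ⊤)
    (hq' : q ≠ ⊤) (hT : 0 < T) (hu : Integrable u (volume.restrict (Ioo 0 T)))
    (hdiv : ∀ᵐ t ∂volume.restrict (Ioo 0 T), IsDivergenceFree Ω (SobolevWZero.field (u t)))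
    (hρ : IsWeakSolution Ω T p (fun t => (SobolevWZero.field (u t))) ρ₀ ρ) :
    UniformCauchySeqOn (approxPath ρ₀ u ρ) atTop (Icc 0 T) := by
  intro U hU
  obtain ⟨ε, hε, hεU⟩ := Metric.mem_uniformity_dist.1 hU
  set μ := volume.restrict (Ω : Set (EuclideanSpace ℝ (Fin N))) with hμ
  obtain ⟨δ, hδ, hδε⟩ : ∃ δ > 0, δ * μ.real univ ≤ ε / 4 := by
    -- The added one avoids dividing by a measure that might be zero.
    refine ⟨ε / 4 / (μ.real univ + 1), by positivity, ?_⟩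
    rw [div_mul_eq_mul_div]
    refine div_le_of_le_mul₀ (by positivity) (by positivity) ?_
    gcongr
    linarith
  obtain ⟨G, hGm, hG, hGle⟩ := hρ.exists_commutator_majorant hΩ hq' hu hdiv
  have henergy := hρ.eventually_energy_le hΩ hq' hT hu hdiv (l := atTop ×ˢ atTop)
    contDiff_approxKernel_sub hasCompactSupport_approxKernel_sub (G := fun t => G t + G t)
    (by rw [lintegral_add_left' hGm]; exact ENNReal.add_ne_top.2 ⟨hG, hG⟩)
    (by
      filter_upwards [hGle] with t ht i
      exact (lintegral_transportCommutator_sub_kernel_le _ (hasCompactSupport_approxKernel i.1) _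
        (hasCompactSupport_approxKernel i.2) _ _ _ _).trans (add_le_add (ht i.1) (ht i.2)))
    (by
      filter_upwards [hdiv] with t ht
      have h := tendsto_lintegral_commutator hΩ hp' hq' (ρ t) ht
      have h2 := (h.comp (tendsto_fst (f := atTop) (g := (atTop : Filter ℕ)))).add
        (h.comp (tendsto_snd (f := (atTop : Filter ℕ)) (g := atTop)))
      rw [add_zero] at h2
      exact tendsto_of_tendsto_of_tendsto_of_le_of_le tendsto_const_nhds h2 (fun _ => zero_le)
        fun i => lintegral_transportCommutator_sub_kernel_le _
          (hasCompactSupport_approxKernel i.1) _ (hasCompactSupport_approxKernel i.2) _ _ _ _)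
    (contDiff_sqrt_sq_add hδ) (L := 1) (abs_deriv_sqrt_sq_add_le hδ)
    (lipschitzWith_deriv_sqrt_sq_add hδ) (show 0 < ε / 4 by positivity)
  have hinit := cauchySeq_iff_tendsto.1
    (tendsto_toL1_smoothL_approxKernel (inclL Ω p q ρ₀)).cauchySeq
  rw [← prod_atTop_atTop_eq] at hinit
  filter_upwards [henergy, hinit (Metric.dist_mem_uniformity (show 0 < ε / 4 by positivity))] with i hi hi0 t ht
  refine hεU ?_
  set w := smoothPath (contDiff_approxKernel_sub i) (hasCompactSupport_approxKernel_sub i) ρ₀ u ρ t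
    with hw
  set w₀ := smoothL Ω (contDiff_approxKernel_sub i) (hasCompactSupport_approxKernel_sub i)
    (inclL Ω p q ρ₀) with hw₀
  have e1 : dist (approxPath ρ₀ u ρ i.1 t) (approxPath ρ₀ u ρ i.2 t) = ∫ x, |w x| ∂μ := by
    rw [← norm_toL1, dist_eq_norm, approxPath, approxPath, ← map_sub,
      ← hρ.smoothPath_sub_kernel hu _ _ _ _ (contDiff_approxKernel_sub i)
        (hasCompactSupport_approxKernel_sub i) ht]
  have e2 : ∫ x, |w₀ x| ∂μ < ε / 4 := by
    rw [← norm_toL1, hw₀, smoothL_sub_kernel (contDiff_approxKernel i.1)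
      (hasCompactSupport_approxKernel i.1) (contDiff_approxKernel i.2)
      (hasCompactSupport_approxKernel i.2), map_sub, ← dist_eq_norm]
    exact hi0
  have hcont : Continuous fun x : ℝ => √(x ^ 2 + δ ^ 2) := (contDiff_sqrt_sq_add hδ).continuous
  have e3 : ∫ x, |w x| ∂μ ≤ ∫ x, √(w x ^ 2 + δ ^ 2) ∂μ :=
    integral_mono (integrable_comp_bcf continuous_abs w) (integrable_comp_bcf hcont w)
      fun x => abs_le_sqrt_sq_add δ (w x)
  have e4 : ∫ x, √(w₀ x ^ 2 + δ ^ 2) ∂μ ≤ (∫ x, |w₀ x| ∂μ) + δ * μ.real univ := by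
    have h := integral_mono (integrable_comp_bcf (μ := μ) hcont w₀)
      ((integrable_comp_bcf (μ := μ) continuous_abs w₀).add (integrable_const δ))
      fun x => sqrt_sq_add_le hδ (w₀ x)
    refine h.trans (le_of_eq ?_)
    have h2 := integral_add (integrable_comp_bcf (μ := μ) continuous_abs w₀) (integrable_const δ)
    rw [integral_const, smul_eq_mul, mul_comm (μ.real univ)] at h2
    exact h2
  have e5 := (abs_le.1 (hi t ht)).2
  rw [e1]
  linarith

/-- The law is identified at every time of `[0, T]`, not only almost every one, because the energy
estimate is uniform in time along the continuous paths. -/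
theorem IsWeakSolution.exists_continuousOn_L1 (hΩ : IsSmoothDomain Ω) (hp' : p ≠ ⊤)
    (hq' : q ≠ ⊤) (hT : 0 < T) (hu : Integrable u (volume.restrict (Ioo 0 T)))
    (hdiv : ∀ᵐ t ∂volume.restrict (Ioo 0 T), IsDivergenceFree Ω (SobolevWZero.field (u t)))
    (hρ : IsWeakSolution Ω T p (fun t => (SobolevWZero.field (u t))) ρ₀ ρ) :
    ∃ R : ℝ → LpOn Ω 1 ℝ, ContinuousOn R (Icc 0 T) ∧
      (∀ᵐ t ∂volume.restrict (Ioo 0 T), R t = inclL Ω p q (ρ t)) ∧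
      ∀ t ∈ Icc 0 T, ProbabilityTheory.IdentDistrib (R t) ρ₀
        (volume.restrict (Ω : Set (EuclideanSpace ℝ (Fin N))))
        (volume.restrict (Ω : Set (EuclideanSpace ℝ (Fin N)))) := by
  obtain ⟨R, hRc, hR⟩ := exists_tendstoUniformlyOn_of_cauchy
    (hρ.uniformCauchySeqOn_approxPath hΩ hp' hq' hT hu hdiv) (hρ.continuousOn_approxPath hu hT)
  refine ⟨R, hRc, ?_, fun t ht => ?_⟩
  · have h := ae_all_iff.2 fun n => hρ.smoothL_eq_add_integral hΩ hq' hT hu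
      (contDiff_approxKernel n) (hasCompactSupport_approxKernel n)
    -- Outside one null set the `n`-th path is the mollification of `ρ t` for every `n`, and these
    -- tend to `ρ t` in `L^1`.
    filter_upwards [h, ae_restrict_mem measurableSet_Ioo] with t ht hmem
    refine tendsto_nhds_unique (hR t (Ioo_subset_Icc_self hmem)) ?_
    refine (tendsto_toL1_smoothL_approxKernel (inclL Ω p q (ρ t))).congr fun n => ?_
    rw [ht n]
    rfl
  obtain ⟨G, hGm, hG, hGle⟩ := hρ.exists_commutator_majorant hΩ hq' hu hdiv
  -- The integral of `β` is conserved: the energy at time `t` and at time zero differ by a quantity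
  -- that vanishes as the mollification is removed, and both converge since `β` is Lipschitz.
  have key : ∀ {β : ℝ → ℝ}, ContDiff ℝ ∞ β → ∀ {L M : NNReal}, (∀ x, |deriv β x| ≤ L) →
      LipschitzWith M (deriv β) → ∫ x in (Ω : Set (EuclideanSpace ℝ (Fin N))), β (R t x) =
        ∫ x in (Ω : Set (EuclideanSpace ℝ (Fin N))), β (ρ₀ x) := by
    intro β hβ L M hL hM
    have hlip : LipschitzWith L β :=
      lipschitzWith_of_nnnorm_deriv_le (hβ.differentiable (by simp)) fun x => by
        rw [← NNReal.coe_le_coe, coe_nnnorm]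
        exact hL x
    have hcont := continuous_integral_comp_of_lipschitz
      (μ := volume.restrict (Ω : Set (EuclideanSpace ℝ (Fin N)))) hlip
    have h1 := (hcont.tendsto _).comp (hR t ht)
    have h2 := (hcont.tendsto _).comp (tendsto_toL1_smoothL_approxKernel (inclL Ω p q ρ₀))
    have h3 : ∫ x in (Ω : Set (EuclideanSpace ℝ (Fin N))), β (inclL Ω p q ρ₀ x) =
        ∫ x in (Ω : Set (EuclideanSpace ℝ (Fin N))), β (ρ₀ x) := by
      refine integral_congr_ae ?_
      filter_upwards [coeFn_inclL (q := q) ρ₀] with x hx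
      rw [hx]
    rw [← h3, ← sub_eq_zero]
    refine tendsto_nhds_unique (h1.sub h2) ?_
    rw [Metric.tendsto_nhds]
    intro ε hε
    filter_upwards [hρ.eventually_energy_le hΩ hq' hT hu hdiv contDiff_approxKernel
      hasCompactSupport_approxKernel hG hGle (by
        filter_upwards [hdiv] with t ht
        exact tendsto_lintegral_commutator hΩ hp' hq' (ρ t) ht) hβ hL hM (half_pos hε)] with n hn
    rw [Real.dist_eq, sub_zero]
    refine lt_of_le_of_lt ?_ (half_lt_self hε)
    simp only [Function.comp_apply, approxPath]
    rw [integral_comp_toL1, integral_comp_toL1]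
    exact hn t ht
  have hb : ∀ ξ c : ℝ, |c| ≤ 1 → |c * ξ| ≤ ‖ξ‖₊ := fun ξ c hc => by
    rw [abs_mul]
    exact mul_le_of_le_one_left (abs_nonneg _) hc
  have hdcos : ∀ ξ : ℝ, deriv (fun x => Real.cos (ξ * x)) = fun x => -Real.sin (ξ * x) * ξ :=
    fun ξ => funext fun x => by
      simpa using (((hasDerivAt_id x).const_mul ξ).cos).deriv
  have hdsin : ∀ ξ : ℝ, deriv (fun x => Real.sin (ξ * x)) = fun x => Real.cos (ξ * x) * ξ :=
    fun ξ => funext fun x => by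
      simpa using (((hasDerivAt_id x).const_mul ξ).sin).deriv
  have hlipmul : ∀ ξ : ℝ, LipschitzWith ‖ξ‖₊ fun x => ξ * x := fun ξ => lipschitzWith_smul ξ
  have hlipmul' : ∀ ξ : ℝ, LipschitzWith ‖ξ‖₊ fun x => x * ξ := fun ξ => by
    simpa only [mul_comm] using hlipmul ξ
  refine identDistrib_of_integral_cos_sin (Lp.aestronglyMeasurable _).aemeasurable
    (Lp.aestronglyMeasurable _).aemeasurable (fun ξ => ?_) fun ξ => ?_
  · refine key (β := fun x => Real.cos (ξ * x)) (L := ‖ξ‖₊) (M := ‖ξ‖₊ * (1 * ‖ξ‖₊)) (by fun_prop)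
      (fun x => ?_) ?_
    · rw [hdcos]
      exact hb ξ _ (by rw [abs_neg]; exact Real.abs_sin_le_one _)
    · rw [hdcos]
      exact (hlipmul' ξ).comp (Real.lipschitzWith_sin.comp (hlipmul ξ)).neg
  · refine key (β := fun x => Real.sin (ξ * x)) (L := ‖ξ‖₊) (M := ‖ξ‖₊ * (1 * ‖ξ‖₊)) (by fun_prop)
      (fun x => ?_) ?_
    · rw [hdsin]
      exact hb ξ _ (Real.abs_cos_le_one _)
    · rw [hdsin]
      exact (hlipmul' ξ).comp (Real.lipschitzWith_cos.comp (hlipmul ξ))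

end Conclusion

/-! ### Continuity in `L^p`. -/

theorem mainTheorem6 {N : ℕ} (Ω : Opens (EuclideanSpace ℝ (Fin N))) (hΩ : IsSmoothDomain Ω)
    (T : ℝ) (hT : 0 < T) (p q : ℝ≥0∞) [Fact (1 ≤ p)] [Fact (1 ≤ q)]
    (hp : 1 < p) (hp' : p < ⊤) (hpq : ENNReal.HolderConjugate p q)
    (ρ₀ : LpOn Ω p ℝ)
    (u : ℝ → SobolevWZero Ω q) (hu : Integrable u (volume.restrict (Ioo 0 T)))
    (hdiv : ∀ᵐ t ∂volume.restrict (Ioo 0 T), IsDivergenceFree Ω (SobolevWZero.field (u t)))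
    (ρ : ℝ → LpOn Ω p ℝ) (hρ : IsWeakSolution Ω T p (fun t => (SobolevWZero.field (u t))) ρ₀ ρ) :
    ∃ r : ℝ → LpOn Ω p ℝ, ContinuousOn r (Icc 0 T) ∧ ρ =ᵐ[volume.restrict (Ioo 0 T)] r := by
  have := hΩ.isFiniteMeasure
  -- The strict inequality `1 < p` makes `q` finite, as the translation estimates for the field
  -- require.
  have hq' : q ≠ ⊤ := ((ENNReal.HolderConjugate.lt_top_iff_one_lt q p).2 hp).ne
  obtain ⟨R, hRc, hRρ, hRi⟩ := hρ.exists_continuousOn_L1 hΩ hp'.ne hq' hT hu hdiv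
  obtain ⟨r, hr, hrR⟩ := exists_continuousOn_Lp_of_identDistrib hp'.ne hRc (Lp.memLp ρ₀) hRi
  refine ⟨r, hr, ?_⟩
  filter_upwards [hRρ, ae_restrict_mem measurableSet_Ioo] with t h1 h2
  refine Lp.ext ?_
  have h3 := hrR t (Ioo_subset_Icc_self h2)
  rw [h1] at h3
  exact ((coeFn_inclL (q := q) (ρ t)).symm.trans h3.symm)
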